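/- **Theorem (hook length property for swivel shifteds).** Let $n\ge 3$, $k\ge 1$, $\epsilon\in\{0,1\}$ be integers and let $\lambda=(\lambda_1\ge\dots\ge\lambda_n\ge 0)$ be a partition of length at most $n$. Let $P=P_{n+1}^{\lambda_1+n-1}(X_{11})$ (class 11, swivel shifteds) with $$X_{11}=\{(\lambda,n,1),\ ((k-1),3,n-1),\ (\emptyset,2,n),\ ((\epsilon),1,1)\}\cup\{(\emptyset,2,i):1\le i\le n-2\}.$$ Then $P$ has the hook length property: $P$ is $d$-complete, and, as formal power series in $q$, $$\sum_{\sigma}q^{|\sigma|}=\prod_{x\in P}\frac{1}{1-q^{h(x)}},$$ where the sum is over all $P$-partitions, i.e. all order-reversing maps $\sigma:P\to\mathbb N=\{0,1,2,\dots\}$, and $|\sigma|=\sum_{x\in P}\sigma(x)$. The notions used are the following. *The posets $P_N^m(X)$.* For a strict partition $\nu$, the shifted Young poset $\nu^*$ consists of the cells $(r,c)$ with $\nu_r>0$ and $r\le c\le r+\nu_r-1$, where $(r,c)\le(r',c')$ iff $r\ge r'$ and $c\ge c'$; its diagonal cells are the $(r,r)$. Let $\delta_m=(m-1,\dots,1,0)$.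 For a finite family $X$ of triples $(\lambda^{(i)},n_i,s_i)$, with $n_i,s_i\ge1$, $s_i+n_i-1\le N$ and $\lambda^{(i)}$ a partition of length at most $n_i$, $P_N(X)$ is obtained from the disjoint union of a chain $x_1<\dots<x_N$ and the posets $(\lambda^{(i)}+\delta_{n_i+1})^*$ by identifying, for every $i$, the diagonal cells $(1,1),(2,2),\dots,(n_i,n_i)$ of the $i$-th poset with $x_{s_i+n_i-1},x_{s_i+n_i-2},\dots,x_{s_i}$, the order being generated by the orders of the pieces. $P_N^m(X)$ is obtained from $P_N(X)$ by attaching a chain of $m$ elements above its maximum $x_N$. *$d$-complete posets.* For $k\ge3$ the double-tailed diamond $d_k(1)$ is the poset with $2k-2$ elements that consists of two incomparable elements (the sides), a chain of $k-2$ elements above both of them (the neck) and a chain of $k-2$ elements below both. A $d_k$-interval is an interval $[w,z]$ isomorphic to $d_k(1)$; a $d_k^-$-convex set is a convex subset isomorphic to $d_k(1)$ minus its maximum. A poset is $d$-complete if for all $k\ge3$: (1) for every $d_k^-$-convex set $I$ there is an element $z$ covering all maximal elements of $I$ such that $I\cup\{z\}$ is a $d_k$-interval; (2) if $[w,z]$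 is a $d_k$-interval, then $z$ covers no element outside $[w,z]$; (3) no two distinct $d_k^-$-convex sets differ only in their minimal elements. *Hook lengths.* If $z$ is not in the neck of any $d_k$-interval, then $h(z)$ is the number of elements $\le z$. Otherwise there is a unique $w$ such that $[w,z]$ is a $d_\ell$-interval for some $\ell$, and $h(z)=h(x)+h(y)-h(w)$, where $x,y$ are the sides of $[w,z]$. -/

import Mathlib

namespace DComplete

/-! ### `P`-partitions -/

/-- The `P`-partition generating function `∑_σ q^|σ|`, as a formal power series in `q`: the
coefficient of `q^N` is the number of order-reversing maps `σ : P → ℕ` with `∑ x, σ x = N`. -/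
noncomputable def GF (P : Type) [PartialOrder P] [Fintype P] : PowerSeries ℚ :=
  PowerSeries.mk fun N => (Nat.card {σ : P → ℕ // Antitone σ ∧ ∑ x, σ x = N} : ℚ)

/-! ### `d`-complete posets -/

/-- The double-tailed diamond `d_k(1)` for `k ≥ 3`. It is graded with ranks `0, …, 2k-4`; there is
one element `(r, false)` of each rank `r`, and one further element `(k-2, true)` in the middle rank,
so that `(k-2, false)` and `(k-2, true)` are the two sides of the diamond. -/
@[ext]
structure DoubleTailedDiamond (k : ℕ) where
  /-- the rank -/
  rank : ℕ
  /-- `true` for the second element of the middle rank, `false` for all others -/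
  second : Bool
  rank_le : rank ≤ 2 * k - 4
  rank_eq : second = true → rank = k - 2

/-- Elements of different ranks are ordered by rank, the two sides are incomparable. -/
instance (k : ℕ) : PartialOrder (DoubleTailedDiamond k) where
  le p q := p = q ∨ p.rank < q.rank
  le_refl p := Or.inl rfl
  le_trans p q r := by
    rintro (rfl | h) (rfl | h')
    · exact Or.inl rfl
    · exact Or.inr h'
    · exact Or.inr h
    · exact Or.inr (h.trans h')
  le_antisymm p q := by
    rintro (rfl | h) (h' | h')
    · rfl
    · rfl
    · exact h'.symm
    · exact absurd h' (by omega)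

section

variable {P : Type} [PartialOrder P]

/-- The interval `[w, z]` is a `d_k`-interval. -/
def IsDInterval (k : ℕ) (w z : P) : Prop :=
  3 ≤ k ∧ Nonempty (Set.Icc w z ≃o DoubleTailedDiamond k)

/-- The set `I` is a `d_k⁻`-convex set: it is convex and isomorphic to `d_k(1)` without its maximal
element. -/
def IsDMinusConvex (k : ℕ) (I : Set P) : Prop :=
  3 ≤ k ∧ I.OrdConnected ∧ Nonempty (I ≃o {p : DoubleTailedDiamond k // ¬ IsMax p})

variable (P) in
/-- `d`-complete posets. -/
structure IsDComplete : Prop where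
  /-- Every `d_k⁻`-convex set is completed to a `d_k`-interval by an element covering its maximal
  element(s). -/
  exists_top : ∀ (k : ℕ) (I : Set P), IsDMinusConvex k I →
    ∃ w z : P, (∀ m, Maximal (· ∈ I) m → m ⋖ z) ∧ insert z I = Set.Icc w z ∧ IsDInterval k w z
  /-- The top of a `d_k`-interval covers no element outside of it. -/
  covBy_mem : ∀ (k : ℕ) (w z : P), IsDInterval k w z → ∀ y, y ⋖ z → y ∈ Set.Icc w z
  /-- No two `d_k⁻`-convex sets differ only in their minimal elements. -/
  bot_unique : ∀ (k : ℕ) (I J : Set P) (v w : P), IsDMinusConvex k I → IsDMinusConvex k J →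
    IsLeast I v → IsLeast J w → I \ {v} = J \ {w} → v = w

/-- `[w, z]` is a `d_k`-interval for some `k`, and `x`, `y` are its two incomparable elements. -/
def IsDIntervalWithSides (w x y z : P) : Prop :=
  (∃ k, IsDInterval k w z) ∧ x ∈ Set.Icc w z ∧ y ∈ Set.Icc w z ∧ ¬ x ≤ y ∧ ¬ y ≤ x

theorem IsDIntervalWithSides.lt {w x y z : P} (h : IsDIntervalWithSides w x y z) :
    x < z ∧ y < z ∧ w < z := by
  obtain ⟨-, hx, hy, hxy, hyx⟩ := h
  have hxz : x < z := lt_of_le_of_ne hx.2 fun e => hyx (e ▸ hy.2)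
  have hyz : y < z := lt_of_le_of_ne hy.2 fun e => hxy (e ▸ hx.2)
  exact ⟨hxz, hyz, hx.1.trans_lt hxz⟩

open Classical in
/-- The hook length of `z`. If `z` is in the neck of a `d_k`-interval, equivalently if `z` is the
top of some `d_ℓ`-interval `[w, z]` (remove the same number of elements from both ends), then
`h z = h x + h y - h w` where `x`, `y` are the sides of `[w, z]`; otherwise `h z` is the number of
elements `≤ z`. In a `d`-complete poset `w` is determined by `z`, and `{x, y}` by `[w, z]`. -/
noncomputable def hookLength [Finite P] (z : P) : ℕ :=
  if h : ∃ t : P × P × P, IsDIntervalWithSides t.1 t.2.1 t.2.2 z then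
    hookLength h.choose.2.1 + hookLength h.choose.2.2 - hookLength h.choose.1
  else Nat.card (Set.Iic z)
termination_by (wellFounded_lt (α := P)).wrap z
decreasing_by
  · exact h.choose_spec.lt.1
  · exact h.choose_spec.lt.2.1
  · exact h.choose_spec.lt.2.2

end

/-- `P` is a `d`-complete poset that satisfies the hook length formula
`∑_σ q^|σ| = ∏_{x ∈ P} 1 / (1 - q^{h(x)})`, an identity of formal power series in `q`. -/
def HasHookLengthProperty (P : Type) [PartialOrder P] [Fintype P] : Prop :=
  IsDComplete P ∧
    GF P = ∏ x : P, (1 - (PowerSeries.X : PowerSeries ℚ) ^ hookLength x)⁻¹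

/-! ### The posets `P_n(X)` and `P_n^m(X)` -/

/-- `lam ∈ Par_n`: a partition of length at most `n`, with parts `lam 0 ≥ lam 1 ≥ ⋯` and
`lam i = 0` for `i ≥ n`. -/
def IsPar (n : ℕ) (lam : ℕ → ℕ) : Prop := Antitone lam ∧ ∀ i, n ≤ i → lam i = 0

/-- The staircase partition `δ_n = (n-1, n-2, …, 1, 0)`. -/
def staircase (n : ℕ) : ℕ → ℕ := fun i => n - 1 - i

/-- A triple `(λ, n_i, s_i)`, where `λ ∈ Par_{n_i}`. It describes the shifted Young poset of
`λ + δ_{n_i + 1}`, whose `n_i` diagonal cells are to be identified with the diagonal entries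
`x_{s_i} < ⋯ < x_{s_i + n_i - 1}`. -/
structure Block where
  /-- the partition `λ` -/
  part : ℕ → ℕ
  /-- the number `n_i` of diagonal cells -/
  size : ℕ
  /-- the index `s_i` of the smallest diagonal entry used -/
  start : ℕ

namespace Block

/-- The cells `(r, c)` off the diagonal, `r < c`, of the shifted Young diagram of
`λ + δ_{n_i + 1}`. Rows and columns are numbered from `0`; row `r` occupies the columns
`r, …, r + (λ + δ_{n_i + 1})_r - 1`, and its leftmost cell `(r, r)` is the diagonal cell. -/
abbrev OffCell (B : Block) : Type :=
  Σ r : Fin B.size, Finset.Ioo (r : ℕ) (r + (B.part r + staircase (B.size + 1) r))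

/-- The pair (row, column) of a cell off the diagonal. -/
def OffCell.pos {B : Block} (c : B.OffCell) : ℕ × ℕ := (c.1, c.2)

/-- The index of the diagonal entry identified with the diagonal cell `(r, r)`: the top one,
`r = 0`, is `x_{s_i + n_i - 1}`, and the bottom one, `r = n_i - 1`, is `x_{s_i}`. -/
def diagIndex (B : Block) (r : ℕ) : ℕ := B.start + (B.size - 1 - r)

end Block

/-- The order of a (shifted) Young poset: `p ≤ q` if the cell `p` is weakly below and weakly to the
right of the cell `q`. -/
def CellLE (p q : ℕ × ℕ) : Prop := q.1 ≤ p.1 ∧ q.2 ≤ p.2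

/-- The elements of `P_n(X)` for a family `X` of triples: the diagonal entries `x_1, …, x_n`, and
for each triple of the family the cells off the diagonal of its shifted Young diagram. -/
def PosetP {ι : Type} (n : ℕ) (X : ι → Block) : Type :=
  Finset.Icc 1 n ⊕ Σ i : ι, (X i).OffCell

namespace PosetP

variable {ι : Type} {n : ℕ} {X : ι → Block}

instance [Fintype ι] : Fintype (PosetP n X) :=
  inferInstanceAs (Fintype (Finset.Icc 1 n ⊕ Σ i : ι, (X i).OffCell))

/-- The order of `P_n(X)`, that is, of the chain `x_1 < ⋯ < x_n` and the shifted Young posets of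
all triples, glued along the diagonal entries: elements of the same piece are ordered as in this
piece, and elements of different pieces through diagonal entries. -/
def LE' : PosetP n X → PosetP n X → Prop
  | .inl a, .inl b => (a : ℕ) ≤ b
  | .inl a, .inr ⟨j, d⟩ =>
      ∃ s < (X j).size, (a : ℕ) ≤ (X j).diagIndex s ∧ CellLE (s, s) d.pos
  | .inr ⟨i, c⟩, .inl b =>
      ∃ r < (X i).size, CellLE c.pos (r, r) ∧ (X i).diagIndex r ≤ b
  | .inr ⟨i, c⟩, .inr ⟨j, d⟩ =>
      (i = j ∧ CellLE c.pos d.pos) ∨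
      ∃ r < (X i).size, ∃ s < (X j).size,
        CellLE c.pos (r, r) ∧ (X i).diagIndex r ≤ (X j).diagIndex s ∧ CellLE (s, s) d.pos

theorem LE'.refl (u : PosetP n X) : LE' u u := by
  rcases u with a | ⟨i, c⟩
  · exact le_refl (a : ℕ)
  · exact Or.inl ⟨rfl, le_refl _, le_refl _⟩

theorem LE'.trans {u v w : PosetP n X} (huv : LE' u v) (hvw : LE' v w) : LE' u w := by
  rcases u with a | ⟨i, c⟩ <;> rcases v with b | ⟨j, d⟩ <;> rcases w with e | ⟨l, f⟩ <;>
    simp only [LE', CellLE, Block.diagIndex] at huv hvw ⊢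
  · omega
  · obtain ⟨s, hs, h⟩ := hvw
    exact ⟨s, hs, by omega⟩
  · obtain ⟨s, hs, h⟩ := huv
    obtain ⟨r, hr, h'⟩ := hvw
    omega
  · obtain ⟨s, hs, h⟩ := huv
    rcases hvw with ⟨rfl, h'⟩ | ⟨r, hr, t, ht, h'⟩
    · exact ⟨s, hs, by omega⟩
    · exact ⟨t, ht, by omega⟩
  · obtain ⟨r, hr, h⟩ := huv
    exact ⟨r, hr, by omega⟩
  · obtain ⟨r, hr, h⟩ := huv
    obtain ⟨s, hs, h'⟩ := hvw
    exact Or.inr ⟨r, hr, s, hs, by omega⟩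
  · obtain ⟨t, ht, h'⟩ := hvw
    rcases huv with ⟨rfl, h⟩ | ⟨r, hr, s, hs, h⟩
    · exact ⟨t, ht, by omega⟩
    · exact ⟨r, hr, by omega⟩
  · rcases huv with ⟨rfl, h⟩ | ⟨r, hr, s, hs, h⟩ <;>
      rcases hvw with ⟨rfl, h'⟩ | ⟨r', hr', s', hs', h'⟩
    · exact Or.inl ⟨rfl, by omega⟩
    · exact Or.inr ⟨r', hr', s', hs', by omega⟩
    · exact Or.inr ⟨r, hr, s, hs, by omega⟩
    · exact Or.inr ⟨r, hr, s', hs', by omega⟩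

theorem LE'.antisymm {u v : PosetP n X} (huv : LE' u v) (hvu : LE' v u) : u = v := by
  rcases u with a | ⟨i, c⟩ <;> rcases v with b | ⟨j, d⟩ <;>
    simp only [LE', CellLE, Block.diagIndex] at huv hvu
  · exact congrArg Sum.inl (Subtype.ext (le_antisymm huv hvu))
  · have hd : d.pos.1 < d.pos.2 := (Finset.mem_Ioo.1 d.2.2).1
    obtain ⟨s, hs, h⟩ := huv
    obtain ⟨r, hr, h'⟩ := hvu
    omega
  · have hc : c.pos.1 < c.pos.2 := (Finset.mem_Ioo.1 c.2.2).1
    obtain ⟨s, hs, h⟩ := huv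
    obtain ⟨r, hr, h'⟩ := hvu
    omega
  · have hc : c.pos.1 < c.pos.2 := (Finset.mem_Ioo.1 c.2.2).1
    have hd : d.pos.1 < d.pos.2 := (Finset.mem_Ioo.1 d.2.2).1
    rcases huv with ⟨rfl, h⟩ | ⟨r, hr, s, hs, h⟩ <;>
      rcases hvu with ⟨hij, h'⟩ | ⟨r', hr', s', hs', h'⟩
    · obtain ⟨⟨c1, hc1⟩, ⟨c2, hc2⟩⟩ := c
      obtain ⟨⟨d1, hd1⟩, ⟨d2, hd2⟩⟩ := d
      simp only [Block.OffCell.pos] at h h'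
      obtain rfl : c1 = d1 := by omega
      obtain rfl : c2 = d2 := by omega
      rfl
    · omega
    · subst hij
      omega
    · omega

instance : PartialOrder (PosetP n X) where
  le := LE'
  le_refl := LE'.refl
  le_trans _ _ _ := LE'.trans
  le_antisymm _ _ := LE'.antisymm

/-- The diagonal entry `x_n` is the maximum of `P_n(X)`. -/
theorem le_diag (hX : ∀ i, (X i).start + (X i).size - 1 ≤ n) (hn : n ∈ Finset.Icc 1 n)
    (u : PosetP n X) : u ≤ (Sum.inl ⟨n, hn⟩ : PosetP n X) := by
  rcases u with a | ⟨i, c⟩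
  · exact (Finset.mem_Icc.1 a.2).2
  · have h0 : 0 < (X i).size := lt_of_le_of_lt (Nat.zero_le _) c.1.2
    refine ⟨0, h0, ⟨Nat.zero_le _, Nat.zero_le _⟩, ?_⟩
    have := hX i
    simp only [Block.diagIndex]
    omega

end PosetP

/-- `P_n^m(X)`: a chain with `m` elements attached above `x_n`. Since `x_n` is the maximum of
`P_n(X)`, this is the ordinal sum of `P_n(X)` and the chain. -/
abbrev PosetPm {ι : Type} (n : ℕ) (X : ι → Block) (m : ℕ) : Type := PosetP n X ⊕ₗ Fin m

/-! ### Class 11 -/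

/-- The family
`X₁₁ = {(λ, n, 1), ((k-1), 3, n-1), (∅, 2, n), ((ε), 1, 1)} ∪ {(∅, 2, i) : 1 ≤ i ≤ n-2}`. -/
def X11 (n k ε : ℕ) (lam : ℕ → ℕ) : Fin 4 ⊕ Fin (n - 2) → Block
  | .inl j => ![⟨lam, n, 1⟩, ⟨Pi.single 0 (k - 1), 3, n - 1⟩, ⟨0, 2, n⟩, ⟨Pi.single 0 ε, 1, 1⟩] j
  | .inr i => ⟨0, 2, i + 1⟩

/-- The semi-irreducible `d`-complete posets of class 11 (swivel shifteds),
`P_{n+1}^{λ₁+n-1}(X₁₁)`; the largest part `λ₁` is `lam 0`. -/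
abbrev SwivelShifted (n k ε : ℕ) (lam : ℕ → ℕ) : Type :=
  PosetPm (n + 1) (X11 n k ε lam) (lam 0 + n - 1)

end DComplete

namespace DComplete

/-! ### The glued order, tested on single diagonal entries -/

section PosetPOrder

variable {ι : Type} {N : ℕ} {X : ι → Block}

/-! The swivel shifted is drawn in the plane `ℤ × ℤ` so that its order is the componentwise order
with both coordinates reversed (`plane`, `plane_le`). Covers are then unit steps up or to the left,
apart from the diagonal steps from `(-1, -1)` upwards and one long step at the top of the detached
leg (`step_of_covBy`). Two distinct elements covering a common element span a unit square, so every
diamond has a unit square at its centre, and convexity leaves only three ways to extend it (`DPos`,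
`Diam.classify`): not at all; by one element at each end, for a square on the diagonal; or, for the
square with upper left corner `(-1, -1)`, along row `0` at the bottom and along the chain at the
top. The axioms of `d`-completeness are read off from this list.

The same list gives the hook lengths. Apart from the diagonal above row `0` and the leg, they are a
row contribution plus a column contribution (`hookLength_eq_planeHook`): such a function satisfies
the recursion for unit squares automatically, and the relation `colHook c = rowHook (c + 2)` makes
it satisfy the recursion for the diamonds extended once.

For the generating function, `q` is a real number in `(0, 1)` and all sums converge (`GF_eq_prod`
returns to formal power series). Once the values `y₀ ≤ y₁ ≤ ⋯` on `x_{n+1} > x_n > ⋯` are fixed, the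
blocks are filled independently. The fillings of a block with row lengths `ℓ_j` off the diagonal sum
to `det (q ^ ((Y_i + i) ℓ_j))` up to a constant (`hasSum_filling`): diagonals are peeled off, and
summing over an interlacing sequence turns the determinant for `ℓ - 1` into the one for `ℓ`.

In the variables `w_i = q ^ (y_i + i)` the resulting weight is a homogeneous polynomial: a
determinant for `λ`, a `3 × 3` determinant, differences of neighbouring variables and a power of the
last one. Homogeneity turns the sum over the first entry into a geometric series, and Laplace
expansion along the first row of the determinant for `λ` leads to a shorter chain with one exponent
removed. The sum over the removed exponent is evaluated by Lagrange interpolation: `sum_removal` for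
the tail of the chain (`hasSum_chainWeight`), and `sum_removal_node`, with one additional node, for
the part around the `3 × 3` determinant (`hasSum_swivelWeight`). The outcome is a product.

It remains to recognise that product as the hook product (`hookProduct_mul_swivelValue`). Hooks are
multiplied row by row; the combinatorial input is that the numbers `λ_s + δ_s` of the lower rows and
the gaps of the columns fill an initial interval of `ℕ` (`prod_shiftedPart_mul_prod_columnGap`). -/

theorem Block.OffCell.bounds {B : Block} (c : B.OffCell) :
    c.pos.1 < B.size ∧ c.pos.1 < c.pos.2 ∧
      c.pos.2 < c.pos.1 + (B.part c.pos.1 + staircase (B.size + 1) c.pos.1) :=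
  ⟨c.1.2, Finset.mem_Ioo.1 c.2.2⟩

/-- The diagonal entry `x_a` as an element of `P_N(X)`. -/
def PosetP.diag (X : ι → Block) (a : Finset.Icc 1 N) : PosetP N X := Sum.inl a

/-- An off-diagonal cell of a block as an element of `P_N(X)`. -/
def PosetP.cell (N : ℕ) (i : ι) (c : (X i).OffCell) : PosetP N X := Sum.inr ⟨i, c⟩

theorem PosetP.cases (u : PosetP N X) :
    (∃ a, u = PosetP.diag X a) ∨ ∃ i c, u = PosetP.cell N i c := by
  rcases u with a | ⟨i, c⟩
  · exact Or.inl ⟨a, rfl⟩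
  · exact Or.inr ⟨i, c, rfl⟩

theorem PosetP.diag_le_diag {a b : Finset.Icc 1 N} :
    diag X a ≤ diag X b ↔ (a : ℕ) ≤ b := Iff.rfl

/-- Above a cell, the lowest diagonal cell of its block is the one in the same row; dually, below it
the highest is the one in the same column, if there is one. The existential quantifiers of the order
thus need only one test each. -/
theorem PosetP.cell_le_diag {i : ι} {c : (X i).OffCell} {b : Finset.Icc 1 N} :
    cell N i c ≤ diag X b ↔
      (X i).diagIndex c.pos.1 ≤ b := by
  have hc := c.bounds
  constructor
  · rintro ⟨r, hr, h, h'⟩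
    simp only [CellLE, Block.diagIndex] at *
    omega
  · intro h
    refine ⟨c.pos.1, hc.1, ⟨le_rfl, hc.2.1.le⟩, h⟩

theorem PosetP.diag_le_cell {j : ι} {d : (X j).OffCell} {a : Finset.Icc 1 N} :
    diag X a ≤ cell N j d ↔
      d.pos.2 < (X j).size ∧ (a : ℕ) ≤ (X j).diagIndex d.pos.2 := by
  have hd := d.bounds
  constructor
  · rintro ⟨r, hr, h, h'⟩
    simp only [CellLE, Block.diagIndex] at *
    omega
  · intro h
    exact ⟨d.pos.2, h.1, h.2, hd.2.1.le, le_rfl⟩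

theorem PosetP.cell_le_cell {i j : ι} {c : (X i).OffCell} {d : (X j).OffCell} :
    cell N i c ≤ cell N j d ↔
      (i = j ∧ CellLE c.pos d.pos) ∨
        d.pos.2 < (X j).size ∧ (X i).diagIndex c.pos.1 ≤ (X j).diagIndex d.pos.2 := by
  have hd := d.bounds
  have hc := c.bounds
  constructor
  · rintro (h | ⟨r, hr, s, hs, h⟩)
    · exact Or.inl h
    · right
      simp only [CellLE, Block.diagIndex] at *
      omega
  · rintro (h | h)
    · exact Or.inl h
    · exact Or.inr ⟨_, hc.1, _, h.1, ⟨le_rfl, hc.2.1.le⟩, h.2, hd.2.1.le, le_rfl⟩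

end PosetPOrder

/-! ### The swivel shifted as a subset of the plane -/

/-- The position in the plane of the off-diagonal cell in row `p.1` and column `p.2` of a block
of `X11`. -/
def cellPlane (n : ℕ) : Fin 4 ⊕ Fin (n - 2) → ℕ × ℕ → ℤ × ℤ
  | .inl 0, p => (p.1, p.2)
  -- This block is drawn transposed, and its arm beyond column `2` is moved down to the rows `≥ n +
  -- 1` of column `-1`, where it lies above nothing but itself.
  | .inl 1, p => if p.1 = 1 then (1, 0) else if p.2 = 1 then (0, -1) else
      if p.2 = 2 then (1, -1) else (n + p.2 - 2, -1)
  | .inl 2, _ => (-1, 0)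
  | .inl 3, _ => (n, n - 1)
  | .inr i, _ => (n - i - 1, n - i - 2)

/-- The position in the plane of an element of the main part of a swivel shifted. -/
def basePlane (n k ε : ℕ) (lam : ℕ → ℕ) : PosetP (n + 1) (X11 n k ε lam) → ℤ × ℤ
  | .inl a => ((n : ℤ) - (a : ℕ), (n : ℤ) - (a : ℕ))
  | .inr ⟨i, c⟩ => cellPlane n i c.pos

/-- The position in the plane of an element of a swivel shifted. -/
def plane (n k ε : ℕ) (lam : ℕ → ℕ) (u : SwivelShifted n k ε lam) : ℤ × ℤ :=
  Sum.elim (basePlane n k ε lam) (fun j => (-2 - ((j : ℕ) : ℤ), -2 - ((j : ℕ) : ℤ)))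
    (ofLex (α := PosetP (n + 1) (X11 n k ε lam) ⊕ Fin (lam 0 + n - 1)) u)

/-- The positions in the plane that are occupied by a swivel shifted. -/
def Shape (n k ε : ℕ) (lam : ℕ → ℕ) (r c : ℤ) : Prop :=
  (r = c ∧ -(lam 0 + n : ℤ) ≤ r ∧ r < n) ∨
  (0 ≤ r ∧ r < n ∧ r < c ∧ c ≤ lam r.toNat + n - 1) ∨
  (c = r - 1 ∧ 0 ≤ r ∧ r < n + ε) ∨
  (r = 1 ∧ c = -1) ∨
  (c = -1 ∧ n + 1 ≤ r ∧ r < n + k) ∨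
  (r = -1 ∧ c = 0)

section

variable {n k ε : ℕ} {lam : ℕ → ℕ}

/-- A single table of the cells of all blocks with their block data and positions. With it,
comparing two elements is linear arithmetic in each of finitely many cases. -/
theorem X11_pos_cases (hk : 1 ≤ k) (hε : ε = 0 ∨ ε = 1) (i : Fin 4 ⊕ Fin (n - 2))
    (p : ℕ × ℕ) (hp : p.1 < (X11 n k ε lam i).size ∧ p.1 < p.2 ∧
      p.2 < p.1 + ((X11 n k ε lam i).part p.1 + staircase ((X11 n k ε lam i).size + 1) p.1)) :
    (i = .inl 0 ∧ p.1 < n ∧ p.1 < p.2 ∧ p.2 < lam p.1 + n ∧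
      (X11 n k ε lam i).size = n ∧ (X11 n k ε lam i).start = 1 ∧
      cellPlane n i p = ((p.1 : ℤ), (p.2 : ℤ))) ∨
    (i = .inl 1 ∧ p.1 = 1 ∧ p.2 = 2 ∧
      (X11 n k ε lam i).size = 3 ∧ (X11 n k ε lam i).start = n - 1 ∧
      cellPlane n i p = (1, 0)) ∨
    (i = .inl 1 ∧ p.1 = 0 ∧ p.2 = 1 ∧
      (X11 n k ε lam i).size = 3 ∧ (X11 n k ε lam i).start = n - 1 ∧
      cellPlane n i p = (0, -1)) ∨
    (i = .inl 1 ∧ p.1 = 0 ∧ p.2 = 2 ∧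
      (X11 n k ε lam i).size = 3 ∧ (X11 n k ε lam i).start = n - 1 ∧
      cellPlane n i p = (1, -1)) ∨
    (i = .inl 1 ∧ p.1 = 0 ∧ 3 ≤ p.2 ∧ p.2 ≤ k + 1 ∧
      (X11 n k ε lam i).size = 3 ∧ (X11 n k ε lam i).start = n - 1 ∧
      cellPlane n i p = ((n : ℤ) + p.2 - 2, -1)) ∨
    (i = .inl 2 ∧ p.1 = 0 ∧ p.2 = 1 ∧
      (X11 n k ε lam i).size = 2 ∧ (X11 n k ε lam i).start = n ∧
      cellPlane n i p = (-1, 0)) ∨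
    (i = .inl 3 ∧ p.1 = 0 ∧ p.2 = 1 ∧ 1 ≤ ε ∧
      (X11 n k ε lam i).size = 1 ∧ (X11 n k ε lam i).start = 1 ∧
      cellPlane n i p = ((n : ℤ), (n : ℤ) - 1)) ∨
    (∃ j : Fin (n - 2), i = .inr j ∧ p.1 = 0 ∧ p.2 = 1 ∧
      (X11 n k ε lam i).size = 2 ∧ (X11 n k ε lam i).start = j + 1 ∧
      cellPlane n i p = ((n : ℤ) - j - 1, (n : ℤ) - j - 2)) := by
  obtain ⟨a, b⟩ := p
  rcases i with i | i
  · fin_cases i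
    · left
      simp [X11, staircase] at hp ⊢
      simp [cellPlane]
      omega
    · simp [X11, staircase, Pi.single_apply, cellPlane] at hp ⊢
      split_ifs at hp ⊢ <;> simp_all <;> omega
    · simp [X11, staircase, cellPlane] at hp ⊢
      omega
    · simp [X11, staircase, Pi.single_apply, cellPlane] at hp ⊢
      split_ifs at hp <;> omega
  · simp [X11, staircase, cellPlane] at hp ⊢
    omega

theorem X11_cell_cases (hk : 1 ≤ k) (hε : ε = 0 ∨ ε = 1) (i : Fin 4 ⊕ Fin (n - 2))
    (c : (X11 n k ε lam i).OffCell) :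
    (i = .inl 0 ∧ c.pos.1 < n ∧ c.pos.1 < c.pos.2 ∧ c.pos.2 < lam c.pos.1 + n ∧
      (X11 n k ε lam i).size = n ∧ (X11 n k ε lam i).start = 1 ∧
      cellPlane n i c.pos = ((c.pos.1 : ℤ), (c.pos.2 : ℤ))) ∨
    (i = .inl 1 ∧ c.pos.1 = 1 ∧ c.pos.2 = 2 ∧
      (X11 n k ε lam i).size = 3 ∧ (X11 n k ε lam i).start = n - 1 ∧
      cellPlane n i c.pos = (1, 0)) ∨
    (i = .inl 1 ∧ c.pos.1 = 0 ∧ c.pos.2 = 1 ∧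
      (X11 n k ε lam i).size = 3 ∧ (X11 n k ε lam i).start = n - 1 ∧
      cellPlane n i c.pos = (0, -1)) ∨
    (i = .inl 1 ∧ c.pos.1 = 0 ∧ c.pos.2 = 2 ∧
      (X11 n k ε lam i).size = 3 ∧ (X11 n k ε lam i).start = n - 1 ∧
      cellPlane n i c.pos = (1, -1)) ∨
    (i = .inl 1 ∧ c.pos.1 = 0 ∧ 3 ≤ c.pos.2 ∧ c.pos.2 ≤ k + 1 ∧
      (X11 n k ε lam i).size = 3 ∧ (X11 n k ε lam i).start = n - 1 ∧
      cellPlane n i c.pos = ((n : ℤ) + c.pos.2 - 2, -1)) ∨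
    (i = .inl 2 ∧ c.pos.1 = 0 ∧ c.pos.2 = 1 ∧
      (X11 n k ε lam i).size = 2 ∧ (X11 n k ε lam i).start = n ∧
      cellPlane n i c.pos = (-1, 0)) ∨
    (i = .inl 3 ∧ c.pos.1 = 0 ∧ c.pos.2 = 1 ∧ 1 ≤ ε ∧
      (X11 n k ε lam i).size = 1 ∧ (X11 n k ε lam i).start = 1 ∧
      cellPlane n i c.pos = ((n : ℤ), (n : ℤ) - 1)) ∨
    (∃ j : Fin (n - 2), i = .inr j ∧ c.pos.1 = 0 ∧ c.pos.2 = 1 ∧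
      (X11 n k ε lam i).size = 2 ∧ (X11 n k ε lam i).start = j + 1 ∧
      cellPlane n i c.pos = ((n : ℤ) - j - 1, (n : ℤ) - j - 2)) :=
  X11_pos_cases hk hε i c.pos c.bounds

theorem SwivelShifted.cases (u : SwivelShifted n k ε lam) :
    (∃ a, u = toLex (Sum.inl (PosetP.diag _ a))) ∨
      (∃ i c, u = toLex (Sum.inl (PosetP.cell (n + 1) i c))) ∨ ∃ j, u = toLex (Sum.inr j) := by
  induction u using Lex.rec with | _ u
  rcases u with u | j
  · rcases u.cases with ⟨a, rfl⟩ | ⟨i, c, rfl⟩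
    · exact Or.inl ⟨a, rfl⟩
    · exact Or.inr (Or.inl ⟨i, c, rfl⟩)
  · exact Or.inr (Or.inr ⟨j, rfl⟩)

@[simp] theorem plane_diag (a : Finset.Icc 1 (n + 1)) :
    plane n k ε lam (toLex (Sum.inl (PosetP.diag _ a))) =
      ((n : ℤ) - (a : ℕ), (n : ℤ) - (a : ℕ)) := rfl

@[simp] theorem plane_cell (i : Fin 4 ⊕ Fin (n - 2)) (c : (X11 n k ε lam i).OffCell) :
    plane n k ε lam (toLex (Sum.inl (PosetP.cell (n + 1) i c))) = cellPlane n i c.pos := rfl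

@[simp] theorem plane_chain (j : Fin (lam 0 + n - 1)) :
    plane n k ε lam (toLex (Sum.inr j)) = (-2 - ((j : ℕ) : ℤ), -2 - ((j : ℕ) : ℤ)) := rfl

/-- This replaces the gluing of blocks by coordinates: covers, diamonds and hook lengths are from
here on treated as facts about a set of lattice points. -/
theorem plane_le (hn : 3 ≤ n) (hk : 1 ≤ k) (hε : ε = 0 ∨ ε = 1) (u v : SwivelShifted n k ε lam) :
    u ≤ v ↔ (plane n k ε lam v).1 ≤ (plane n k ε lam u).1 ∧
      (plane n k ε lam v).2 ≤ (plane n k ε lam u).2 := by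
  obtain ⟨a, rfl⟩ | ⟨i, c, rfl⟩ | ⟨s, rfl⟩ := u.cases <;>
    obtain ⟨b, rfl⟩ | ⟨j, d, rfl⟩ | ⟨t, rfl⟩ := v.cases
  · have ha := Finset.mem_Icc.1 a.2
    have hb := Finset.mem_Icc.1 b.2
    rw [Sum.Lex.inl_le_inl_iff, PosetP.diag_le_diag, plane_diag, plane_diag]
    dsimp only
    omega
  · have ha := Finset.mem_Icc.1 a.2
    have hd := d.bounds
    rw [Sum.Lex.inl_le_inl_iff, PosetP.diag_le_cell, plane_diag, plane_cell]
    simp only [Block.diagIndex]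
    rcases X11_cell_cases hk hε j d with h | h | h | h | h | h | h | ⟨j', h⟩ <;>
      obtain ⟨e, h⟩ := h <;> subst e <;> simp only [h] <;> omega
  · have ha := Finset.mem_Icc.1 a.2
    simp only [Sum.Lex.inl_le_inr, plane_diag, plane_chain, true_iff]
    omega
  · have hb := Finset.mem_Icc.1 b.2
    have hc := c.bounds
    rw [Sum.Lex.inl_le_inl_iff, PosetP.cell_le_diag, plane_diag, plane_cell]
    simp only [Block.diagIndex]
    rcases X11_cell_cases hk hε i c with h | h | h | h | h | h | h | ⟨j', h⟩ <;>
      obtain ⟨e, h⟩ := h <;> subst e <;> simp only [h] <;> omega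
  · have hd := d.bounds
    have hc := c.bounds
    rw [Sum.Lex.inl_le_inl_iff, PosetP.cell_le_cell, plane_cell, plane_cell]
    simp only [Block.diagIndex, CellLE]
    rcases X11_cell_cases hk hε i c with h | h | h | h | h | h | h | ⟨i', h⟩ <;>
    rcases X11_cell_cases hk hε j d with h' | h' | h' | h' | h' | h' | h' | ⟨j', h'⟩ <;>
      obtain ⟨e, h⟩ := h <;> obtain ⟨e', h'⟩ := h' <;> subst e <;> subst e' <;>
      simp only [h, h', reduceCtorEq, Sum.inl.injEq, Sum.inr.injEq, Fin.ext_iff, Fin.isValue] <;>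
      simp <;> omega
  · simp only [Sum.Lex.inl_le_inr, plane_cell, plane_chain, true_iff]
    rcases X11_cell_cases hk hε i c with h | h | h | h | h | h | h | ⟨j', h⟩ <;>
      obtain ⟨e, h⟩ := h <;> subst e <;> simp only [h] <;> omega
  · have hb := Finset.mem_Icc.1 b.2
    simp only [Sum.Lex.not_inr_le_inl, plane_diag, plane_chain, false_iff]
    omega
  · simp only [Sum.Lex.not_inr_le_inl, plane_cell, plane_chain, false_iff]
    rcases X11_cell_cases hk hε j d with h | h | h | h | h | h | h | ⟨j', h⟩ <;>
      obtain ⟨e, h⟩ := h <;> subst e <;> simp only [h] <;> omega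
  · simp only [Sum.Lex.inr_le_inr_iff, plane_chain, Fin.le_def]
    omega

end

/-! ### Diamonds as a chain with one additional element -/

section Diamond

variable {P : Type} [PartialOrder P]

/-- The elements `s 0 < ⋯ < s t` together with `y`, which is incomparable to `s (a + 1)` and
comparable to all others, form the elements of rank at most `t` of a double-tailed diamond
`d_{a+3}(1)`. -/
structure Diam (a t : ℕ) (s : ℕ → P) (y : P) : Prop where
  lt : ∀ i j, i < j → j ≤ t → s i < s j
  below : ∀ i, i ≤ a → s i < y
  above : ∀ i, a + 2 ≤ i → i ≤ t → y < s i
  not_le : ¬ y ≤ s (a + 1)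
  not_ge : ¬ s (a + 1) ≤ y

/-- The set of the elements of a partial diamond. -/
def diamSet (t : ℕ) (s : ℕ → P) (y : P) : Set P := {p | p = y ∨ ∃ i ≤ t, p = s i}

theorem DoubleTailedDiamond.le_def {k : ℕ} {p q : DoubleTailedDiamond k} :
    p ≤ q ↔ p = q ∨ p.rank < q.rank := Iff.rfl

theorem DoubleTailedDiamond.not_isMax_iff {a : ℕ} (p : DoubleTailedDiamond (a + 3)) :
    ¬ IsMax p ↔ p.rank ≤ 2 * a + 1 := by
  have hp := p.rank_le
  constructor
  · intro h
    by_contra! h'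
    apply h
    intro q hq
    rcases hq with rfl | hq
    · exact le_rfl
    · have := q.rank_le
      omega
  · intro h hm
    have := hm (b := ⟨2 * a + 2, false, by omega, by simp⟩) (Or.inr (by simp; omega))
    rcases this with h' | h'
    · rw [← h'] at h
      simp at h
    · simp at h'
      omega

/-- All elements of `d_{a+3}(1)` have rank at most `2 a + 2`. -/
def DoubleTailedDiamond.isoRankLe (a : ℕ) :
    DoubleTailedDiamond (a + 3) ≃o {p : DoubleTailedDiamond (a + 3) // p.rank ≤ 2 * a + 2} :=
  OrderIso.Set.univ.symm.trans (OrderIso.setCongr Set.univ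
    {p : DoubleTailedDiamond (a + 3) | p.rank ≤ 2 * a + 2}
    (by ext p; have := p.rank_le; simp; omega))

/-- The parameter `t` serves two purposes at once: `t = 2 * a + 2` gives the whole diamond
`d_{a+3}(1)`, and `t = 2 * a + 1` gives it without its maximum. -/
theorem Diam.orderIso {a t : ℕ} {s : ℕ → P} {y : P} (h : Diam a t s y) (ha : a + 1 ≤ t)
    (ht : t ≤ 2 * a + 2) :
    Nonempty (diamSet t s y ≃o {p : DoubleTailedDiamond (a + 3) // p.rank ≤ t}) := by
  let f : {p : DoubleTailedDiamond (a + 3) // p.rank ≤ t} → P :=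
    fun p => if p.1.second then y else s p.1.rank
  have hle : ∀ p q, f p ≤ f q ↔ p ≤ q := by
    rintro ⟨⟨i, b, hi, hi'⟩, hit⟩ ⟨⟨j, b', hj, hj'⟩, hjt⟩
    simp only [f, Subtype.mk_le_mk, DoubleTailedDiamond.le_def, DoubleTailedDiamond.mk.injEq]
    simp only at hit hjt
    have e : a + 3 - 2 = a + 1 := by omega
    rw [e] at hi' hj'
    cases b <;> cases b' <;> simp only [if_true, Bool.false_eq_true, if_false, and_true, and_false,
      false_or, reduceCtorEq]
    · rcases lt_trichotomy i j with h' | h' | h'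
      · simp [h', (h.lt i j h' hjt).le]
      · simp [h']
      · have := h.lt j i h' hit
        simp only [this.not_ge, false_iff]
        omega
    · have := hj' rfl
      rcases lt_trichotomy i (a + 1) with h' | h' | h'
      · have := h.below i (by omega)
        simp only [this.le, true_iff]
        omega
      · subst h'
        simp only [h.not_ge, false_iff]
        omega
      · have := h.above i (by omega) hit
        simp only [this.not_ge, false_iff]
        omega
    · have := hi' rfl
      rcases lt_trichotomy j (a + 1) with h' | h' | h'
      · have := h.below j (by omega)
        simp only [this.not_ge, false_iff]
        omega
      · subst h'
        simp only [h.not_le, false_iff]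
        omega
      · have := h.above j (by omega) hjt
        simp only [this.le, true_iff]
        omega
    · have := hi' rfl
      have := hj' rfl
      simp only [le_refl, true_iff]
      omega
  have hrange : Set.range f = diamSet t s y := by
    ext p
    constructor
    · rintro ⟨⟨⟨i, b, hi, hi'⟩, hit⟩, rfl⟩
      cases b
      · exact Or.inr ⟨i, hit, rfl⟩
      · exact Or.inl rfl
    · rintro (rfl | ⟨i, hi, rfl⟩)
      · exact ⟨⟨⟨a + 1, true, by omega, fun _ => by omega⟩, ha⟩, rfl⟩
      · exact ⟨⟨⟨i, false, by omega, by simp⟩, hi⟩, rfl⟩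
  let e := (OrderEmbedding.ofMapLEIff f hle).orderIso
  exact ⟨(e.trans (OrderIso.setCongr _ _ hrange)).symm⟩

theorem exists_diam_of_orderIso {a t : ℕ} {I : Set P} (ha : a + 1 ≤ t) (ht : t ≤ 2 * a + 2)
    (e : I ≃o {p : DoubleTailedDiamond (a + 3) // p.rank ≤ t}) :
    ∃ s y, Diam a t s y ∧ I = diamSet t s y := by
  let S : ℕ → {p : DoubleTailedDiamond (a + 3) // p.rank ≤ t} := fun i =>
    ⟨⟨min i t, false, by simp; omega, by simp⟩, by simp⟩
  let Y : {p : DoubleTailedDiamond (a + 3) // p.rank ≤ t} :=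
    ⟨⟨a + 1, true, by omega, fun _ => by omega⟩, ha⟩
  have key : ∀ p q, (e.symm p : P) ≤ e.symm q ↔ p ≤ q := fun p q => by
    rw [Subtype.coe_le_coe, e.symm.le_iff_le]
  have key' : ∀ p q, (e.symm p : P) < e.symm q ↔ p < q := fun p q => by
    rw [Subtype.coe_lt_coe, e.symm.lt_iff_lt]
  have hlt : ∀ p q : {p : DoubleTailedDiamond (a + 3) // p.rank ≤ t}, p.1.rank < q.1.rank →
      p < q := by
    intro p q h
    rw [lt_iff_le_and_ne]
    refine ⟨Or.inr h, ?_⟩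
    rintro rfl
    exact lt_irrefl _ h
  refine ⟨fun i => e.symm (S i), e.symm Y, ⟨?_, ?_, ?_, ?_, ?_⟩, ?_⟩
  · intro i j hij hj
    rw [key']
    apply hlt
    simp [S]
    omega
  · intro i hi
    rw [key']
    apply hlt
    simp [S, Y]
    omega
  · intro i hi hit
    rw [key']
    apply hlt
    simp [S, Y]
    omega
  · rw [key]
    simp only [S, Y, Subtype.mk_le_mk, DoubleTailedDiamond.le_def, DoubleTailedDiamond.mk.injEq]
    simp
  · rw [key]
    simp only [S, Y, Subtype.mk_le_mk, DoubleTailedDiamond.le_def, DoubleTailedDiamond.mk.injEq]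
    simp
    omega
  · ext p
    constructor
    · intro hp
      obtain ⟨⟨⟨i, b, hi, hi'⟩, hit⟩, hq⟩ := e.symm.surjective ⟨p, hp⟩
      cases b
      · right
        refine ⟨i, hit, ?_⟩
        have : S i = ⟨⟨i, false, hi, hi'⟩, hit⟩ := by
          simp [S]
          exact hit
        simp only
        rw [this, hq]
      · left
        have : Y = ⟨⟨i, true, hi, hi'⟩, hit⟩ := by
          simp [Y]
          have := hi' rfl
          omega
        rw [this, hq]
    · rintro (rfl | ⟨i, hi, rfl⟩)
      · exact (e.symm Y).2
      · exact (e.symm (S i)).2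

theorem IsDInterval.exists_diam {a : ℕ} {w z : P} (h : IsDInterval (a + 3) w z) :
    ∃ s y, Diam a (2 * a + 2) s y ∧ Set.Icc w z = diamSet (2 * a + 2) s y := by
  obtain ⟨-, ⟨e⟩⟩ := h
  exact exists_diam_of_orderIso (by omega) le_rfl (e.trans (DoubleTailedDiamond.isoRankLe a))

theorem IsDMinusConvex.exists_diam {a : ℕ} {I : Set P} (h : IsDMinusConvex (a + 3) I) :
    ∃ s y, Diam a (2 * a + 1) s y ∧ I = diamSet (2 * a + 1) s y := by
  obtain ⟨-, -, ⟨e⟩⟩ := h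
  refine exists_diam_of_orderIso (by omega) (by omega) (e.trans ?_)
  exact OrderIso.setCongr {p : DoubleTailedDiamond (a + 3) | ¬ IsMax p} {p | p.rank ≤ 2 * a + 1}
    (by ext p; exact DoubleTailedDiamond.not_isMax_iff p)

theorem Diam.isDInterval {a : ℕ} {s : ℕ → P} {y w z : P} (h : Diam a (2 * a + 2) s y)
    (hI : Set.Icc w z = diamSet (2 * a + 2) s y) : IsDInterval (a + 3) w z := by
  refine ⟨by omega, ?_⟩
  obtain ⟨e⟩ := h.orderIso (by omega) le_rfl
  rw [← hI] at e
  exact ⟨e.trans (DoubleTailedDiamond.isoRankLe a).symm⟩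

theorem Diam.lt_iff {a t : ℕ} {s : ℕ → P} {y : P} (h : Diam a t s y) {i j : ℕ} (hi : i ≤ t)
    (hj : j ≤ t) : s i < s j ↔ i < j := by
  refine ⟨fun h' => ?_, fun h' => h.lt i j h' hj⟩
  by_contra! hji
  rcases hji.eq_or_lt with rfl | hji
  · exact lt_irrefl _ h'
  · exact lt_asymm h' (h.lt j i hji hi)

theorem Diam.lt_y_iff {a t : ℕ} {s : ℕ → P} {y : P} (h : Diam a t s y) {i : ℕ} (hi : i ≤ t) :
    s i < y ↔ i ≤ a := by
  refine ⟨fun h' => ?_, fun h' => h.below i h'⟩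
  by_contra! hia
  rcases (show i = a + 1 ∨ a + 2 ≤ i by omega) with rfl | hi'
  · exact h.not_ge h'.le
  · exact lt_asymm h' (h.above i hi' hi)

theorem Diam.y_lt_iff {a t : ℕ} {s : ℕ → P} {y : P} (h : Diam a t s y) {i : ℕ} (hi : i ≤ t) :
    y < s i ↔ a + 2 ≤ i := by
  refine ⟨fun h' => ?_, fun h' => h.above i h' hi⟩
  by_contra! hia
  rcases (show i = a + 1 ∨ i ≤ a by omega) with rfl | hi'
  · exact h.not_le h'.le
  · exact lt_asymm h' (h.below i hi')

theorem Diam.covBy {a t : ℕ} {s : ℕ → P} {y : P} (h : Diam a t s y)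
    (hc : (diamSet t s y).OrdConnected) {i : ℕ} (hi : i + 1 ≤ t) : s i ⋖ s (i + 1) := by
  refine ⟨h.lt _ _ (by omega) hi, fun p h1 h2 => ?_⟩
  have hp : p ∈ diamSet t s y :=
    hc.out (Or.inr ⟨i, by omega, rfl⟩) (Or.inr ⟨i + 1, hi, rfl⟩) ⟨h1.le, h2.le⟩
  rcases hp with rfl | ⟨j, hj, rfl⟩
  · rw [h.lt_y_iff (by omega)] at h1
    rw [h.y_lt_iff (by omega)] at h2
    omega
  · rw [h.lt_iff (by omega) hj] at h1
    rw [h.lt_iff hj (by omega)] at h2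
    omega

theorem Diam.covBy_y {a t : ℕ} {s : ℕ → P} {y : P} (h : Diam a t s y)
    (hc : (diamSet t s y).OrdConnected) (ha : a ≤ t) : s a ⋖ y := by
  refine ⟨h.below _ le_rfl, fun p h1 h2 => ?_⟩
  have hp : p ∈ diamSet t s y :=
    hc.out (Or.inr ⟨a, by omega, rfl⟩) (Or.inl rfl) ⟨h1.le, h2.le⟩
  rcases hp with rfl | ⟨j, hj, rfl⟩
  · exact lt_irrefl _ h2
  · rw [h.lt_iff ha hj] at h1
    rw [h.lt_y_iff hj] at h2
    omega

theorem Diam.y_covBy {a t : ℕ} {s : ℕ → P} {y : P} (h : Diam a t s y)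
    (hc : (diamSet t s y).OrdConnected) (ha : a + 2 ≤ t) : y ⋖ s (a + 2) := by
  refine ⟨h.above _ le_rfl ha, fun p h1 h2 => ?_⟩
  have hp : p ∈ diamSet t s y :=
    hc.out (Or.inl rfl) (Or.inr ⟨a + 2, by omega, rfl⟩) ⟨h1.le, h2.le⟩
  rcases hp with rfl | ⟨j, hj, rfl⟩
  · exact lt_irrefl _ h1
  · rw [h.y_lt_iff hj] at h1
    rw [h.lt_iff hj ha] at h2
    omega

theorem Diam.mem_between {a t : ℕ} {s : ℕ → P} {y : P} (h : Diam a t s y)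
    (hc : (diamSet t s y).OrdConnected) {i j : ℕ} (hj : j ≤ t) (hi : i ≤ t) {p : P}
    (h1 : s i ≤ p) (h2 : p ≤ s j) : p = y ∨ ∃ l, i ≤ l ∧ l ≤ j ∧ p = s l := by
  have hp : p ∈ diamSet t s y :=
    hc.out (Or.inr ⟨i, hi, rfl⟩) (Or.inr ⟨j, hj, rfl⟩) ⟨h1, h2⟩
  rcases hp with rfl | ⟨l, hl, rfl⟩
  · exact Or.inl rfl
  · refine Or.inr ⟨l, ?_, ?_, rfl⟩
    · by_contra! hh
      exact (h.lt _ _ hh hi).not_ge h1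
    · by_contra! hh
      exact (h.lt _ _ hh hl).not_ge h2

/-- The two sides form the only incomparable pair of a diamond. -/
theorem Diam.incomparable {a t : ℕ} {s : ℕ → P} {y : P} (h : Diam a t s y) {p q : P}
    (hp : p ∈ diamSet t s y) (hq : q ∈ diamSet t s y) (hpq : ¬ p ≤ q) (hqp : ¬ q ≤ p) :
    (p = y ∧ q = s (a + 1)) ∨ (p = s (a + 1) ∧ q = y) := by
  rcases hp with rfl | ⟨i, hi, rfl⟩ <;> rcases hq with rfl | ⟨j, hj, rfl⟩
  · exact absurd le_rfl hpq
  · rcases lt_trichotomy j (a + 1) with h' | rfl | h'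
    · exact absurd (h.below j (by omega)).le hqp
    · exact Or.inl ⟨rfl, rfl⟩
    · exact absurd (h.above j (by omega) hj).le hpq
  · rcases lt_trichotomy i (a + 1) with h' | rfl | h'
    · exact absurd (h.below i (by omega)).le hpq
    · exact Or.inr ⟨rfl, rfl⟩
    · exact absurd (h.above i (by omega) hi).le hqp
  · rcases lt_trichotomy i j with h' | rfl | h'
    · exact absurd (h.lt _ _ h' hj).le hpq
    · exact absurd le_rfl hpq
    · exact absurd (h.lt _ _ h' hi).le hqp

end Diamond

/-! ### The occupied positions -/

section Plane

variable {n k ε : ℕ} {lam : ℕ → ℕ}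

theorem Block.exists_offCell {B : Block} {r c : ℕ} (h : r < B.size ∧ r < c ∧
    c < r + (B.part r + staircase (B.size + 1) r)) : ∃ d : B.OffCell, d.pos = (r, c) :=
  ⟨⟨⟨r, h.1⟩, ⟨c, Finset.mem_Ioo.2 h.2⟩⟩, rfl⟩

theorem shape_plane (hn : 3 ≤ n) (hk : 1 ≤ k) (hε : ε = 0 ∨ ε = 1)
    (u : SwivelShifted n k ε lam) : Shape n k ε lam (plane n k ε lam u).1 (plane n k ε lam u).2 := by
  obtain ⟨a, rfl⟩ | ⟨i, c, rfl⟩ | ⟨s, rfl⟩ := u.cases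
  · have ha := Finset.mem_Icc.1 a.2
    rw [plane_diag]
    left
    dsimp only
    omega
  · rw [plane_cell]
    rcases X11_cell_cases hk hε i c with h | h | h | h | h | h | h | ⟨j', h⟩ <;>
      obtain ⟨e, h⟩ := h <;> simp only [h, Shape, and_true, true_and, or_true, true_or]
    · right; left
      simp only [Int.toNat_natCast]
      omega
    all_goals omega
  · have := s.2
    rw [plane_chain]
    left
    dsimp only
    omega

theorem exists_plane_eq (hn : 3 ≤ n) (hε : ε = 0 ∨ ε = 1) {r c : ℤ}
    (h : Shape n k ε lam r c) : ∃ u : SwivelShifted n k ε lam, plane n k ε lam u = (r, c) := by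
  have cell : ∀ (i : Fin 4 ⊕ Fin (n - 2)) (p : ℕ × ℕ), (p.1 < (X11 n k ε lam i).size ∧
      p.1 < p.2 ∧ p.2 < p.1 + ((X11 n k ε lam i).part p.1 +
        staircase ((X11 n k ε lam i).size + 1) p.1)) → cellPlane n i p = (r, c) →
      ∃ u : SwivelShifted n k ε lam, plane n k ε lam u = (r, c) := by
    intro i p hp e
    obtain ⟨d, hd⟩ := Block.exists_offCell hp
    refine ⟨toLex (Sum.inl (PosetP.cell (n + 1) i d)), ?_⟩
    rw [plane_cell, hd]
    exact e
  rcases h with h | h | h | h | h | h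
  · by_cases hr : -1 ≤ r
    · refine ⟨toLex (Sum.inl (PosetP.diag _ ⟨(n - r).toNat, Finset.mem_Icc.2 (by omega)⟩)), ?_⟩
      rw [plane_diag, Prod.mk.injEq]
      dsimp only
      omega
    · refine ⟨toLex (Sum.inr ⟨(-2 - r).toNat, by omega⟩), ?_⟩
      rw [plane_chain, Prod.mk.injEq]
      dsimp only
      omega
  · refine cell (.inl 0) (r.toNat, c.toNat) ?_ ?_
    · simp [X11, staircase]
      omega
    · simp [cellPlane]
      omega
  · by_cases h0 : r = 0
    · refine cell (.inl 1) (0, 1) ?_ ?_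
      · simp [X11, staircase]
      · simp [cellPlane]
        omega
    by_cases h1 : r = 1
    · refine cell (.inl 1) (1, 2) ?_ ?_
      · simp [X11, staircase]
      · simp [cellPlane]
        omega
    by_cases h2 : r = n
    · refine cell (.inl 3) (0, 1) ?_ ?_
      · simp [X11, staircase]
        omega
      · simp [cellPlane]
        omega
    · refine cell (.inr ⟨(n - 1 - r).toNat, by omega⟩) (0, 1) ?_ ?_
      · simp [X11, staircase]
      · simp [cellPlane]
        omega
  · refine cell (.inl 1) (0, 2) ?_ ?_
    · simp [X11, staircase]
    · simp [cellPlane]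
      omega
  · refine cell (.inl 1) (0, (r - n + 2).toNat) ?_ ?_
    · simp [X11, staircase]
      omega
    · simp [cellPlane]
      split_ifs <;> simp <;> omega
  · refine cell (.inl 2) (0, 1) ?_ ?_
    · simp [X11, staircase]
    · simp [cellPlane]
      omega

theorem plane_injective (hn : 3 ≤ n) (hk : 1 ≤ k) (hε : ε = 0 ∨ ε = 1) :
    Function.Injective (plane n k ε lam) := by
  intro u v h
  apply le_antisymm <;> rw [plane_le hn hk hε, h] <;> exact ⟨le_rfl, le_rfl⟩

end Plane

theorem eq_of_covBy_of_le {P : Type} [PartialOrder P] {u v w : P} (h : u ⋖ v) (hw : u < w)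
    (hwv : w ≤ v) : w = v := by
  rcases hwv.lt_or_eq with hlt | rfl
  · exact absurd hlt (h.2 hw)
  · rfl

/-! ### Covers in the plane and candidates for diamonds -/

section Steps

variable {n k ε : ℕ} {lam : ℕ → ℕ}

/-- The possible relative positions of an element and one of its upper covers. -/
def Step (n : ℕ) (r c r' c' : ℤ) : Prop :=
  (r' = r - 1 ∧ c' = c) ∨ (r' = r ∧ c' = c - 1) ∨
    (r = c ∧ r ≤ -1 ∧ r' = r - 1 ∧ c' = c - 1) ∨ (r = n + 1 ∧ c = -1 ∧ r' = 1 ∧ c' = -1)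

theorem IsPar.toNat_le (hlam : IsPar n lam) {r r' : ℤ} (h : r ≤ r') :
    lam r'.toNat ≤ lam r.toNat := hlam.1 (Int.toNat_le_toNat h)

/-- From every position one can move towards a larger one by a `Step` that does not overshoot it. A
cover admits nothing strictly in between, so it has to be such a step. -/
theorem exists_step (hn : 3 ≤ n) (hε : ε = 0 ∨ ε = 1) (hlam : IsPar n lam) {r c r' c' : ℤ}
    (h : Shape n k ε lam r c) (h' : Shape n k ε lam r' c') (hr : r' ≤ r) (hc : c' ≤ c)
    (hne : ¬ (r' = r ∧ c' = c)) :
    ∃ p q, Shape n k ε lam p q ∧ r' ≤ p ∧ p ≤ r ∧ c' ≤ q ∧ q ≤ c ∧ Step n r c p q := by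
  have hl := hlam.toNat_le (show r - 1 ≤ r by omega)
  rcases h with h | h | h | h | h | h
  · obtain ⟨rfl, h⟩ := h
    by_cases h0 : r ≤ -1
    · refine ⟨r - 1, r - 1, ?_, ?_⟩
      · left; unfold Shape at h'; omega
      · unfold Shape at h'; unfold Step; omega
    · by_cases h1 : r' ≤ r - 1
      · refine ⟨r - 1, r, ?_, ?_⟩
        · unfold Shape; omega
        · unfold Step; omega
      · refine ⟨r, r - 1, ?_, ?_⟩
        · right; right; left; omega
        · unfold Step; omega
  · by_cases h1 : c' ≤ c - 1
    · refine ⟨r, c - 1, ?_, ?_⟩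
      · unfold Shape; omega
      · unfold Step; omega
    · refine ⟨r - 1, c, ?_, ?_⟩
      · right; left; unfold Shape at h'; omega
      · unfold Step; omega
  · by_cases h1 : r' ≤ r - 1
    · refine ⟨r - 1, r - 1, ?_, ?_⟩
      · left; omega
      · unfold Step; omega
    -- The target is in the same row and left of the subdiagonal, so it can only be `(1, -1)`, and
    -- `r = 1`.
    · refine ⟨r, r - 2, ?_, ?_⟩
      · right; right; right; left; unfold Shape at h'; omega
      · unfold Shape at h'; unfold Step; omega
  · refine ⟨0, -1, ?_, ?_⟩
    · right; right; left; unfold Shape at h'; omega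
    · unfold Shape at h'; unfold Step; omega
  · by_cases h1 : r = n + 1
    · refine ⟨1, -1, ?_, ?_⟩
      · right; right; right; left; omega
      · unfold Shape at h'; unfold Step; omega
    · refine ⟨r - 1, c, ?_, ?_⟩
      · right; right; right; right; left; omega
      · unfold Shape at h'; unfold Step; omega
  · refine ⟨-1, -1, ?_, ?_⟩
    · left; unfold Shape at h'; omega
    · unfold Shape at h'; unfold Step; omega

/-- The part of the shape that is relevant for unit squares: if the four cells of a unit square
belong to the shape, then its upper left corner is one of the following. -/
theorem Shape.square_cases (hn : 3 ≤ n) {r c : ℤ} (h1 : Shape n k ε lam r (c + 1))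
    (h2 : Shape n k ε lam (r + 1) c) (h3 : Shape n k ε lam (r + 1) (c + 1)) :
    (r = -1 ∧ c = -1) ∨ (r = 0 ∧ c = -1) ∨ (0 ≤ r ∧ r ≤ c ∧ r + 1 < n) := by
  unfold Shape at *
  omega

/-- The diagonal steps and the long step up the leg start at positions with only one step upwards.
Two different steps are therefore one up and one to the left, and the shape is such that the square
closes. -/
theorem Shape.of_two_steps (hn : 3 ≤ n) {r c p q p' q' : ℤ} (h : Shape n k ε lam r c)
    (hp : Shape n k ε lam p q) (hq : Shape n k ε lam p' q') (hlam : IsPar n lam)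
    (h1 : Step n r c p q) (h2 : Step n r c p' q')
    (hne : ¬ (p = p' ∧ q = q')) :
    ((p = r - 1 ∧ q = c ∧ p' = r ∧ q' = c - 1) ∨ (p' = r - 1 ∧ q' = c ∧ p = r ∧ q = c - 1)) ∧
      Shape n k ε lam (r - 1) (c - 1) := by
  have hl := hlam.toNat_le (show r - 1 ≤ r by omega)
  have key : (p = r - 1 ∧ q = c ∧ p' = r ∧ q' = c - 1) ∨
      (p' = r - 1 ∧ q' = c ∧ p = r ∧ q = c - 1) := by
    unfold Step at h1 h2
    rcases h1 with h1 | h1 | h1 | h1 <;> rcases h2 with h2 | h2 | h2 | h2 <;>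
      first
      | omega
      | (exfalso; unfold Shape at *; omega)
  refine ⟨key, ?_⟩
  have h3 : Shape n k ε lam (r - 1) c := by
    rcases key with ⟨rfl, rfl, -⟩ | ⟨rfl, rfl, -⟩ <;> assumption
  have h4 : Shape n k ε lam r (c - 1) := by
    rcases key with ⟨-, -, rfl, rfl⟩ | ⟨-, -, rfl, rfl⟩ <;> assumption
  have := Shape.square_cases hn (r := r - 1) (c := c - 1) (by simpa using h3) (by simpa using h4)
    (by simpa using h)
  unfold Shape at *
  omega

/-- The positions `w` and `z` of the ends of a `d_{a+3}`-interval with sides at `(r, c + 1)` and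
`(r + 1, c)`; if `0 < a`, then `m` is the position of the only element covered by its top. -/
def DPos (n k ε : ℕ) (lam : ℕ → ℕ) (a : ℕ) (r c w₁ w₂ z₁ z₂ m₁ m₂ : ℤ) : Prop :=
  Shape n k ε lam r c ∧ Shape n k ε lam r (c + 1) ∧ Shape n k ε lam (r + 1) c ∧
    Shape n k ε lam (r + 1) (c + 1) ∧ Shape n k ε lam w₁ w₂ ∧ Shape n k ε lam z₁ z₂ ∧
    ((a = 0 ∧ w₁ = r + 1 ∧ w₂ = c + 1 ∧ z₁ = r ∧ z₂ = c) ∨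
      (a = 1 ∧ 0 ≤ r ∧ r = c ∧ w₁ = r + 2 ∧ w₂ = r + 1 ∧ m₁ = r ∧ m₂ = r ∧
        ((r = 0 ∧ z₁ = -1 ∧ z₂ = 0) ∨ (1 ≤ r ∧ z₁ = r ∧ z₂ = r - 1))) ∨
      (1 ≤ a ∧ r = -1 ∧ c = -1 ∧ w₁ = 0 ∧ w₂ = a ∧ m₁ = -a ∧ m₂ = -a ∧
        z₁ = -1 - a ∧ z₂ = -1 - a))

variable (hn : 3 ≤ n) (hk : 1 ≤ k) (hε : ε = 0 ∨ ε = 1) (hlam : IsPar n lam)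

include hn hk hε hlam

theorem step_of_covBy {u v : SwivelShifted n k ε lam} (h : u ⋖ v) :
    Step n (plane n k ε lam u).1 (plane n k ε lam u).2
      (plane n k ε lam v).1 (plane n k ε lam v).2 := by
  have huv := (plane_le hn hk hε u v).1 h.le
  obtain ⟨p, q, hS, h1, h2, h3, h4, hstep⟩ := exists_step hn hε hlam (shape_plane hn hk hε u)
    (shape_plane hn hk hε v) huv.1 huv.2
    (fun e => h.lt.ne (plane_injective hn hk hε (Prod.ext e.1.symm e.2.symm)))
  obtain ⟨x, hx⟩ := exists_plane_eq hn hε hS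
  have hux : u ≤ x := by rw [plane_le hn hk hε, hx]; exact ⟨h2, h4⟩
  have hxv : x ≤ v := by rw [plane_le hn hk hε, hx]; exact ⟨h1, h3⟩
  have hxu : u ≠ x := by
    rintro rfl
    rw [hx] at hstep
    unfold Step at hstep
    dsimp only at hstep
    omega
  rcases hxv.lt_or_eq with hlt | rfl
  · exact absurd hlt (h.2 (lt_of_le_of_ne hux hxu))
  · rwa [hx]

end Steps

/-! ### Classification of the diamonds -/

section Classification

variable {n k ε : ℕ} {lam : ℕ → ℕ}
variable (hn : 3 ≤ n) (hk : 1 ≤ k) (hε : ε = 0 ∨ ε = 1) (hlam : IsPar n lam)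
variable {a t : ℕ} {s : ℕ → SwivelShifted n k ε lam} {y : SwivelShifted n k ε lam}

/-- The positions of the two sides of a diamond. -/
def SidesAt (a : ℕ) (s : ℕ → SwivelShifted n k ε lam) (y : SwivelShifted n k ε lam)
    (r c : ℤ) : Prop :=
  (plane n k ε lam y = (r, c + 1) ∧ plane n k ε lam (s (a + 1)) = (r + 1, c)) ∨
    (plane n k ε lam y = (r + 1, c) ∧ plane n k ε lam (s (a + 1)) = (r, c + 1))

include hn hk hε

/-- Convexity in the form that drives the classification: an occupied position between two chain
elements must itself belong to the diamond. Unwanted steps are refuted by exhibiting an intruder. -/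
theorem Diam.excluded (h : Diam a t s y) (hc : (diamSet t s y).OrdConnected) {i j : ℕ}
    (hi : i ≤ t) (hj : j ≤ t) {p q : ℤ} (hS : Shape n k ε lam p q)
    (h1 : p ≤ (plane n k ε lam (s i)).1) (h2 : q ≤ (plane n k ε lam (s i)).2)
    (h3 : (plane n k ε lam (s j)).1 ≤ p) (h4 : (plane n k ε lam (s j)).2 ≤ q) :
    plane n k ε lam y = (p, q) ∨ ∃ l, i ≤ l ∧ l ≤ j ∧ plane n k ε lam (s l) = (p, q) := by
  obtain ⟨v, hv⟩ := exists_plane_eq hn hε hS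
  rcases h.mem_between hc hj hi (p := v) (by rw [plane_le hn hk hε, hv]; exact ⟨h1, h2⟩)
    (by rw [plane_le hn hk hε, hv]; exact ⟨h3, h4⟩) with rfl | ⟨l, hil, hlj, rfl⟩
  · exact Or.inl hv
  · exact Or.inr ⟨l, hil, hlj, hv⟩

include hlam

/-- Both sides cover `s a`, so they are opposite corners of a unit square. Its upper left corner
lies strictly above the side `y` and below `s (a + 2)`, which covers `y`; hence it equals `s (a +
2)`. -/
theorem Diam.center (h : Diam a t s y) (hc : (diamSet t s y).OrdConnected) (ht : a + 1 ≤ t) :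
    ∃ r c, plane n k ε lam (s a) = (r + 1, c + 1) ∧ SidesAt a s y r c ∧
      Shape n k ε lam r c ∧ Shape n k ε lam r (c + 1) ∧ Shape n k ε lam (r + 1) c ∧
      Shape n k ε lam (r + 1) (c + 1) ∧ (a + 2 ≤ t → plane n k ε lam (s (a + 2)) = (r, c)) := by
  have h1 := step_of_covBy hn hk hε hlam (h.covBy hc ht)
  have h2 := step_of_covBy hn hk hε hlam (h.covBy_y hc (by omega))
  have hne : ¬ ((plane n k ε lam y).1 = (plane n k ε lam (s (a + 1))).1 ∧
      (plane n k ε lam y).2 = (plane n k ε lam (s (a + 1))).2) := fun e =>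
    h.not_le (plane_injective hn hk hε (Prod.ext e.1 e.2)).le
  have hSy := shape_plane hn hk hε y
  have hS1 := shape_plane hn hk hε (s (a + 1))
  have hS0 := shape_plane hn hk hε (s a)
  obtain ⟨hpos, hS⟩ := Shape.of_two_steps hn hS0 hSy hS1 hlam h2 h1 hne
  have ele : ∀ {p q : ℤ} {u : SwivelShifted n k ε lam}, (plane n k ε lam u).1 = p →
      (plane n k ε lam u).2 = q → plane n k ε lam u = (p, q) := fun e1 e2 => Prod.ext e1 e2
  have hsides : SidesAt a s y ((plane n k ε lam (s a)).1 - 1) ((plane n k ε lam (s a)).2 - 1) := by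
    rcases hpos with hp | hp
    · left
      exact ⟨ele hp.1 (by omega), ele (by omega) hp.2.2.2⟩
    · right
      exact ⟨ele (by omega) hp.2.2.2, ele hp.1 (by omega)⟩
  refine ⟨_, _, ele (sub_add_cancel _ _).symm (sub_add_cancel _ _).symm, hsides, hS, ?_, ?_, ?_, ?_⟩
  · rcases hpos with ⟨e1, e2, e3, e4⟩ | ⟨e1, e2, e3, e4⟩
    · rw [e1, e2] at hSy; simpa using hSy
    · rw [e1, e2] at hS1; simpa using hS1
  · rcases hpos with ⟨e1, e2, e3, e4⟩ | ⟨e1, e2, e3, e4⟩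
    · rw [e3, e4] at hS1; simpa using hS1
    · rw [e3, e4] at hSy; simpa using hSy
  · simpa using hS0
  · intro ht2
    obtain ⟨v, hv⟩ := exists_plane_eq hn hε hS
    have hy2 := h.y_covBy hc ht2
    have hs2 := h.covBy hc (i := a + 1) ht2
    have l1 := (plane_le hn hk hε _ _).1 hy2.le
    have l2 := (plane_le hn hk hε _ _).1 hs2.le
    have e : v = s (a + 2) := by
      refine eq_of_covBy_of_le hy2 (lt_of_le_of_ne ?_ ?_) ?_
      · rw [plane_le hn hk hε, hv]
        dsimp only
        omega
      · rintro rfl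
        rw [hv] at hpos
        dsimp only at hpos
        omega
      · rw [plane_le hn hk hε, hv]
        rw [show a + 1 + 1 = a + 2 from rfl] at l2
        dsimp only
        omega
    rw [← e, hv]

/-- A step downwards from the square usually puts another occupied position between `s (a - 1)` and
`s (a + 2)`; the positions passed to `hex` are these intruders. No intruder exists only below a
square on the diagonal, towards the subdiagonal, and to the right of `(0, 0)`. -/
theorem Diam.lower_type (h : Diam a t s y) (hc : (diamSet t s y).OrdConnected) {r c : ℤ}
    (ha : 1 ≤ a) (ht : a + 2 ≤ t) (h0 : plane n k ε lam (s a) = (r + 1, c + 1))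
    (hs : SidesAt a s y r c) (h2 : plane n k ε lam (s (a + 2)) = (r, c))
    (hS1 : Shape n k ε lam r (c + 1)) (hS2 : Shape n k ε lam (r + 1) c)
    (hS3 : Shape n k ε lam (r + 1) (c + 1)) :
    (r = c ∧ 0 ≤ r ∧ r + 1 < n ∧ plane n k ε lam (s (a - 1)) = (r + 2, r + 1)) ∨
      (r = -1 ∧ c = -1 ∧ plane n k ε lam (s (a - 1)) = (0, 1)) := by
  obtain ⟨a, rfl⟩ : ∃ b, a = b + 1 := ⟨a - 1, by omega⟩
  simp only [Nat.add_sub_cancel]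
  have hstep := step_of_covBy hn hk hε hlam (h.covBy hc (i := a) (by omega))
  have hF := shape_plane hn hk hε (s a)
  have hex : ∀ p q, Shape n k ε lam p q → p ≤ (plane n k ε lam (s a)).1 →
      q ≤ (plane n k ε lam (s a)).2 → r ≤ p → c ≤ q →
      (p = (plane n k ε lam (s a)).1 ∧ q = (plane n k ε lam (s a)).2) ∨
        (r ≤ p ∧ p ≤ r + 1 ∧ c ≤ q ∧ q ≤ c + 1) := by
    intro p q hS e1 e2 e3 e4
    rcases h.excluded hn hk hε hc (i := a) (j := a + 3) (by omega) ht hS e1 e2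
      (by rw [h2]; exact e3) (by rw [h2]; exact e4) with hy | ⟨l, hl, hl', hl''⟩
    · right
      rcases hs with ⟨e, -⟩ | ⟨e, -⟩ <;> rw [hy, Prod.mk.injEq] at e <;> omega
    · rcases (show l = a ∨ l = a + 1 ∨ l = a + 2 ∨ l = a + 3 by omega) with rfl | rfl | rfl | rfl
      · left
        rw [hl'']
        exact ⟨rfl, rfl⟩
      · right
        rw [hl'', Prod.mk.injEq] at h0
        omega
      · right
        rcases hs with ⟨-, e⟩ | ⟨-, e⟩ <;> rw [hl'', Prod.mk.injEq] at e <;> omega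
      · right
        rw [hl'', Prod.mk.injEq] at h2
        omega
  rw [h0] at hstep
  generalize plane n k ε lam (s a) = F at *
  obtain ⟨F1, F2⟩ := F
  dsimp only at *
  rw [Prod.mk.injEq, Prod.mk.injEq]
  have hl := hlam.toNat_le (show r ≤ r + 1 by omega)
  have hsq := Shape.square_cases hn hS1 hS2 hS3
  rcases hstep with e | e | e | e
  · obtain ⟨rfl, rfl⟩ : F1 = r + 2 ∧ F2 = c + 1 := by omega
    rcases hsq with ⟨rfl, rfl⟩ | ⟨rfl, rfl⟩ | ⟨h5, h6, h7⟩
    · have := hex 1 (-1) (by unfold Shape; omega)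
      omega
    · unfold Shape at hF
      omega
    · by_cases hrc : r = c
      · omega
      · have := hex (r + 2) c (by unfold Shape at hF ⊢; omega)
        omega
  · obtain ⟨rfl, rfl⟩ : F1 = r + 1 ∧ F2 = c + 2 := by omega
    rcases hsq with ⟨rfl, rfl⟩ | ⟨rfl, rfl⟩ | ⟨h5, h6, h7⟩
    · omega
    · have := hex 0 1 (by unfold Shape; simp only [Int.toNat_zero]; omega)
      omega
    · have := hex r (c + 2) (by unfold Shape at hF ⊢; omega)
      omega
  · omega
  · omega

/-- The only lower neighbour of `(r + 2, r + 1)` is the diagonal cell `(r + 2, r + 2)`, and passing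
to it would bring in the intruder `(r + 1, r + 2)`. -/
theorem Diam.le_one_of_lower (h : Diam a t s y) (hc : (diamSet t s y).OrdConnected) {r : ℤ}
    (ht : a + 2 ≤ t) (h0 : plane n k ε lam (s a) = (r + 1, r + 1))
    (hs : SidesAt a s y r r) (h2 : plane n k ε lam (s (a + 2)) = (r, r))
    (hr : 0 ≤ r) (h1 : plane n k ε lam (s (a - 1)) = (r + 2, r + 1)) : a ≤ 1 := by
  by_contra! ha
  obtain ⟨a, rfl⟩ : ∃ b, a = b + 2 := ⟨a - 2, by omega⟩
  rw [show a + 2 - 1 = a + 1 by omega] at h1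
  have hstep := step_of_covBy hn hk hε hlam (h.covBy hc (i := a) (by omega))
  have hF := shape_plane hn hk hε (s a)
  have hex := h.excluded hn hk hε hc (i := a) (j := a + 4) (p := r + 1) (q := r + 2)
    (by omega) ht
  rw [h2] at hex
  rw [h1] at hstep
  have hF' : plane n k ε lam (s a) = (r + 2, r + 2) := by
    generalize plane n k ε lam (s a) = F at *
    obtain ⟨F1, F2⟩ := F
    rw [Prod.mk.injEq]
    unfold Step at hstep
    unfold Shape at hF
    dsimp only at hstep hF
    omega
  rw [hF'] at hF hex
  dsimp only at hF hex
  rcases hex (by unfold Shape at hF ⊢; omega) (by omega) (by omega) (by omega) (by omega) with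
    hy | ⟨l, hl, hl', hl''⟩
  · rcases hs with ⟨e, -⟩ | ⟨e, -⟩ <;> rw [hy, Prod.mk.injEq] at e <;> omega
  · rcases (show l = a ∨ l = a + 1 ∨ l = a + 2 ∨ l = a + 3 ∨ l = a + 4 by omega) with
      rfl | rfl | rfl | rfl | rfl
    · rw [hl'', Prod.mk.injEq] at hF'
      omega
    · rw [hl'', Prod.mk.injEq] at h1
      omega
    · rw [hl'', Prod.mk.injEq] at h0
      omega
    · rcases hs with ⟨-, e⟩ | ⟨-, e⟩ <;> rw [hl'', Prod.mk.injEq] at e <;> omega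
    · rw [hl'', Prod.mk.injEq] at h2
      omega

/-- From `(r, r)` there is a step up and a step to the left. The step up has the intruder `(r - 1, r
+ 1)` unless `r = 0`, and the step to the left has the intruder `(1, -1)` if `r = 0`. -/
theorem Diam.top_of_lower (h : Diam 1 4 s y) (hc : (diamSet 4 s y).OrdConnected) {r : ℤ}
    (h0 : plane n k ε lam (s 1) = (r + 1, r + 1))
    (hs : SidesAt 1 s y r r) (h2 : plane n k ε lam (s 3) = (r, r))
    (hr : 0 ≤ r) (hrn : r + 1 < n) (h1 : plane n k ε lam (s 0) = (r + 2, r + 1)) :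
    (r = 0 ∧ plane n k ε lam (s 4) = (-1, 0)) ∨ (1 ≤ r ∧ plane n k ε lam (s 4) = (r, r - 1)) := by
  have hstep := step_of_covBy hn hk hε hlam (h.covBy hc (i := 3) (by omega))
  have hF := shape_plane hn hk hε (s 4)
  have hex : ∀ p q, Shape n k ε lam p q → p ≤ r + 2 → q ≤ r + 1 →
      (plane n k ε lam (s 4)).1 ≤ p → (plane n k ε lam (s 4)).2 ≤ q →
      (p = (plane n k ε lam (s 4)).1 ∧ q = (plane n k ε lam (s 4)).2) ∨
      (p = r + 2 ∧ q = r + 1) ∨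
        (r ≤ p ∧ p ≤ r + 1 ∧ r ≤ q ∧ q ≤ r + 1) := by
    intro p q hS e1 e2 e3 e4
    rcases h.excluded hn hk hε hc (i := 0) (j := 4) (by omega) le_rfl hS (by rw [h1]; exact e1)
      (by rw [h1]; exact e2) e3 e4 with hy | ⟨l, hl, hl', hl''⟩
    · right; right
      rcases hs with ⟨e, -⟩ | ⟨e, -⟩ <;> rw [hy, Prod.mk.injEq] at e <;> omega
    · rcases (show l = 0 ∨ l = 1 ∨ l = 2 ∨ l = 3 ∨ l = 4 by omega) with rfl | rfl | rfl | rfl | rfl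
      · right; left
        rw [hl'', Prod.mk.injEq] at h1
        exact h1
      · rw [hl'', Prod.mk.injEq] at h0
        omega
      · rcases hs with ⟨-, e⟩ | ⟨-, e⟩ <;> rw [hl'', Prod.mk.injEq] at e <;> omega
      · rw [hl'', Prod.mk.injEq] at h2
        omega
      · left
        rw [hl'']
        exact ⟨rfl, rfl⟩
  rw [show 3 + 1 = 4 from rfl, h2] at hstep
  generalize plane n k ε lam (s 4) = F at *
  obtain ⟨F1, F2⟩ := F
  dsimp only at *
  rw [Prod.mk.injEq, Prod.mk.injEq]
  rcases hstep with e | e | e | e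
  · by_cases hr0 : r = 0
    · omega
    · have := hex (r - 1) (r + 1) (by unfold Shape; omega)
      omega
  · by_cases hr0 : r = 0
    · have := hex 1 (-1) (by unfold Shape; omega)
      omega
    · omega
  · omega
  · omega

/-- A step down into row `1` would have the intruder `(1, 0)`. Showing that `(1, 0)` is not in the
chain needs the positions of all elements found so far, hence the quantifier over `j` inside the
induction. -/
theorem Diam.lower_chain (h : Diam a t s y) (hc : (diamSet t s y).OrdConnected)
    (ht : a + 2 ≤ t) (h0 : plane n k ε lam (s a) = (0, 0))
    (hs : SidesAt a s y (-1) (-1)) (h2 : plane n k ε lam (s (a + 2)) = (-1, -1))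
    (h1 : plane n k ε lam (s (a - 1)) = (0, 1)) (i : ℕ) (hi : i ≤ a) :
    ∀ j ≤ i, plane n k ε lam (s (a - j)) = (0, (j : ℤ)) := by
  induction i with
  | zero =>
    intro j hj
    obtain rfl : j = 0 := by omega
    simpa using h0
  | succ i ih =>
    intro j hj
    have ih := ih (by omega)
    rcases (show j ≤ i ∨ j = i + 1 by omega) with hj | rfl
    · exact ih j hj
    rcases (show i = 0 ∨ 1 ≤ i by omega) with rfl | hi1
    · simpa using h1
    have hstep := step_of_covBy hn hk hε hlam (h.covBy hc (i := a - (i + 1)) (by omega))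
    have hF := shape_plane hn hk hε (s (a - (i + 1)))
    rw [show a - (i + 1) + 1 = a - i by omega, ih i le_rfl] at hstep
    have hex := h.excluded hn hk hε hc (i := a - (i + 1)) (j := a + 2) (p := 1) (q := 0)
      (by omega) ht (by unfold Shape; omega)
    rw [h2] at hex
    generalize hFe : plane n k ε lam (s (a - (i + 1))) = F at *
    obtain ⟨F1, F2⟩ := F
    dsimp only at *
    rw [Prod.mk.injEq]
    rcases hstep with e | e | e | e
    · exfalso
      rcases hex (by omega) (by omega) (by omega) (by omega) with hy | ⟨l, hl, hl', hl''⟩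
      · rcases hs with ⟨e, -⟩ | ⟨e, -⟩ <;> rw [hy, Prod.mk.injEq] at e <;> omega
      · rcases (show l = a - (i + 1) ∨ (a - i ≤ l ∧ l ≤ a) ∨ l = a + 1 ∨ l = a + 2 by omega) with
          rfl | hl3 | rfl | rfl
        · rw [hl'', Prod.mk.injEq] at hFe
          omega
        · have := ih (a - l) (by omega)
          rw [show a - (a - l) = l by omega, hl'', Prod.mk.injEq] at this
          omega
        · rcases hs with ⟨-, e⟩ | ⟨-, e⟩ <;> rw [hl'', Prod.mk.injEq] at e <;> omega
        · rw [hl'', Prod.mk.injEq] at h2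
          omega
    · push_cast
      omega
    · omega
    · omega

theorem Diam.upper_chain (h : Diam a t s y) (hc : (diamSet t s y).OrdConnected)
    (h2 : plane n k ε lam (s (a + 2)) = (-1, -1)) (i : ℕ) (hi : a + 2 + i ≤ t) :
    plane n k ε lam (s (a + 2 + i)) = (-1 - (i : ℤ), -1 - (i : ℤ)) := by
  induction i with
  | zero => simpa using h2
  | succ i ih =>
    have ih := ih (by omega)
    have hstep := step_of_covBy hn hk hε hlam (h.covBy hc (i := a + 2 + i) (by omega))
    have hF := shape_plane hn hk hε (s (a + 2 + i + 1))
    rw [ih] at hstep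
    rw [← add_assoc]
    generalize plane n k ε lam (s (a + 2 + i + 1)) = F at *
    obtain ⟨F1, F2⟩ := F
    rw [Prod.mk.injEq]
    unfold Step at hstep
    unfold Shape at hF
    dsimp only at hstep hF
    push_cast
    omega

/-- The position `(z₁, z₂)` of the top is determined, and occupied, already for `t = 2 * a + 1`,
when the top is not yet present; this is what makes the first axiom of `d`-completeness available.
-/
theorem Diam.classify (ht : t = 2 * a + 1 ∨ t = 2 * a + 2) (h : Diam a t s y)
    (hc : (diamSet t s y).OrdConnected) :
    ∃ r c w₁ w₂ z₁ z₂ m₁ m₂, DPos n k ε lam a r c w₁ w₂ z₁ z₂ m₁ m₂ ∧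
      plane n k ε lam (s 0) = (w₁, w₂) ∧ SidesAt a s y r c ∧
      (1 ≤ a → plane n k ε lam (s (2 * a + 1)) = (m₁, m₂)) ∧
      (t = 2 * a + 2 → plane n k ε lam (s (2 * a + 2)) = (z₁, z₂)) := by
  obtain ⟨r, c, h0, hs, hS0, hS1, hS2, hS3, h2⟩ := h.center hn hk hε hlam hc (by omega)
  have hw := shape_plane hn hk hε (s 0)
  rcases Nat.eq_zero_or_pos a with rfl | ha
  -- For `a = 0` the position `(m₁, m₂)` plays no role, and zeros are filled in.
  · exact ⟨r, c, r + 1, c + 1, r, c, 0, 0, ⟨hS0, hS1, hS2, hS3, hS3, hS0, Or.inl (by simp)⟩, h0, hs,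
      by omega, fun h' => h2 (by omega)⟩
  · have h2' := h2 (by omega)
    rcases h.lower_type hn hk hε hlam hc ha (by omega) h0 hs h2' hS1 hS2 hS3 with
      ⟨rfl, hr, hrn, h1⟩ | ⟨rfl, rfl, h1⟩
    · obtain rfl : a = 1 := by
        have := h.le_one_of_lower hn hk hε hlam hc (by omega) h0 hs h2' hr h1
        omega
      simp only [Nat.sub_self] at h1
      rw [h1] at hw
      rcases (show r = 0 ∨ 1 ≤ r by omega) with rfl | hr1
      · refine ⟨0, 0, 2, 1, -1, 0, 0, 0, ⟨hS0, hS1, hS2, hS3, hw, by unfold Shape; omega,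
          by omega⟩, h1, hs, fun _ => h2', ?_⟩
        rintro rfl
        rcases h.top_of_lower hn hk hε hlam hc h0 hs h2' hr hrn h1 with h4 | h4
        · exact h4.2
        · omega
      · refine ⟨r, r, r + 2, r + 1, r, r - 1, r, r, ⟨hS0, hS1, hS2, hS3, hw,
          by unfold Shape; omega, by omega⟩, h1, hs, fun _ => h2', ?_⟩
        rintro rfl
        rcases h.top_of_lower hn hk hε hlam hc h0 hs h2' hr hrn h1 with h4 | h4
        · omega
        · exact h4.2
    · have hlow := h.lower_chain hn hk hε hlam hc (by omega) h0 hs h2' h1 a le_rfl a le_rfl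
      have hup := h.upper_chain hn hk hε hlam hc h2'
      rw [Nat.sub_self] at hlow
      rw [hlow] at hw
      refine ⟨-1, -1, 0, a, -1 - a, -1 - a, -a, -a, ⟨hS0, hS1, hS2, hS3, hw, ?_, by omega⟩, hlow,
        hs, ?_, ?_⟩
      · unfold Shape at hw ⊢
        simp only [Int.toNat_zero] at hw
        omega
      · intro _
        have := hup (a - 1) (by omega)
        rw [show a + 2 + (a - 1) = 2 * a + 1 by omega] at this
        rw [this, Prod.mk.injEq]
        omega
      · rintro rfl
        have := hup a (by omega)
        rwa [show a + 2 + a = 2 * a + 2 by omega] at this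

end Classification

/-! ### What the position of a diamond determines -/

section Positions

variable {n k ε : ℕ} {lam : ℕ → ℕ} {a : ℕ} {r c w₁ w₂ z₁ z₂ m₁ m₂ : ℤ}

/-- The second axiom of `d`-completeness in coordinates. Of the companions, `DPos.unique_of_sides`
is used for the third axiom and `DPos.unique_of_top` for the recursion of the hook lengths. -/
theorem DPos.lower_cover (hn : 3 ≤ n) (h : DPos n k ε lam a r c w₁ w₂ z₁ z₂ m₁ m₂) {p q : ℤ}
    (hS : Shape n k ε lam p q) (hst : Step n p q z₁ z₂) :
    (a = 0 ∧ ((p = r + 1 ∧ q = c) ∨ (p = r ∧ q = c + 1))) ∨ (1 ≤ a ∧ p = m₁ ∧ q = m₂) := by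
  obtain ⟨-, h1, h2, h3, -, -, h⟩ := h
  have hsq := Shape.square_cases hn h1 h2 h3
  clear h1 h2 h3
  rcases h with h | h | h
  · obtain ⟨rfl, rfl, rfl, rfl, rfl⟩ := h
    unfold Step at hst
    omega
  · obtain ⟨rfl, h0, rfl, rfl, rfl, rfl, rfl, h⟩ := h
    unfold Step at hst
    unfold Shape at hS
    omega
  · obtain ⟨ha, rfl, rfl, rfl, rfl, rfl, rfl, rfl, rfl⟩ := h
    unfold Step at hst
    unfold Shape at hS
    omega

theorem DPos.unique_of_top (hn : 3 ≤ n) {a' : ℕ} {r' c' w₁' w₂' m₁' m₂' : ℤ}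
    (h : DPos n k ε lam a r c w₁ w₂ z₁ z₂ m₁ m₂)
    (h' : DPos n k ε lam a' r' c' w₁' w₂' z₁ z₂ m₁' m₂') :
    r = r' ∧ c = c' ∧ w₁ = w₁' ∧ w₂ = w₂' := by
  obtain ⟨-, h1, h2, h3, -, -, h⟩ := h
  obtain ⟨-, h1', h2', h3', -, -, h'⟩ := h'
  have hsq := Shape.square_cases hn h1 h2 h3
  have hsq' := Shape.square_cases hn h1' h2' h3'
  clear h1 h2 h3 h1' h2' h3'
  omega

theorem DPos.unique_of_sides {w₁' w₂' z₁' z₂' m₁' m₂' : ℤ}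
    (h : DPos n k ε lam a r c w₁ w₂ z₁ z₂ m₁ m₂)
    (h' : DPos n k ε lam a r c w₁' w₂' z₁' z₂' m₁' m₂') :
    w₁ = w₁' ∧ w₂ = w₂' := by
  obtain ⟨-, -, -, -, -, -, h⟩ := h
  obtain ⟨-, -, -, -, -, -, h'⟩ := h'
  omega

theorem DPos.m_ge (h : DPos n k ε lam a r c w₁ w₂ z₁ z₂ m₁ m₂) (ha : 1 ≤ a) :
    z₁ ≤ m₁ ∧ z₂ ≤ m₂ ∧ ¬ (m₁ = z₁ ∧ m₂ = z₂) := by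
  obtain ⟨-, -, -, -, -, -, h⟩ := h
  omega

end Positions

/-! ### `d`-completeness -/

section DComplete

variable {n k ε : ℕ} {lam : ℕ → ℕ}
variable (hn : 3 ≤ n) (hk : 1 ≤ k) (hε : ε = 0 ∨ ε = 1) (hlam : IsPar n lam)

include hn hk hε

theorem plane_lt (u v : SwivelShifted n k ε lam) :
    u < v ↔ ((plane n k ε lam v).1 ≤ (plane n k ε lam u).1 ∧
      (plane n k ε lam v).2 ≤ (plane n k ε lam u).2) ∧
      ¬ ((plane n k ε lam u).1 ≤ (plane n k ε lam v).1 ∧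
      (plane n k ε lam u).2 ≤ (plane n k ε lam v).2) := by
  rw [lt_iff_le_not_ge, plane_le hn hk hε, plane_le hn hk hε]

theorem SidesAt.eq_of_plane {a : ℕ} {s : ℕ → SwivelShifted n k ε lam}
    {y : SwivelShifted n k ε lam} {r c : ℤ} (hs : SidesAt a s y r c)
    {u : SwivelShifted n k ε lam} (hu : plane n k ε lam u = (r + 1, c) ∨
      plane n k ε lam u = (r, c + 1)) : u = y ∨ u = s (a + 1) := by
  rcases hs with ⟨e, e'⟩ | ⟨e, e'⟩ <;> rcases hu with hu | hu
  · exact Or.inr (plane_injective hn hk hε (hu.trans e'.symm))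
  · exact Or.inl (plane_injective hn hk hε (hu.trans e.symm))
  · exact Or.inl (plane_injective hn hk hε (hu.trans e.symm))
  · exact Or.inr (plane_injective hn hk hε (hu.trans e'.symm))

include hlam

theorem DPos.mem_of_covBy {a t : ℕ} {s : ℕ → SwivelShifted n k ε lam}
    {y : SwivelShifted n k ε lam} {r c w₁ w₂ z₁ z₂ m₁ m₂ : ℤ}
    (h : DPos n k ε lam a r c w₁ w₂ z₁ z₂ m₁ m₂) (hs : SidesAt a s y r c)
    (hm : 1 ≤ a → plane n k ε lam (s (2 * a + 1)) = (m₁, m₂)) {z q : SwivelShifted n k ε lam}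
    (hz : plane n k ε lam z = (z₁, z₂)) (hq : q ⋖ z) (ht : 2 * a + 1 ≤ t) :
    q ∈ diamSet t s y := by
  have hst := step_of_covBy hn hk hε hlam hq
  rw [hz] at hst
  rcases h.lower_cover hn (shape_plane hn hk hε q) hst with ⟨rfl, h1⟩ | ⟨ha, h1⟩
  · have : q = y ∨ q = s (0 + 1) := by
      apply hs.eq_of_plane hn hk hε
      rcases h1 with h1 | h1
      · exact Or.inl (Prod.ext h1.1 h1.2)
      · exact Or.inr (Prod.ext h1.1 h1.2)
    rcases this with rfl | rfl
    · exact Or.inl rfl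
    · exact Or.inr ⟨0 + 1, ht, rfl⟩
  · right
    refine ⟨2 * a + 1, ht, plane_injective hn hk hε ?_⟩
    rw [hm ha]
    exact Prod.ext h1.1 h1.2

/-- The top is the element at the position found in `Diam.classify`. Everything strictly below it is
below an element that it covers, and these belong to the given set; convexity then shows that
adjoining the top gives the whole interval. -/
theorem exists_top_of_isDMinusConvex (K : ℕ) (I : Set (SwivelShifted n k ε lam))
    (hI : IsDMinusConvex K I) : ∃ w z : SwivelShifted n k ε lam,
      (∀ m, Maximal (· ∈ I) m → m ⋖ z) ∧ insert z I = Set.Icc w z ∧ IsDInterval K w z := by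
  obtain ⟨a, rfl⟩ : ∃ a, K = a + 3 := ⟨K - 3, by have := hI.1; omega⟩
  have hconv := hI.2.1
  obtain ⟨s, y, hd, rfl⟩ := hI.exists_diam
  obtain ⟨r, c, w₁, w₂, z₁, z₂, m₁, m₂, hD, hw, hs, hm, -⟩ :=
    hd.classify hn hk hε hlam (Or.inl rfl) hconv
  obtain ⟨z, hz⟩ := exists_plane_eq hn hε hD.2.2.2.2.2.1
  have htop : ∀ p ∈ diamSet (2 * a + 1) s y, p < z := by
    have h1 : s (2 * a + 1) < z ∧ y < z := by
      rcases Nat.eq_zero_or_pos a with rfl | ha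
      · obtain ⟨-, -, -, -, -, -, h⟩ := hD
        obtain ⟨-, -, rfl, rfl⟩ : w₁ = r + 1 ∧ w₂ = c + 1 ∧ z₁ = r ∧ z₂ = c := by omega
        rw [plane_lt hn hk hε, plane_lt hn hk hε, hz]
        rcases hs with ⟨e, e'⟩ | ⟨e, e'⟩ <;> rw [e, show 2 * 0 + 1 = 0 + 1 from rfl, e'] <;>
          dsimp only <;> omega
      · have hlt : s (2 * a + 1) < z := by
          have := hD.m_ge ha
          rw [plane_lt hn hk hε, hz, hm ha]
          dsimp only
          omega
        exact ⟨hlt, (hd.above _ (by omega) le_rfl).trans hlt⟩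
    rintro p (rfl | ⟨i, hi, rfl⟩)
    · exact h1.2
    · rcases hi.lt_or_eq with hi | rfl
      · exact (hd.lt _ _ hi le_rfl).trans h1.1
      · exact h1.1
  have hbot : ∀ p ∈ diamSet (2 * a + 1) s y, s 0 ≤ p := by
    rintro p (rfl | ⟨i, hi, rfl⟩)
    · exact (hd.below 0 (by omega)).le
    · rcases Nat.eq_zero_or_pos i with rfl | hi0
      · exact le_rfl
      · exact (hd.lt _ _ hi0 hi).le
  have hIcc : insert z (diamSet (2 * a + 1) s y) = Set.Icc (s 0) z := by
    ext p
    constructor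
    · rintro (rfl | hp)
      · exact ⟨(htop _ (Or.inr ⟨0, by omega, rfl⟩)).le, le_rfl⟩
      · exact ⟨hbot p hp, (htop p hp).le⟩
    · rintro ⟨hp1, hp2⟩
      rcases hp2.eq_or_lt with rfl | hp2
      · exact Or.inl rfl
      · right
        obtain ⟨q, hpq, hqz⟩ := exists_le_covBy_of_lt hp2
        exact hconv.out (Or.inr ⟨0, by omega, rfl⟩)
          (hD.mem_of_covBy hn hk hε hlam hs hm hz hqz le_rfl) ⟨hp1, hpq⟩
  refine ⟨s 0, z, fun m hmax => ?_, hIcc, ?_⟩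
  · obtain ⟨q, hmq, hqz⟩ := exists_le_covBy_of_lt (htop m hmax.1)
    have hq := hD.mem_of_covBy hn hk hε hlam hs hm hz hqz (le_refl (2 * a + 1))
    rwa [le_antisymm hmq (hmax.2 hq hmq)]
  · refine Diam.isDInterval (s := fun i => if i = 2 * a + 2 then z else s i) (y := y)
      ⟨?_, ?_, ?_, ?_, ?_⟩ ?_
    · intro i j hij hj
      rw [if_neg (by omega)]
      split_ifs with hj'
      · exact htop _ (Or.inr ⟨i, by omega, rfl⟩)
      · exact hd.lt i j hij (by omega)
    · intro i hi
      rw [if_neg (by omega)]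
      exact hd.below i hi
    · intro i hi hit
      split_ifs with hi'
      · exact htop _ (Or.inl rfl)
      · exact hd.above i hi (by omega)
    · rw [if_neg (by omega)]
      exact hd.not_le
    · rw [if_neg (by omega)]
      exact hd.not_ge
    · rw [← hIcc]
      ext p
      constructor
      · rintro (rfl | rfl | ⟨i, hi, rfl⟩)
        · exact Or.inr ⟨2 * a + 2, le_rfl, by simp⟩
        · exact Or.inl rfl
        · exact Or.inr ⟨i, by omega, by dsimp only; rw [if_neg (by omega)]⟩
      · rintro (rfl | ⟨i, hi, rfl⟩)
        · exact Or.inr (Or.inl rfl)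
        · dsimp only
          split_ifs with hi'
          · exact Or.inl rfl
          · exact Or.inr (Or.inr ⟨i, by omega, rfl⟩)

theorem mem_of_covBy_of_isDInterval (K : ℕ) (w z : SwivelShifted n k ε lam)
    (h : IsDInterval K w z) (q : SwivelShifted n k ε lam) (hq : q ⋖ z) : q ∈ Set.Icc w z := by
  obtain ⟨a, rfl⟩ : ∃ a, K = a + 3 := ⟨K - 3, by have := h.1; omega⟩
  obtain ⟨s, y, hd, hI⟩ := h.exists_diam
  have hconv : (diamSet (2 * a + 2) s y).OrdConnected := hI ▸ Set.ordConnected_Icc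
  obtain ⟨r, c, w₁, w₂, z₁, z₂, m₁, m₂, hD, hw, hs, hm, hz⟩ :=
    hd.classify hn hk hε hlam (Or.inr rfl) hconv
  have hsz : s (2 * a + 2) = z := by
    have h1 : z ∈ diamSet (2 * a + 2) s y := by
      rw [← hI]
      exact Set.right_mem_Icc.2 (Set.nonempty_Icc.1 ⟨y, hI ▸ Or.inl rfl⟩)
    have h2 : s (2 * a + 2) ∈ Set.Icc w z := hI ▸ Or.inr ⟨_, le_rfl, rfl⟩
    rcases h1 with rfl | ⟨i, hi, rfl⟩
    · exact absurd h2.2 (hd.above _ (by omega) le_rfl).not_ge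
    · rcases hi.lt_or_eq with hi | rfl
      · exact absurd h2.2 (hd.lt _ _ hi le_rfl).not_ge
      · rfl
  rw [hI]
  exact hD.mem_of_covBy hn hk hε hlam hs hm (hsz ▸ hz rfl) hq (by omega)

/-- The sides are not minimal, so the sides of one diamond survive in the other. There they are
incomparable, hence are its sides too, and the sides together with `a` determine the bottom. -/
theorem isDMinusConvex_bot_unique (K : ℕ) (I J : Set (SwivelShifted n k ε lam))
    (v w : SwivelShifted n k ε lam) (hI : IsDMinusConvex K I) (hJ : IsDMinusConvex K J)
    (hv : IsLeast I v) (hw : IsLeast J w) (hIJ : I \ {v} = J \ {w}) : v = w := by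
  obtain ⟨a, rfl⟩ : ∃ a, K = a + 3 := ⟨K - 3, by have := hI.1; omega⟩
  have hcI := hI.2.1
  have hcJ := hJ.2.1
  obtain ⟨s, y, hd, rfl⟩ := hI.exists_diam
  obtain ⟨s', y', hd', rfl⟩ := hJ.exists_diam
  obtain ⟨r, c, w₁, w₂, z₁, z₂, m₁, m₂, hD, hs0, hs, -, -⟩ :=
    hd.classify hn hk hε hlam (Or.inl rfl) hcI
  obtain ⟨r', c', w₁', w₂', z₁', z₂', m₁', m₂', hD', hs0', hs', -, -⟩ :=
    hd'.classify hn hk hε hlam (Or.inl rfl) hcJ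
  have bot : ∀ {s : ℕ → SwivelShifted n k ε lam} {y v : SwivelShifted n k ε lam},
      Diam a (2 * a + 1) s y → IsLeast (diamSet (2 * a + 1) s y) v → s 0 = v := by
    intro s y v hd hv
    have h1 := hv.2 (Or.inr ⟨0, by omega, rfl⟩ : s 0 ∈ diamSet (2 * a + 1) s y)
    rcases hv.1 with rfl | ⟨i, hi, rfl⟩
    · exact absurd h1 (hd.below 0 (by omega)).not_ge
    · rcases Nat.eq_zero_or_pos i with rfl | hi0
      · rfl
      · exact absurd h1 (hd.lt 0 i hi0 hi).not_ge
  obtain rfl := bot hd hv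
  obtain rfl := bot hd' hw
  have hy : y ∈ diamSet (2 * a + 1) s' y' := by
    have : y ∈ diamSet (2 * a + 1) s y \ {s 0} :=
      ⟨Or.inl rfl, (hd.below 0 (by omega)).ne'⟩
    rw [hIJ] at this
    exact this.1
  have hs1 : s (a + 1) ∈ diamSet (2 * a + 1) s' y' := by
    have : s (a + 1) ∈ diamSet (2 * a + 1) s y \ {s 0} :=
      ⟨Or.inr ⟨a + 1, by omega, rfl⟩, (hd.lt 0 (a + 1) (by omega) (by omega)).ne'⟩
    rw [hIJ] at this
    exact this.1
  have hrc : r = r' ∧ c = c' := by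
    unfold SidesAt at hs hs'
    rcases hd'.incomparable hy hs1 hd.not_le hd.not_ge with ⟨e, e'⟩ | ⟨e, e'⟩
    · rw [e, e'] at hs
      rcases hs with ⟨h1, h2⟩ | ⟨h1, h2⟩ <;> rcases hs' with ⟨h3, h4⟩ | ⟨h3, h4⟩ <;>
        rw [h1, Prod.mk.injEq] at h3 <;> rw [h2, Prod.mk.injEq] at h4 <;> omega
    · rw [e, e'] at hs
      rcases hs with ⟨h1, h2⟩ | ⟨h1, h2⟩ <;> rcases hs' with ⟨h3, h4⟩ | ⟨h3, h4⟩ <;>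
        rw [h2, Prod.mk.injEq] at h3 <;> rw [h1, Prod.mk.injEq] at h4 <;> omega
  obtain ⟨rfl, rfl⟩ := hrc
  obtain ⟨rfl, rfl⟩ := hD.unique_of_sides hD'
  exact plane_injective hn hk hε (hs0.trans hs0'.symm)

theorem swivelShifted_isDComplete : IsDComplete (SwivelShifted n k ε lam) where
  exists_top := exists_top_of_isDMinusConvex hn hk hε hlam
  covBy_mem := mem_of_covBy_of_isDInterval hn hk hε hlam
  bot_unique := isDMinusConvex_bot_unique hn hk hε hlam

end DComplete

/-! ### The hook length recursion in coordinates -/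

section Intervals

variable {n k ε : ℕ} {lam : ℕ → ℕ}
variable (hn : 3 ≤ n) (hk : 1 ≤ k) (hε : ε = 0 ∨ ε = 1)

include hn hk hε

/-- The converse direction to the classification: a list `f` of chain positions and the position `g`
of the other side do form an interval, provided no further position lies in the box that they span.
-/
theorem isDIntervalWithSides_of_pos (a : ℕ) (f : ℕ → ℤ × ℤ) (g : ℤ × ℤ)
    (hf : ∀ i ≤ 2 * a + 2, Shape n k ε lam (f i).1 (f i).2)
    (hlt : ∀ i j, i < j → j ≤ 2 * a + 2 → (f j).1 ≤ (f i).1 ∧ (f j).2 ≤ (f i).2 ∧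
      ((f j).1 < (f i).1 ∨ (f j).2 < (f i).2))
    (hlow : ∀ i ≤ a, g.1 ≤ (f i).1 ∧ g.2 ≤ (f i).2 ∧ (g.1 < (f i).1 ∨ g.2 < (f i).2))
    (hup : ∀ i, a + 2 ≤ i → i ≤ 2 * a + 2 → (f i).1 ≤ g.1 ∧ (f i).2 ≤ g.2 ∧
      ((f i).1 < g.1 ∨ (f i).2 < g.2))
    (hside : (g.1 < (f (a + 1)).1 ∧ (f (a + 1)).2 < g.2) ∨
      ((f (a + 1)).1 < g.1 ∧ g.2 < (f (a + 1)).2))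
    (hIcc : ∀ p q, Shape n k ε lam p q → (f (2 * a + 2)).1 ≤ p → p ≤ (f 0).1 →
      (f (2 * a + 2)).2 ≤ q → q ≤ (f 0).2 → (g = (p, q) ∨ ∃ i ≤ 2 * a + 2, f i = (p, q)))
    {w x y z : SwivelShifted n k ε lam} (hw : plane n k ε lam w = f 0)
    (hx : plane n k ε lam x = f (a + 1)) (hy : plane n k ε lam y = g)
    (hz : plane n k ε lam z = f (2 * a + 2)) : IsDIntervalWithSides w x y z := by
  have hs : ∀ i, ∃ u : SwivelShifted n k ε lam, i ≤ 2 * a + 2 → plane n k ε lam u = f i := by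
    intro i
    by_cases hi : i ≤ 2 * a + 2
    · obtain ⟨u, hu⟩ := exists_plane_eq hn hε (hf i hi)
      exact ⟨u, fun _ => hu⟩
    · exact ⟨w, fun h => absurd h hi⟩
  choose s hs using hs
  have hd : Diam a (2 * a + 2) s y := by
    refine ⟨?_, ?_, ?_, ?_, ?_⟩
    · intro i j hij hj
      have := hlt i j hij hj
      rw [plane_lt hn hk hε, hs i (by omega), hs j hj]
      omega
    · intro i hi
      have := hlow i hi
      rw [plane_lt hn hk hε, hs i (by omega), hy]
      omega
    · intro i hi hit
      have := hup i hi hit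
      rw [plane_lt hn hk hε, hs i (by omega), hy]
      omega
    · rw [plane_le hn hk hε, hs _ (by omega), hy]
      omega
    · rw [plane_le hn hk hε, hs _ (by omega), hy]
      omega
  have hw0 : w = s 0 := plane_injective hn hk hε (by rw [hw, hs 0 (by omega)])
  have hz0 : z = s (2 * a + 2) := plane_injective hn hk hε (by rw [hz, hs _ le_rfl])
  have hx0 : x = s (a + 1) := plane_injective hn hk hε (by rw [hx, hs _ (by omega)])
  have hI : Set.Icc w z = diamSet (2 * a + 2) s y := by
    ext p
    constructor
    · rintro ⟨h1, h2⟩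
      rw [plane_le hn hk hε, hw] at h1
      rw [plane_le hn hk hε, hz] at h2
      rcases hIcc _ _ (shape_plane hn hk hε p) h2.1 h1.1 h2.2 h1.2 with e | ⟨i, hi, e⟩
      · exact Or.inl (plane_injective hn hk hε (by rw [hy, e]))
      · exact Or.inr ⟨i, hi, plane_injective hn hk hε (by rw [hs i hi, e])⟩
    · rw [hw0, hz0]
      rintro (rfl | ⟨i, hi, rfl⟩)
      · exact ⟨(hd.below 0 (by omega)).le, (hd.above _ (by omega) le_rfl).le⟩
      · constructor
        · rcases Nat.eq_zero_or_pos i with rfl | hi0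
          · exact le_rfl
          · exact (hd.lt _ _ hi0 hi).le
        · rcases hi.eq_or_lt with rfl | hi'
          · exact le_rfl
          · exact (hd.lt _ _ hi' le_rfl).le
  refine ⟨⟨a + 3, hd.isDInterval hI⟩, ?_, ?_, ?_, ?_⟩
  · rw [hI, hx0]
    exact Or.inr ⟨a + 1, by omega, rfl⟩
  · rw [hI]
    exact Or.inl rfl
  · rw [hx0]
    exact hd.not_ge
  · rw [hx0]
    exact hd.not_le

theorem DPos.isDIntervalWithSides {a : ℕ} {r c w₁ w₂ z₁ z₂ m₁ m₂ : ℤ}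
    (h : DPos n k ε lam a r c w₁ w₂ z₁ z₂ m₁ m₂) {w x y z : SwivelShifted n k ε lam}
    (hw : plane n k ε lam w = (w₁, w₂)) (hx : plane n k ε lam x = (r, c + 1))
    (hy : plane n k ε lam y = (r + 1, c)) (hz : plane n k ε lam z = (z₁, z₂)) :
    IsDIntervalWithSides w x y z := by
  obtain ⟨h0, h1, h2, h3, hSw, hSz, h⟩ := h
  have hsq := Shape.square_cases hn h1 h2 h3
  rcases h with ⟨rfl, rfl, rfl, rfl, rfl⟩ | ⟨rfl, hr, rfl, rfl, rfl, -, -, h⟩ |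
      ⟨ha, rfl, rfl, rfl, rfl, -, -, rfl, rfl⟩
  · refine isDIntervalWithSides_of_pos hn hk hε 0 (fun i => if i = 0 then (z₁ + 1, z₂ + 1) else
      if i = 1 then (z₁, z₂ + 1) else (z₁, z₂)) (z₁ + 1, z₂) ?_ ?_ ?_ ?_ ?_ ?_ hw hx hy hz
    · intro i _
      try dsimp only
      split_ifs <;> assumption
    · intro i j hij hj
      try dsimp only
      split_ifs <;> dsimp only <;> omega
    · intro i hi
      try dsimp only
      rw [if_pos (by omega)]
      dsimp only
      omega
    · intro i hi _
      try dsimp only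
      rw [if_neg (by omega), if_neg (by omega)]
      dsimp only
      omega
    · right
      simp
    · intro p q _ e1 e2 e3 e4
      simp at e1 e2 e3 e4
      rcases (show p = z₁ ∨ p = z₁ + 1 by omega) with rfl | rfl <;>
        rcases (show q = z₂ ∨ q = z₂ + 1 by omega) with rfl | rfl
      · exact Or.inr ⟨2, by omega, by simp⟩
      · exact Or.inr ⟨1, by omega, by simp⟩
      · exact Or.inl rfl
      · exact Or.inr ⟨0, by omega, by simp⟩
  · have hzz : z₁ ≤ r ∧ z₂ ≤ r ∧ (z₁ < r ∨ z₂ < r) ∧ -1 ≤ z₁ ∧ 0 ≤ z₂ := by omega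
    refine isDIntervalWithSides_of_pos hn hk hε 1 (fun i => if i = 0 then (r + 2, r + 1) else
      if i = 1 then (r + 1, r + 1) else if i = 2 then (r, r + 1) else if i = 3 then (r, r) else
      (z₁, z₂)) (r + 1, r) ?_ ?_ ?_ ?_ ?_ ?_ hw hx hy hz
    · intro i _
      try dsimp only
      split_ifs <;> assumption
    · intro i j hij hj
      try dsimp only
      split_ifs <;> dsimp only <;> omega
    · intro i hi
      try dsimp only
      split_ifs <;> dsimp only <;> omega
    · intro i hi _
      try dsimp only
      split_ifs <;> dsimp only <;> omega
    · right
      simp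
    · intro p q hS e1 e2 e3 e4
      simp at e1 e2 e3 e4
      have : (p = r + 2 ∧ q = r + 1) ∨ (p = r + 1 ∧ q = r + 1) ∨ (p = r ∧ q = r + 1) ∨
          (p = r ∧ q = r) ∨ (p = z₁ ∧ q = z₂) ∨ (p = r + 1 ∧ q = r) := by
        unfold Shape at hS
        omega
      rcases this with ⟨rfl, rfl⟩ | ⟨rfl, rfl⟩ | ⟨rfl, rfl⟩ | ⟨rfl, rfl⟩ | ⟨rfl, rfl⟩ | ⟨rfl, rfl⟩
      · exact Or.inr ⟨0, by omega, by simp⟩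
      · exact Or.inr ⟨1, by omega, by simp⟩
      · exact Or.inr ⟨2, by omega, by simp⟩
      · exact Or.inr ⟨3, by omega, by simp⟩
      · exact Or.inr ⟨4, by omega, by simp⟩
      · exact Or.inl rfl
  · have hSz' := hSz
    have hSw' := hSw
    unfold Shape at hSw' hSz'
    refine isDIntervalWithSides_of_pos hn hk hε a (fun i => if i ≤ a then (0, (a : ℤ) - i) else
      if i = a + 1 then (-1, 0) else ((a : ℤ) + 1 - i, (a : ℤ) + 1 - i)) (0, -1)
      ?_ ?_ ?_ ?_ ?_ ?_ (by simpa using hw) (by simpa using hx) (by simpa using hy) ?_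
    · intro i hi
      try dsimp only
      split_ifs
      · unfold Shape
        simp only [Int.toNat_zero] at hSw' ⊢
        omega
      · unfold Shape
        simp
      · left
        dsimp only
        omega
    · intro i j hij hj
      try dsimp only
      split_ifs <;> dsimp only <;> omega
    · intro i hi
      try dsimp only
      split_ifs <;> dsimp only <;> omega
    · intro i hi _
      try dsimp only
      split_ifs <;> dsimp only <;> omega
    · right
      simp
    · intro p q hS e1 e2 e3 e4
      rw [if_neg (by omega), if_neg (by omega)] at e1 e3
      simp at e1 e2 e3 e4
      have : (p = 0 ∧ q = -1) ∨ (p = 0 ∧ 0 ≤ q) ∨ (p = -1 ∧ q = 0) ∨ (p = q ∧ p ≤ -1) := by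
        unfold Shape at hS
        omega
      rcases this with ⟨rfl, rfl⟩ | ⟨rfl, h0⟩ | ⟨rfl, rfl⟩ | ⟨rfl, h0⟩
      · exact Or.inl rfl
      · refine Or.inr ⟨(a - q).toNat, by omega, ?_⟩
        rw [if_pos (by omega), Prod.mk.injEq]
        omega
      · refine Or.inr ⟨a + 1, by omega, ?_⟩
        simp
      · refine Or.inr ⟨(a + 1 - p).toNat, by omega, ?_⟩
        rw [if_neg (by omega), if_neg (by omega), Prod.mk.injEq]
        omega
    · rw [if_neg (by omega), if_neg (by omega), hz, Prod.mk.injEq]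
      push_cast
      omega

theorem exists_DPos_of_isDIntervalWithSides (hlam : IsPar n lam) {w x y z : SwivelShifted n k ε lam}
    (h : IsDIntervalWithSides w x y z) :
    ∃ a r c w₁ w₂ z₁ z₂ m₁ m₂, DPos n k ε lam a r c w₁ w₂ z₁ z₂ m₁ m₂ ∧
      plane n k ε lam w = (w₁, w₂) ∧ plane n k ε lam z = (z₁, z₂) ∧
      ((plane n k ε lam x = (r, c + 1) ∧ plane n k ε lam y = (r + 1, c)) ∨
        (plane n k ε lam y = (r, c + 1) ∧ plane n k ε lam x = (r + 1, c))) := by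
  obtain ⟨⟨K, hK⟩, hx, hy, hxy, hyx⟩ := h
  obtain ⟨a, rfl⟩ : ∃ a, K = a + 3 := ⟨K - 3, by have := hK.1; omega⟩
  obtain ⟨s, v, hd, hI⟩ := hK.exists_diam
  have hconv : (diamSet (2 * a + 2) s v).OrdConnected := hI ▸ Set.ordConnected_Icc
  obtain ⟨r, c, w₁, w₂, z₁, z₂, m₁, m₂, hD, hw, hs, hm, hz⟩ :=
    hd.classify hn hk hε hlam (Or.inr rfl) hconv
  have hwz : w ≤ z := Set.nonempty_Icc.1 ⟨v, hI ▸ Or.inl rfl⟩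
  have hsz : s (2 * a + 2) = z := by
    have h1 : z ∈ diamSet (2 * a + 2) s v := hI ▸ Set.right_mem_Icc.2 hwz
    have h2 : s (2 * a + 2) ∈ Set.Icc w z := hI ▸ Or.inr ⟨_, le_rfl, rfl⟩
    rcases h1 with rfl | ⟨i, hi, rfl⟩
    · exact absurd h2.2 (hd.above _ (by omega) le_rfl).not_ge
    · rcases hi.lt_or_eq with hi | rfl
      · exact absurd h2.2 (hd.lt _ _ hi le_rfl).not_ge
      · rfl
  have hsw : s 0 = w := by
    have h1 : w ∈ diamSet (2 * a + 2) s v := hI ▸ Set.left_mem_Icc.2 hwz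
    have h2 : s 0 ∈ Set.Icc w z := hI ▸ Or.inr ⟨_, Nat.zero_le _, rfl⟩
    rcases h1 with rfl | ⟨i, hi, rfl⟩
    · exact absurd h2.1 (hd.below _ (by omega)).not_ge
    · rcases Nat.eq_zero_or_pos i with rfl | hi0
      · rfl
      · exact absurd h2.1 (hd.lt _ _ hi0 hi).not_ge
  refine ⟨a, r, c, w₁, w₂, z₁, z₂, m₁, m₂, hD, hsw ▸ hw, hsz ▸ hz rfl, ?_⟩
  unfold SidesAt at hs
  rw [hI] at hx hy
  rcases hd.incomparable hx hy hxy hyx with ⟨rfl, rfl⟩ | ⟨rfl, rfl⟩ <;> tauto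

/-- The recursion chooses some interval with top `z`. By uniqueness it has the same bottom and the
same two sides, possibly exchanged, which does not affect the sum of their hook lengths. -/
theorem DPos.hookLength_eq (hlam : IsPar n lam) {a : ℕ} {r c w₁ w₂ z₁ z₂ m₁ m₂ : ℤ}
    (h : DPos n k ε lam a r c w₁ w₂ z₁ z₂ m₁ m₂) {w x y z : SwivelShifted n k ε lam}
    (hw : plane n k ε lam w = (w₁, w₂)) (hx : plane n k ε lam x = (r, c + 1))
    (hy : plane n k ε lam y = (r + 1, c)) (hz : plane n k ε lam z = (z₁, z₂)) :
    hookLength z = hookLength x + hookLength y - hookLength w := by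
  have hex : ∃ t : SwivelShifted n k ε lam × SwivelShifted n k ε lam × SwivelShifted n k ε lam,
      IsDIntervalWithSides t.1 t.2.1 t.2.2 z :=
    ⟨(w, x, y), h.isDIntervalWithSides hn hk hε hw hx hy hz⟩
  rw [hookLength, dif_pos hex]
  obtain ⟨a', r', c', w₁', w₂', z₁', z₂', m₁', m₂', hD, hw', hz', hs⟩ :=
    exists_DPos_of_isDIntervalWithSides hn hk hε hlam hex.choose_spec
  rw [hz, Prod.mk.injEq] at hz'
  obtain ⟨rfl, rfl⟩ := hz'
  obtain ⟨rfl, rfl, rfl, rfl⟩ := h.unique_of_top hn hD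
  have inj := plane_injective (lam := lam) hn hk hε
  rw [inj (hw'.trans hw.symm)]
  rcases hs with ⟨h1, h2⟩ | ⟨h1, h2⟩
  · rw [inj (h1.trans hx.symm), inj (h2.trans hy.symm)]
  · rw [inj (h1.trans hx.symm), inj (h2.trans hy.symm), Nat.add_comm]

theorem hookLength_eq_card (hlam : IsPar n lam) {z : SwivelShifted n k ε lam}
    (h : ∀ a r c w₁ w₂ m₁ m₂, ¬ DPos n k ε lam a r c w₁ w₂ (plane n k ε lam z).1
      (plane n k ε lam z).2 m₁ m₂) (F : Finset (ℤ × ℤ))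
    (hF : ∀ p q, (p, q) ∈ F ↔ Shape n k ε lam p q ∧ (plane n k ε lam z).1 ≤ p ∧
      (plane n k ε lam z).2 ≤ q) : hookLength z = F.card := by
  rw [hookLength, dif_neg]
  · have hbij : Set.BijOn (plane n k ε lam) (Set.Iic z) F := by
      refine ⟨?_, (plane_injective hn hk hε).injOn, ?_⟩
      · intro u hu
        have := (plane_le hn hk hε _ _).1 hu
        exact (hF _ _).2 ⟨shape_plane hn hk hε u, this⟩
      · rintro ⟨p, q⟩ hpq
        have hpq := (hF _ _).1 (Finset.mem_coe.1 hpq)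
        obtain ⟨u, hu⟩ := exists_plane_eq hn hε hpq.1
        refine ⟨u, ?_, hu⟩
        rw [Set.mem_Iic, plane_le hn hk hε, hu]
        exact hpq.2
    rw [Nat.card_congr (hbij.equiv _)]
    simp
  · rintro ⟨t, ht⟩
    obtain ⟨a', r', c', w₁', w₂', z₁', z₂', m₁', m₂', hD, hw', hz', hs⟩ :=
      exists_DPos_of_isDIntervalWithSides hn hk hε hlam ht
    refine h a' r' c' w₁' w₂' m₁' m₂' ?_
    rw [hz']
    exact hD

end Intervals

/-! ### A closed formula for the hook lengths -/

section HookFormula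

variable (n k ε : ℕ) (lam : ℕ → ℕ)

/-- The number of cells in rows `0, …, n` of the shape, except for the column `-1` and including
the cell `(-1, 0)`. -/
def shiftedSize : ℤ := ∑ s ∈ Finset.range n, ((lam s : ℤ) + n + 1 - s) + ε

/-- The contribution of the row `r` to the hook lengths. -/
def rowHook (r : ℤ) : ℤ :=
  -- Forced by the diamond with top `(-1, 0)`: the hook there must be `rowHook 0 + rowHook 1`, and
  -- column `0` already contributes `lam 2 + n - 1`.
  if r = -1 then lam 0 + lam 1 - lam 2 + n + 2
  else if r < n then lam r.toNat + n + 1 - r else ε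

/-- The contribution of the column `c` to the hook lengths. -/
def colHook (c : ℤ) : ℤ :=
  if c = -1 then k + shiftedSize n ε lam - (lam 0 + lam 1 + 2 * n + 1)
  else if c ≤ n - 2 then rowHook n ε lam (c + 2)
  else if c = n - 1 then ε - 1
  else ((Finset.range n).filter fun s => c ≤ (lam s : ℤ) + n - 1).card - c - 2

/-- The hook length at the position `(r, c)`. -/
def planeHook (r c : ℤ) : ℤ :=
  if r = c ∧ r ≤ -1 then k + shiftedSize n ε lam - colHook n k ε lam (-1 - r)
  else if c = -1 ∧ n + 1 ≤ r then n + k - r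
  else rowHook n ε lam r + colHook n k ε lam c

/-- The cells of the shape in the rows `r, …, n - 1` and in columns `≥ c`. -/
noncomputable def rowsFrom (r : ℕ) (c : ℤ) : Finset (ℤ × ℤ) :=
  ((Finset.Ico r n).sigma fun s => Finset.Icc (max c ((s : ℤ) - 1)) ((lam s : ℤ) + n - 1)).image
    fun x => ((x.1 : ℤ), x.2)

variable {n k ε lam}

theorem mem_rowsFrom {r : ℕ} {c p q : ℤ} : (p, q) ∈ rowsFrom n lam r c ↔
    (r : ℤ) ≤ p ∧ p < n ∧ c ≤ q ∧ p - 1 ≤ q ∧ q ≤ lam p.toNat + n - 1 := by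
  simp only [rowsFrom, Finset.mem_image, Finset.mem_sigma, Finset.mem_Ico, Finset.mem_Icc,
    Prod.mk.injEq, Sigma.exists]
  constructor
  · rintro ⟨s, q, h, rfl, rfl⟩
    simp only [Int.toNat_natCast]
    omega
  · intro h
    exact ⟨p.toNat, q, by omega, by omega, rfl⟩

theorem card_rowsFrom (r : ℕ) (c : ℤ) : (rowsFrom n lam r c).card =
    ∑ s ∈ Finset.Ico r n, ((lam s : ℤ) + n - max c ((s : ℤ) - 1)).toNat := by
  rw [rowsFrom, Finset.card_image_of_injective, Finset.card_sigma]
  · refine Finset.sum_congr rfl fun s _ => ?_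
    rw [Int.card_Icc]
    congr 1
    ring
  · rintro ⟨s, q⟩ ⟨s', q'⟩ h
    simp only [Prod.mk.injEq, Nat.cast_inj] at h
    obtain ⟨rfl, rfl⟩ := h
    rfl

theorem rowHook_of_lt {r : ℤ} (h0 : 0 ≤ r) (h : r < n) :
    rowHook n ε lam r = lam r.toNat + n + 1 - r := by
  rw [rowHook, if_neg (by omega), if_pos h]

theorem rowHook_self : rowHook n ε lam n = ε := by
  rw [rowHook, if_neg (by omega), if_neg (by omega)]

theorem colHook_of_le {c : ℤ} (h0 : 0 ≤ c) (h : c ≤ n - 2) :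
    colHook n k ε lam c = rowHook n ε lam (c + 2) := by
  rw [colHook, if_neg (by omega), if_pos h]

theorem colHook_of_ge {c : ℤ} (hn : 3 ≤ n) (h : (n : ℤ) ≤ c) : colHook n k ε lam c =
    ((Finset.range n).filter fun s => c ≤ (lam s : ℤ) + n - 1).card - c - 2 := by
  rw [colHook, if_neg (by omega), if_neg (by omega), if_neg (by omega)]

theorem colHook_sub_one (hn : 3 ≤ n) : colHook n k ε lam (n - 1) = ε - 1 := by
  rw [colHook, if_neg (by omega), if_neg (by omega), if_pos rfl]

theorem colHook_neg_one : colHook n k ε lam (-1) =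
    k + shiftedSize n ε lam - (lam 0 + lam 1 + 2 * n + 1) := by
  rw [colHook, if_pos rfl]

theorem rowHook_neg_one : rowHook n ε lam (-1) = lam 0 + lam 1 - lam 2 + n + 2 := by
  rw [rowHook, if_pos rfl]

theorem shiftedSize_eq (hn : 3 ≤ n) : shiftedSize n ε lam = lam 0 + lam 1 + 2 * n + 1 +
    ∑ s ∈ Finset.Ico 2 n, ((lam s : ℤ) + n + 1 - s) + ε := by
  rw [shiftedSize, Finset.range_eq_Ico, Finset.sum_eq_sum_Ico_succ_bot (by omega),
    Finset.sum_eq_sum_Ico_succ_bot (by omega)]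
  push_cast
  ring

theorem sum_Ico_two_nonneg : 0 ≤ ∑ s ∈ Finset.Ico 2 n, ((lam s : ℤ) + n + 1 - s) :=
  Finset.sum_nonneg fun s hs => by
    have := Finset.mem_Ico.1 hs
    omega

theorem le_sum_Ico_two {r : ℤ} (h2 : 2 ≤ r) (hr : r < n) :
    (lam r.toNat : ℤ) + n + 1 - r ≤ ∑ s ∈ Finset.Ico 2 n, ((lam s : ℤ) + n + 1 - s) := by
  have := Finset.single_le_sum (s := Finset.Ico 2 n) (f := fun s => ((lam s : ℤ) + n + 1 - s))
    (fun s hs => by have := Finset.mem_Ico.1 hs; omega)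
    (Finset.mem_Ico.2 (⟨by omega, by omega⟩ : 2 ≤ r.toNat ∧ r.toNat < n))
  omega

theorem card_filter_eq (hlam : IsPar n lam) {r : ℕ} (hr : r < n) {c : ℤ}
    (hc : c ≤ (lam r : ℤ) + n - 1) :
    ((Finset.range n).filter fun s => c ≤ (lam s : ℤ) + n - 1).card =
      r + 1 + ((Finset.Ico (r + 1) n).filter fun s => c ≤ (lam s : ℤ) + n - 1).card := by
  have : (Finset.range n).filter (fun s => c ≤ (lam s : ℤ) + n - 1) =
      Finset.range (r + 1) ∪ (Finset.Ico (r + 1) n).filter (fun s => c ≤ (lam s : ℤ) + n - 1) := by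
    ext s
    simp only [Finset.mem_filter, Finset.mem_range, Finset.mem_union, Finset.mem_Ico]
    constructor
    · intro h
      omega
    · rintro (h | h)
      · have := hlam.1 (show s ≤ r by omega)
        omega
      · omega
  rw [this, Finset.card_union_of_disjoint, Finset.card_range]
  rw [Finset.disjoint_left]
  intro s hs hs'
  simp at hs hs'
  omega

/-- The recursion for `hookLength` uses truncated subtraction; positivity of the expected value
shows that nothing is truncated. It also makes the factors `1 - q ^ h` invertible. -/
theorem planeHook_pos (hn : 3 ≤ n) (hε : ε = 0 ∨ ε = 1) (hlam : IsPar n lam) {r c : ℤ}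
    (h : Shape n k ε lam r c) : 1 ≤ planeHook n k ε lam r c := by
  have hsz := shiftedSize_eq (ε := ε) (lam := lam) hn
  have hnn := sum_Ico_two_nonneg (n := n) (lam := lam)
  have col_ge : ∀ r c : ℤ, 0 ≤ r → r < n → c ≤ lam r.toNat + n - 1 → 0 ≤ c → r - 1 ≤ c →
      1 ≤ rowHook n ε lam r + colHook n k ε lam c := by
    intro r c h0 h1 h2 h3 h4
    rw [rowHook_of_lt h0 h1]
    rcases (show c ≤ n - 3 ∨ c = n - 2 ∨ c = n - 1 ∨ (n : ℤ) ≤ c by omega) with h | rfl | rfl | h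
    · rw [colHook_of_le h3 (by omega), rowHook_of_lt (by omega) (by omega)]
      omega
    · rw [colHook_of_le h3 (by omega), sub_add_cancel, rowHook_self]
      omega
    · rw [colHook_sub_one hn]
      omega
    · rw [colHook_of_ge hn h, card_filter_eq hlam (r := r.toNat) (by omega) (by omega)]
      push_cast
      omega
  have row_one : ((lam 1 : ℕ) : ℤ) ≤ lam 0 := by
    have := hlam.1 (show 0 ≤ 1 by omega)
    omega
  have hl12 : ((lam 2 : ℕ) : ℤ) ≤ lam 1 := by
    have := hlam.1 (show 1 ≤ 2 by omega)
    omega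
  unfold planeHook
  split_ifs with h1 h2
  · have hb : 0 ≤ -1 - r := by omega
    rcases (show -1 - r ≤ n - 3 ∨ -1 - r = n - 2 ∨ -1 - r = n - 1 ∨ (n : ℤ) ≤ -1 - r by omega) with
      h | h | h | h
    · rw [colHook_of_le hb (by omega), rowHook_of_lt (by omega) (by omega)]
      have := le_sum_Ico_two (n := n) (lam := lam) (r := -1 - r + 2) (by omega) (by omega)
      omega
    · rw [h, colHook_of_le (by omega) (by omega), sub_add_cancel, rowHook_self]
      omega
    · rw [h, colHook_sub_one hn]
      omega
    · rw [colHook_of_ge hn h]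
      have : ((Finset.range n).filter fun s => -1 - r ≤ (lam s : ℤ) + n - 1).card ≤ n := by
        simpa using Finset.card_filter_le (Finset.range n) (fun s => -1 - r ≤ (lam s : ℤ) + n - 1)
      omega
  · unfold Shape at h
    omega
  · rcases h with h | h | h | h | h | h
    · obtain ⟨rfl, h⟩ := h
      exact col_ge _ _ (by omega) (by omega) (by omega) (by omega) (by omega)
    · exact col_ge _ _ (by omega) (by omega) (by omega) (by omega) (by omega)
    · obtain ⟨rfl, h⟩ := h
      rcases (show r = 0 ∨ r = n ∨ (1 ≤ r ∧ r < n) by omega) with rfl | rfl | h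
      · rw [rowHook_of_lt le_rfl (by omega), show (0 : ℤ) - 1 = -1 by omega, colHook_neg_one]
        simp only [Int.toNat_zero]
        omega
      · rw [rowHook_self, colHook_sub_one hn]
        omega
      · exact col_ge _ _ (by omega) (by omega) (by omega) (by omega) (by omega)
    · obtain ⟨rfl, rfl⟩ := h
      rw [rowHook_of_lt (by omega) (by omega), colHook_neg_one]
      simp only [Int.toNat_one]
      omega
    · omega
    · obtain ⟨rfl, rfl⟩ := h
      rw [rowHook_neg_one, colHook_of_le le_rfl (by omega), rowHook_of_lt (by omega) (by omega)]
      simp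
      omega

/-- For unit squares away from the corner `(-1, -1)` this is additivity. For the diamonds extended
once, `colHook c = rowHook (c + 2)` reduces both sides to a sum of two neighbouring row
contributions. For tops on the negative diagonal the hooks at `(-1, 0)` and `(0, -1)`, less the
contribution of row `0`, add up to `k + shiftedSize`, so only a column contribution is subtracted.
-/
theorem DPos.planeHook_eq (hn : 3 ≤ n) {a : ℕ} {r c w₁ w₂ z₁ z₂ m₁ m₂ : ℤ}
    (h : DPos n k ε lam a r c w₁ w₂ z₁ z₂ m₁ m₂) :
    planeHook n k ε lam z₁ z₂ = planeHook n k ε lam r (c + 1) + planeHook n k ε lam (r + 1) c -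
      planeHook n k ε lam w₁ w₂ := by
  obtain ⟨h0, h1, h2, h3, hSw, hSz, h⟩ := h
  have hsq := Shape.square_cases hn h1 h2 h3
  have gen : ∀ r c : ℤ, r ≤ n → (0 ≤ r ∨ 0 ≤ c) → planeHook n k ε lam r c =
      rowHook n ε lam r + colHook n k ε lam c := by
    intro r c h h'
    rw [planeHook, if_neg (by omega), if_neg (by omega)]
  have b0 : colHook n k ε lam 0 = lam 2 + n - 1 := by
    rw [colHook_of_le le_rfl (by omega), rowHook_of_lt (by omega) (by omega)]
    simp
    ring
  have r0 : rowHook n ε lam 0 = lam 0 + n + 1 := by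
    rw [rowHook_of_lt (by omega) (by omega)]
    simp
  have am := rowHook_neg_one (n := n) (ε := ε) (lam := lam)
  have bm := colHook_neg_one (n := n) (k := k) (ε := ε) (lam := lam)
  rcases h with ⟨rfl, rfl, rfl, rfl, rfl⟩ | ⟨rfl, hr, rfl, rfl, rfl, -, -, h⟩ |
      ⟨ha, rfl, rfl, rfl, rfl, -, -, rfl, rfl⟩
  · rcases hsq with ⟨rfl, rfl⟩ | h
    · rw [gen (-1) (-1 + 1) (by omega) (by omega), gen (-1 + 1) (-1) (by omega) (by omega),
        gen (-1 + 1) (-1 + 1) (by omega) (by omega), planeHook, if_pos (by omega)]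
      norm_num
      omega
    · rw [gen z₁ (z₂ + 1) (by omega) (by omega), gen (z₁ + 1) z₂ (by omega) (by omega),
        gen (z₁ + 1) (z₂ + 1) (by omega) (by omega), gen z₁ z₂ (by omega) (by omega)]
      ring
  · have hrn : r + 2 ≤ n := by
      unfold Shape at hSw
      omega
    rw [gen r (r + 1) (by omega) (by omega), gen (r + 1) r (by omega) (by omega),
      gen (r + 2) (r + 1) (by omega) (by omega), colHook_of_le hr (by omega)]
    rcases h with ⟨rfl, rfl, rfl⟩ | ⟨h1, rfl, rfl⟩
    · rw [gen (-1) 0 (by omega) (by omega), am, b0, r0, rowHook_of_lt (by omega) (by omega)]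
      simp
      ring
    · rw [gen z₁ (z₁ - 1) (by omega) (by omega), colHook_of_le (by omega) (by omega),
        show z₁ - 1 + 2 = z₁ + 1 by ring]
      ring
  · rw [gen (-1) (-1 + 1) (by omega) (by omega), gen (-1 + 1) (-1) (by omega) (by omega),
      gen 0 a (by omega) (by omega), planeHook, if_pos (by omega),
      show -1 - (-1 - (a : ℤ)) = a by ring]
    norm_num
    omega

/-- By `hnext` no later row extends beyond column `c`, and since `n - 1 ≤ c` each of them
contributes at most its cell in column `c`: the count is an arm plus a leg. -/
theorem card_rowsFrom_eq (hlam : IsPar n lam) {r : ℕ} (hr : r < n) {c : ℤ} (hrc : (r : ℤ) ≤ c)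
    (hc : c ≤ (lam r : ℤ) + n - 1) (hcn : (n : ℤ) - 1 ≤ c)
    (hnext : (r : ℤ) + 1 < n → (lam (r + 1) : ℤ) + n - 1 ≤ c) :
    ((rowsFrom n lam r c).card : ℤ) = lam r + n - c - r - 1 +
      ((Finset.range n).filter fun s => c ≤ (lam s : ℤ) + n - 1).card := by
  have h2 : ∀ s ∈ Finset.Ico (r + 1) n, ((lam s : ℤ) + n - max c ((s : ℤ) - 1)).toNat =
      if c ≤ (lam s : ℤ) + n - 1 then 1 else 0 := by
    intro s hs
    have hs := Finset.mem_Ico.1 hs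
    have := hlam.1 hs.1
    split_ifs <;> omega
  rw [card_rowsFrom, card_filter_eq hlam hr hc, Finset.sum_eq_sum_Ico_succ_bot hr,
    Finset.sum_congr rfl h2, Finset.card_filter]
  push_cast
  omega

variable (hn : 3 ≤ n) (hk : 1 ≤ k) (hε : ε = 0 ∨ ε = 1) (hlam : IsPar n lam)

include hn hk hε hlam

/-- The hook lengths of the elements that are not the top of a `d_k`-interval, except for those
in the column `-1`. -/
theorem hookLength_of_rows {z : SwivelShifted n k ε lam} {r : ℕ} {c : ℤ}
    (hz : plane n k ε lam z = ((r : ℤ), c)) (hc0 : 0 ≤ c) (hr : r < n)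
    (h : ∀ a r' c' w₁ w₂ m₁ m₂, ¬ DPos n k ε lam a r' c' w₁ w₂ r c m₁ m₂) :
    (hookLength z : ℤ) = (rowsFrom n lam r c).card + if c ≤ n - 1 then (ε : ℤ) else 0 := by
  let F : Finset (ℤ × ℤ) := if ε = 1 ∧ c ≤ n - 1 then {((n : ℤ), (n : ℤ) - 1)} else ∅
  have hF : ∀ p q, (p, q) ∈ F ↔ (ε = 1 ∧ c ≤ n - 1) ∧ p = n ∧ q = n - 1 := by
    intro p q
    simp only [F]
    split_ifs with h'
    · simp [h']
    · simp only [Finset.notMem_empty, false_iff]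
      tauto
  have hdisj : Disjoint (rowsFrom n lam r c) F := by
    rw [Finset.disjoint_left]
    rintro ⟨p, q⟩ h1 h2
    rw [mem_rowsFrom] at h1
    rw [hF] at h2
    omega
  rw [hookLength_eq_card hn hk hε hlam (z := z) (by rw [hz]; exact h) (rowsFrom n lam r c ∪ F),
    Finset.card_union_of_disjoint hdisj]
  · have : F.card = if ε = 1 ∧ c ≤ n - 1 then 1 else 0 := by
      simp only [F]
      split_ifs <;> simp
    rw [this]
    push_cast
    split_ifs <;> omega
  · intro p q
    rw [Finset.mem_union, mem_rowsFrom, hF, hz]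
    unfold Shape
    omega

/-- Induction along the recursion: `DPos.planeHook_eq` deals with tops of diamonds. The remaining
elements are the ends of rows and columns of `λ`, the last subdiagonal cells, `(1, -1)` and the leg,
where the elements below are counted directly. -/
theorem hookLength_eq_planeHook (z : SwivelShifted n k ε lam) :
    (hookLength z : ℤ) = planeHook n k ε lam (plane n k ε lam z).1 (plane n k ε lam z).2 := by
  refine WellFoundedLT.induction (motive := fun z : SwivelShifted n k ε lam => (hookLength z : ℤ) =
    planeHook n k ε lam (plane n k ε lam z).1 (plane n k ε lam z).2) z fun z ih => ?_
  have hS := shape_plane hn hk hε z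
  have htop : ∀ {a : ℕ} {r c w₁ w₂ m₁ m₂ : ℤ}, DPos n k ε lam a r c w₁ w₂
      (plane n k ε lam z).1 (plane n k ε lam z).2 m₁ m₂ →
      (hookLength z : ℤ) = planeHook n k ε lam (plane n k ε lam z).1 (plane n k ε lam z).2 := by
    intro a r c w₁ w₂ m₁ m₂ hD
    obtain ⟨w, hw⟩ := exists_plane_eq hn hε hD.2.2.2.2.1
    obtain ⟨x, hx⟩ := exists_plane_eq hn hε hD.2.1
    obtain ⟨y, hy⟩ := exists_plane_eq hn hε hD.2.2.1
    have hlt := (hD.isDIntervalWithSides hn hk hε hw hx hy rfl).lt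
    have hp := planeHook_pos hn hε hlam hS
    have heq := hD.planeHook_eq hn
    have h1 := ih x hlt.1
    have h2 := ih y hlt.2.1
    have h3 := ih w hlt.2.2
    rw [hx] at h1
    rw [hy] at h2
    rw [hw] at h3
    rw [hD.hookLength_eq hn hk hε hlam hw hx hy rfl]
    dsimp only at h1 h2 h3
    omega
  have hnot : ∀ {r c : ℤ}, plane n k ε lam z = (r, c) →
      (∀ a r' c' w₁ w₂ m₁ m₂, ¬ DPos n k ε lam a r' c' w₁ w₂ r c m₁ m₂) ∨
      (hookLength z : ℤ) = planeHook n k ε lam r c := by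
    intro r c hz
    by_cases h : ∃ a r' c' w₁ w₂ m₁ m₂, DPos n k ε lam a r' c' w₁ w₂ r c m₁ m₂
    · obtain ⟨a, r', c', w₁, w₂, m₁, m₂, hD⟩ := h
      right
      have := htop (a := a) (r := r') (c := c') (w₁ := w₁) (w₂ := w₂) (m₁ := m₁) (m₂ := m₂)
        (by rw [hz]; exact hD)
      rwa [hz] at this
    · left
      intro a r' c' w₁ w₂ m₁ m₂ hD
      exact h ⟨a, r', c', w₁, w₂, m₁, m₂, hD⟩
  have hsz := shiftedSize_eq (ε := ε) (lam := lam) hn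
  generalize hz : plane n k ε lam z = p at *
  obtain ⟨r, c⟩ := p
  dsimp only at *
  rcases hnot rfl with hno | h'
  swap
  · exact h'
  have hsquare : ¬ (Shape n k ε lam r (c + 1) ∧ Shape n k ε lam (r + 1) c ∧
      Shape n k ε lam (r + 1) (c + 1)) := fun h =>
    hno 0 r c (r + 1) (c + 1) 0 0 ⟨hS, h.1, h.2.1, h.2.2, h.2.2, hS, Or.inl (by simp)⟩
  have hl := hlam.toNat_le (show r ≤ r + 1 by omega)
  -- cells to the right of the main diagonal, and the last diagonal cell
  have hright : 0 ≤ r → r < n → r ≤ c → c ≤ lam r.toNat + n - 1 →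
      (hookLength z : ℤ) = planeHook n k ε lam r c := by
    intro h0 h1 h2 h3
    lift r to ℕ using h0
    simp only [Int.toNat_natCast] at *
    have hs1 : (r : ℤ) + 1 < n → (lam (r + 1) : ℤ) + n - 1 ≤ c := by
      intro h4
      by_contra! h5
      refine hsquare ?_
      have e : ((r : ℤ) + 1).toNat = r + 1 := by omega
      unfold Shape
      rw [e] at hl ⊢
      simp only [Int.toNat_natCast]
      omega
    have hcn : (n : ℤ) - 1 ≤ c := by
      by_cases h4 : (r : ℤ) + 1 < n
      · have := hs1 h4
        omega
      · omega
    rw [hookLength_of_rows hn hk hε hlam hz (by omega) (by omega) hno,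
      card_rowsFrom_eq hlam (by omega) h2 h3 hcn hs1, show planeHook n k ε lam r c =
        rowHook n ε lam r + colHook n k ε lam c by
          rw [planeHook, if_neg (by omega), if_neg (by omega)], rowHook_of_lt (by omega) h1]
    rcases hcn.eq_or_lt with rfl | hcn
    · rw [colHook_sub_one hn, if_pos le_rfl]
      have : (Finset.range n).filter (fun s => (n : ℤ) - 1 ≤ (lam s : ℤ) + n - 1) =
          Finset.range n := by
        rw [Finset.filter_true_of_mem]
        intro s _
        omega
      rw [this, Finset.card_range]
      simp only [Int.toNat_natCast]
      ring
    · rw [colHook_of_ge hn (by omega), if_neg (by omega)]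
      simp only [Int.toNat_natCast]
      ring
  have hS' := hS
  rcases hS with h | h | h | h | h | h
  · obtain ⟨rfl, h⟩ := h
    by_cases h0 : 0 ≤ r
    · exact hright h0 h.2 le_rfl (by omega)
    · exfalso
      by_cases h1 : r = -1
      · subst h1
        refine hsquare ⟨?_, ?_, ?_⟩ <;> unfold Shape <;> omega
      -- Here `a = -1 - r`, and the bottom `(0, a)` is occupied because the diagonal reaches up
      -- exactly as far as row `0` reaches to the right.
      · refine hno (-1 - r).toNat (-1) (-1) 0 (-1 - r) (r + 1) (r + 1)
          ⟨?_, ?_, ?_, ?_, ?_, hS', ?_⟩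
        · unfold Shape; omega
        · unfold Shape; omega
        · unfold Shape; omega
        · unfold Shape; omega
        · unfold Shape; simp only [Int.toNat_zero]; omega
        · right; right; omega
  · exact hright h.1 h.2.1 h.2.2.1.le h.2.2.2
  · obtain ⟨rfl, h0, h⟩ := h
    by_cases h00 : r = 0
    · subst h00
      exact absurd (by refine ⟨?_, ?_, ?_⟩ <;> unfold Shape <;> omega) hsquare
    by_cases h1 : r + 2 < n + ε
    · exfalso
      refine hno 1 r r (r + 2) (r + 1) r r ⟨?_, ?_, ?_, ?_, ?_, hS', ?_⟩
      · unfold Shape; omega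
      · unfold Shape; omega
      · unfold Shape; omega
      · unfold Shape; omega
      · unfold Shape; omega
      · right; left; omega
    rw [planeHook, if_neg (by omega), if_neg (by omega)]
    rcases (show r = n ∨ r = n - 1 ∨ (r = n - 2 ∧ ε = 0) by omega) with rfl | rfl | ⟨rfl, rfl⟩
    · rw [hookLength_eq_card hn hk hε hlam (z := z) (by rw [hz]; exact hno)
        {((n : ℤ), (n : ℤ) - 1)}, rowHook_self, colHook_sub_one hn, Finset.card_singleton]
      · push_cast
        omega
      · intro p q
        rw [hz, Finset.mem_singleton, Prod.mk.injEq]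
        unfold Shape
        omega
    · have e : ((n - 1 : ℕ) : ℤ) = (n : ℤ) - 1 := by omega
      rw [← e] at hz hno
      rw [hookLength_of_rows hn hk hε hlam hz (by omega) (by omega) hno,
        if_pos (by omega), card_rowsFrom, show Finset.Ico (n - 1) n = {n - 1} by
          ext x; simp; omega, Finset.sum_singleton, rowHook_of_lt (by omega) (by omega),
        colHook_of_le (by omega) (by omega), show (n : ℤ) - 1 - 1 + 2 = n by ring, rowHook_self,
        ← e, Int.toNat_natCast]
      omega
    · have e : ((n - 2 : ℕ) : ℤ) = (n : ℤ) - 2 := by omega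
      rw [← e] at hz hno
      rw [hookLength_of_rows hn hk hε hlam hz (by omega) (by omega) hno,
        if_pos (by omega), card_rowsFrom, show Finset.Ico (n - 2) n = {n - 2, n - 1} by
          ext x; simp; omega, Finset.sum_pair (by omega), rowHook_of_lt (by omega) (by omega),
        colHook_of_le (by omega) (by omega), rowHook_of_lt (by omega) (by omega),
        show ((n : ℤ) - 2 - 1 + 2).toNat = n - 1 by omega, ← e, Int.toNat_natCast]
      push_cast
      omega
  · obtain ⟨rfl, rfl⟩ := h
    let F : Finset (ℤ × ℤ) := if ε = 1 then {((n : ℤ), (n : ℤ) - 1)} else ∅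
    have hF : ∀ p q, (p, q) ∈ F ↔ ε = 1 ∧ p = n ∧ q = n - 1 := by
      intro p q
      simp only [F]
      split_ifs with h' <;> simp [h']
    let G : Finset (ℤ × ℤ) := (insert 1 (Finset.Ico ((n : ℤ) + 1) (n + k))).image fun p => (p, -1)
    have hG : ∀ p q, (p, q) ∈ G ↔ q = -1 ∧ (p = 1 ∨ ((n : ℤ) + 1 ≤ p ∧ p < n + k)) := by
      intro p q
      simp only [G, Finset.mem_image, Finset.mem_insert, Finset.mem_Ico, Prod.mk.injEq]
      constructor
      · rintro ⟨x, hx, rfl, rfl⟩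
        exact ⟨rfl, hx⟩
      · rintro ⟨rfl, hx⟩
        exact ⟨p, hx, rfl, rfl⟩
    have hcardF : (F.card : ℤ) = ε := by
      simp only [F]
      rcases hε with rfl | rfl <;> simp
    have hcardG : (G.card : ℤ) = k := by
      rw [Finset.card_image_of_injective _ (fun p q h => (Prod.mk.inj h).1),
        Finset.card_insert_of_notMem (by simp; omega), Int.card_Ico]
      omega
    have hd1 : Disjoint (rowsFrom n lam 1 0) F := by
      rw [Finset.disjoint_left]
      rintro ⟨p, q⟩ h1 h2
      rw [mem_rowsFrom] at h1
      rw [hF] at h2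
      omega
    have hd2 : Disjoint (rowsFrom n lam 1 0 ∪ F) G := by
      rw [Finset.disjoint_left]
      rintro ⟨p, q⟩ h1 h2
      rw [Finset.mem_union, mem_rowsFrom, hF] at h1
      rw [hG] at h2
      omega
    rw [hookLength_eq_card hn hk hε hlam (z := z) (by rw [hz]; exact hno)
      (rowsFrom n lam 1 0 ∪ F ∪ G), Finset.card_union_of_disjoint hd2,
      Finset.card_union_of_disjoint hd1]
    · have hsum : ((rowsFrom n lam 1 0).card : ℤ) = lam 1 + n +
          ∑ s ∈ Finset.Ico 2 n, ((lam s : ℤ) + n + 1 - s) := by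
        rw [card_rowsFrom, Finset.sum_eq_sum_Ico_succ_bot (by omega)]
        rw [Nat.cast_add, Nat.cast_sum]
        refine congrArg₂ (· + ·) ?_ ?_
        · simp only [Nat.cast_one]
          omega
        · refine Finset.sum_congr rfl fun s hs => ?_
          have := Finset.mem_Ico.1 hs
          omega
      rw [planeHook, if_neg (by omega), if_neg (by omega), rowHook_of_lt (by omega) (by omega),
        colHook_neg_one, Int.toNat_one]
      push_cast
      omega
    · intro p q
      rw [Finset.mem_union, Finset.mem_union, mem_rowsFrom, hF, hG, hz]
      unfold Shape
      push_cast
      omega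
  · obtain ⟨rfl, h1, h2⟩ := h
    rw [hookLength_eq_card hn hk hε hlam (z := z) (by rw [hz]; exact hno)
        ((Finset.Ico r (n + k)).image fun p => (p, -1)),
      Finset.card_image_of_injective _ (fun p q h => (Prod.mk.inj h).1), Int.card_Ico,
      planeHook, if_neg (by omega), if_pos (by omega)]
    · omega
    · intro p q
      rw [hz]
      simp only [Finset.mem_image, Finset.mem_Ico, Prod.mk.injEq]
      unfold Shape
      constructor
      · rintro ⟨x, hx, rfl, rfl⟩
        omega
      · intro h
        exact ⟨p, by omega, rfl, by omega⟩
  · obtain ⟨rfl, rfl⟩ := h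
    exfalso
    refine hno 1 0 0 2 1 0 0 ⟨?_, ?_, ?_, ?_, ?_, hS', ?_⟩
    · unfold Shape; omega
    · unfold Shape; omega
    · unfold Shape; omega
    · unfold Shape; omega
    · unfold Shape; omega
    · right; left; omega

end HookFormula

/-! ### From real sums on `(0, 1)` to formal power series -/

section PowerSeries

/-- A power series whose sum vanishes on the interval `(0, 1)` is zero. -/
theorem eq_zero_of_hasSum_zero {c : ℕ → ℝ}
    (h : ∀ q : ℝ, 0 < q → q < 1 → HasSum (fun N => c N * q ^ N) 0) : c = 0 := by
  let f : ℝ → ℝ := fun z => ∑' N, z ^ N • c N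
  let p : FormalMultilinearSeries ℝ ℝ ℝ := FormalMultilinearSeries.ofScalars ℝ c
  have hp : HasFPowerSeriesAt f p 0 := by
    rw [hasFPowerSeriesAt_iff]
    filter_upwards [Metric.ball_mem_nhds (0 : ℝ) (show (0 : ℝ) < 1 / 2 by norm_num)] with z hz
    rw [mem_ball_zero_iff, Real.norm_eq_abs] at hz
    have hs : Summable fun N => z ^ N • c N := by
      refine Summable.of_norm_bounded (g := fun N => ‖c N * (1 / 2 : ℝ) ^ N‖)
        (h (1 / 2) (by norm_num) (by norm_num)).summable.norm fun N => ?_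
      rw [norm_smul, norm_mul, mul_comm, norm_pow, norm_pow, Real.norm_eq_abs z]
      refine mul_le_mul_of_nonneg_left ?_ (norm_nonneg _)
      refine pow_le_pow_left₀ (abs_nonneg _) ?_ _
      rw [Real.norm_of_nonneg (by norm_num)]
      exact hz.le
    simpa only [p, f, FormalMultilinearSeries.coeff_ofScalars, zero_add] using hs.hasSum
  by_contra hc
  have hev := hp.locally_ne_zero ((FormalMultilinearSeries.ofScalars_series_eq_zero ℝ).not.2 hc)
  have hev' : ∀ᶠ z in nhdsWithin (0 : ℝ) (Set.Ioi 0), f z ≠ 0 :=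
    hev.filter_mono (nhdsWithin_mono _ fun x hx => ne_of_gt hx)
  obtain ⟨z, hz, hz0, hz1⟩ := (hev'.and (Ioo_mem_nhdsGT (zero_lt_one' ℝ))).exists
  refine hz ?_
  have := (h z hz0 hz1).tsum_eq
  simpa only [f, smul_eq_mul, mul_comm] using this

/-- The power series `f` converges on `(0, 1)` to the function `g`. -/
def SumsTo (f : PowerSeries ℚ) (g : ℝ → ℝ) : Prop :=
  ∀ q : ℝ, 0 < q → q < 1 → HasSum (fun N => ((PowerSeries.coeff N f : ℚ) : ℝ) * q ^ N) (g q)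

theorem SumsTo.mul_one_sub_X_pow {f : PowerSeries ℚ} {g : ℝ → ℝ} (h : SumsTo f g) (a : ℕ) :
    SumsTo (f * (1 - (PowerSeries.X : PowerSeries ℚ) ^ a)) fun q => g q * (1 - q ^ a) := by
  intro q h0 h1
  have hshift : HasSum (fun N => ((PowerSeries.coeff N (f * PowerSeries.X ^ a) : ℚ) : ℝ) * q ^ N)
      (g q * q ^ a) := by
    have hinj : Function.Injective fun N : ℕ => N + a := add_left_injective a
    rw [← hinj.hasSum_iff]
    · convert! (h q h0 h1).mul_right (q ^ a) using 2 with N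
      rw [Function.comp_apply, PowerSeries.coeff_mul_X_pow, pow_add, mul_assoc]
    · intro N hN
      rw [PowerSeries.coeff_mul_X_pow', if_neg]
      · simp
      · intro hle
        exact hN ⟨N - a, Nat.sub_add_cancel hle⟩
  convert! (h q h0 h1).sub hshift using 1
  · funext N
    rw [mul_sub, mul_one, map_sub]
    push_cast
    ring
  · ring

theorem SumsTo.eq_one {f : PowerSeries ℚ} (h : SumsTo f fun _ => 1) : f = 1 := by
  have hc := eq_zero_of_hasSum_zero
    (c := fun N => ((PowerSeries.coeff N f : ℚ) : ℝ) - if N = 0 then 1 else 0) fun q h0 h1 => by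
      have h2 := (h q h0 h1).sub (hasSum_ite_eq (0 : ℕ) (1 : ℝ))
      rw [sub_self] at h2
      convert! h2 using 2 with N
      rw [sub_mul]
      split_ifs with hN <;> simp [hN]
  ext N
  have := congrFun hc N
  simp only [Pi.zero_apply, sub_eq_zero] at this
  rw [PowerSeries.coeff_one]
  split_ifs at this ⊢
  · exact_mod_cast this
  · exact_mod_cast this

/-- Multiplying by polynomials suffices, so convergence of the inverse series never has to be
discussed. -/
theorem SumsTo.mul_prod {ι : Type} (s : Finset ι) (h : ι → ℕ) {f : PowerSeries ℚ} {g : ℝ → ℝ}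
    (hf : SumsTo f g) : SumsTo (f * ∏ i ∈ s, (1 - (PowerSeries.X : PowerSeries ℚ) ^ h i))
      fun q => g q * ∏ i ∈ s, (1 - q ^ h i) := by
  classical
  induction s using Finset.induction_on with
  | empty => simpa using hf
  | insert i s hi ih =>
    simp only [Finset.prod_insert hi]
    convert ih.mul_one_sub_X_pow (h i) using 1
    · ring
    · funext q
      ring

end PowerSeries

/-! ### Reduction of the formal identity to real numbers -/

section GF

/-- The sum of `q ^ |σ|` over all `P`-partitions `σ` is `a`. -/
def HasPartitionSum (P : Type) [PartialOrder P] [Fintype P] (q a : ℝ) : Prop :=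
  HasSum (fun σ : {σ : P → ℕ // Antitone σ} => q ^ ∑ x, σ.1 x) a

/-- The `P`-partitions are grouped by their size; each group is finite, as every value is at most
the size. -/
theorem HasPartitionSum.hasSum_coeff {P : Type} [PartialOrder P] [Fintype P] {q a : ℝ}
    (h : HasPartitionSum P q a) :
    HasSum (fun N => ((PowerSeries.coeff N (GF P) : ℚ) : ℝ) * q ^ N) a := by
  let w : {σ : P → ℕ // Antitone σ} → ℕ := fun σ => ∑ x, σ.1 x
  have h1 : HasSum (fun y : Σ N, {σ // w σ = N} => q ^ w y.2.1) a :=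
    ((Equiv.sigmaFiberEquiv w).hasSum_iff (f := fun σ => q ^ w σ)).2 h
  have hfin : ∀ N, Finite {σ // w σ = N} := fun N => by
    have : Finite {σ : P → ℕ // ∀ x, σ x ≤ N} :=
      Finite.of_injective (β := P → Fin (N + 1))
        (fun σ x => ⟨σ.1 x, Nat.lt_succ_of_le (σ.2 x)⟩) fun σ τ e => by
          ext x
          simpa using congrArg Fin.val (congrFun e x)
    let F : {σ // w σ = N} → {σ : P → ℕ // ∀ x, σ x ≤ N} := fun σ => ⟨σ.1.1, fun x =>
      (Finset.single_le_sum (f := σ.1.1) (fun _ _ => Nat.zero_le _) (Finset.mem_univ x)).trans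
        (le_of_eq σ.2)⟩
    exact Finite.of_injective F fun σ τ e => Subtype.ext (Subtype.ext (Subtype.mk.inj e))
  have hcard : ∀ N, ((PowerSeries.coeff N (GF P) : ℚ) : ℝ) = Nat.card {σ // w σ = N} := by
    intro N
    rw [GF, PowerSeries.coeff_mk, Rat.cast_natCast, Nat.cast_inj]
    exact (Nat.card_congr (Equiv.subtypeSubtypeEquivSubtypeInter Antitone fun σ => ∑ x, σ x = N)).symm
  refine h1.sigma fun N => ?_
  have := Fintype.ofFinite {σ // w σ = N}
  have h2 := hasSum_fintype fun σ : {σ // w σ = N} => q ^ w σ.1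
  rw [Finset.sum_congr rfl fun σ _ => congrArg (q ^ ·) σ.2, Finset.sum_const, nsmul_eq_mul,
    Finset.card_univ, ← Nat.card_eq_fintype_card] at h2
  rw [hcard]
  exact h2

/-- The generating function times `∏ (1 - X ^ h x)` sums to `1` on `(0, 1)`, hence is `1`; as `h x >
0`, the factors have constant term `1` and can be inverted. -/
theorem GF_eq_prod {P : Type} [PartialOrder P] [Fintype P] (h : P → ℕ) (hpos : ∀ x, 0 < h x)
    (hP : ∀ q : ℝ, 0 < q → q < 1 → HasPartitionSum P q (∏ x, (1 - q ^ h x))⁻¹) :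
    GF P = ∏ x, (1 - (PowerSeries.X : PowerSeries ℚ) ^ h x)⁻¹ := by
  have h1 : SumsTo (GF P) fun q => (∏ x, (1 - q ^ h x))⁻¹ := fun q h0 h1 =>
    (hP q h0 h1).hasSum_coeff
  have h2 : GF P * ∏ x, (1 - (PowerSeries.X : PowerSeries ℚ) ^ h x) = 1 := by
    refine SumsTo.eq_one fun q h0 h1' => ?_
    convert! h1.mul_prod Finset.univ h q h0 h1' using 1
    dsimp only
    rw [inv_mul_cancel₀]
    exact Finset.prod_ne_zero_iff.2 fun x _ =>
      (sub_pos.2 (pow_lt_one₀ h0.le h1' (hpos x).ne')).ne'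
  have h3 : (∏ x, (1 - (PowerSeries.X : PowerSeries ℚ) ^ h x)) *
      ∏ x, (1 - (PowerSeries.X : PowerSeries ℚ) ^ h x)⁻¹ = 1 := by
    rw [← Finset.prod_mul_distrib]
    refine Finset.prod_eq_one fun x _ => PowerSeries.mul_inv_cancel _ ?_
    simp [(hpos x).ne']
  calc GF P = GF P * ((∏ x, (1 - (PowerSeries.X : PowerSeries ℚ) ^ h x)) *
      ∏ x, (1 - (PowerSeries.X : PowerSeries ℚ) ^ h x)⁻¹) := by rw [h3, mul_one]
    _ = _ := by rw [← mul_assoc, h2, one_mul]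

end GF

/-! ### The chain on top -/

section Chain

theorem hasSum_sigma_of_nonneg {α : Type*} {β : α → Type*} {f : (Σ x, β x) → ℝ} {g : α → ℝ} {a : ℝ}
    (h0 : ∀ x, 0 ≤ f x) (h1 : ∀ x, HasSum (fun y => f ⟨x, y⟩) (g x)) (h2 : HasSum g a) :
    HasSum f a := by
  refine HasSum.sigma_of_hasSum h2 h1 ((summable_sigma_of_nonneg h0).2
    ⟨fun x => (h1 x).summable, ?_⟩)
  simpa only [(h1 _).tsum_eq] using h2.summable

theorem hasSum_mul_of_nonneg {α β : Type*} {f : α → ℝ} {g : β → ℝ} {a b : ℝ}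
    (hf0 : ∀ x, 0 ≤ f x) (hg0 : ∀ x, 0 ≤ g x) (hf : HasSum f a) (hg : HasSum g b) :
    HasSum (fun x : α × β => f x.1 * g x.2) (a * b) :=
  hf.mul hg (Summable.mul_of_nonneg hf.summable hg.summable hf0 hg0)

variable {Q : Type} [PartialOrder Q] [Fintype Q] {m : ℕ}

theorem antitone_sumLex_iff {A B : Type} [PartialOrder A] [PartialOrder B] {σ : A ⊕ₗ B → ℕ} :
    Antitone σ ↔ Antitone (fun a => σ (toLex (.inl a))) ∧ Antitone (fun b => σ (toLex (.inr b))) ∧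
      ∀ a b, σ (toLex (.inr b)) ≤ σ (toLex (.inl a)) := by
  constructor
  · intro h
    exact ⟨fun a b hab => h (Sum.Lex.inl_le_inl_iff.2 hab),
      fun a b hab => h (Sum.Lex.inr_le_inr_iff.2 hab), fun a b => h (Sum.Lex.inl_le_inr a b)⟩
  · rintro ⟨h1, h2, h3⟩ x y hxy
    obtain ⟨x, rfl⟩ := toLex.surjective x
    obtain ⟨y, rfl⟩ := toLex.surjective y
    rcases x with x | x <;> rcases y with y | y
    · exact h1 (Sum.Lex.inl_le_inl_iff.1 hxy)
    · exact h3 x y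
    · exact absurd hxy Sum.Lex.not_inr_le_inl
    · exact h2 (Sum.Lex.inr_le_inr_iff.1 hxy)

/-- Order-reversing maps on a poset with a chain of `m + 1` elements on top are obtained from those
on the poset with a chain of `m` elements on top by adding a constant, the value at the maximum. -/
def chainEquiv (Q : Type) [PartialOrder Q] (m : ℕ) :
    {σ : Q ⊕ₗ Fin (m + 1) → ℕ // Antitone σ} ≃ ℕ × {σ : Q ⊕ₗ Fin m → ℕ // Antitone σ} where
  toFun σ := (σ.1 (toLex (.inr (Fin.last m))),
    ⟨fun x => σ.1 (toLex ((ofLex x).map id Fin.castSucc)) - σ.1 (toLex (.inr (Fin.last m))), by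
      obtain ⟨h1, h2, h3⟩ := antitone_sumLex_iff.1 σ.2
      exact antitone_sumLex_iff.2 ⟨fun a b hab => Nat.sub_le_sub_right (h1 hab) _,
        fun a b hab => Nat.sub_le_sub_right (h2 (Fin.castSucc_le_castSucc_iff.2 hab)) _,
        fun a b => Nat.sub_le_sub_right (h3 a _) _⟩⟩)
  invFun y := ⟨fun x => y.1 + Sum.elim (fun a => y.2.1 (toLex (.inl a)))
      (Fin.snoc (α := fun _ => ℕ) (fun i => y.2.1 (toLex (.inr i))) 0) (ofLex x), by
      obtain ⟨h1, h2, h3⟩ := antitone_sumLex_iff.1 y.2.2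
      refine antitone_sumLex_iff.2 ⟨fun a b hab => Nat.add_le_add_left (h1 hab) _, ?_, ?_⟩
      · intro a b hab
        refine Nat.add_le_add_left ?_ _
        simp only [ofLex_toLex, Sum.elim_inr]
        induction b using Fin.lastCases with
        | last => simp
        | cast b =>
          induction a using Fin.lastCases with
          | last => exact absurd hab (not_le_of_gt (Fin.castSucc_lt_last b))
          | cast a => simpa using h2 (Fin.castSucc_le_castSucc_iff.1 hab)
      · intro a b
        refine Nat.add_le_add_left ?_ _
        simp only [ofLex_toLex, Sum.elim_inr, Sum.elim_inl]
        induction b using Fin.lastCases with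
        | last => simp
        | cast b => simpa using h3 a b⟩
  left_inv σ := by
    obtain ⟨h1, h2, h3⟩ := antitone_sumLex_iff.1 σ.2
    ext x
    obtain ⟨x, rfl⟩ := toLex.surjective x
    rcases x with x | x
    · simpa using Nat.add_sub_cancel' (h3 x (Fin.last m))
    · induction x using Fin.lastCases with
      | last => simp
      | cast x => simpa using Nat.add_sub_cancel' (h2 (Fin.le_last x.castSucc))
  right_inv y := by
    refine Prod.ext ?_ (Subtype.ext (funext fun x => ?_))
    · simp
    · obtain ⟨x, rfl⟩ := toLex.surjective x
      rcases x with x | x <;> simp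

theorem sum_sumLex {A B : Type} [Fintype A] [Fintype B] (f : A ⊕ₗ B → ℕ) :
    ∑ x, f x = ∑ a, f (toLex (.inl a)) + ∑ b, f (toLex (.inr b)) :=
  (toLex.sum_comp f).symm.trans (Fintype.sum_sum_type _)

/-- The smallest value is at the maximum. Subtracting it everywhere contributes a geometric series
whose exponent is the number of elements, and the maximum, now with value `0`, can be dropped. -/
theorem HasPartitionSum.chain_succ {q a : ℝ} (h0 : 0 < q) (h1 : q < 1)
    (h : HasPartitionSum (Q ⊕ₗ Fin m) q a) :
    HasPartitionSum (Q ⊕ₗ Fin (m + 1)) q ((1 - q ^ (Fintype.card Q + m + 1))⁻¹ * a) := by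
  have hq : 0 ≤ q ^ (Fintype.card Q + m + 1) := by positivity
  have hg := hasSum_geometric_of_lt_one hq (pow_lt_one₀ h0.le h1 (by omega))
  have := hasSum_mul_of_nonneg (fun s => by positivity) (fun σ => by positivity) hg h
  refine (Equiv.hasSum_iff (chainEquiv Q m).symm).1 ?_
  convert! this using 2 with y
  rw [← pow_mul, ← pow_add, Function.comp_apply, sum_sumLex, sum_sumLex, Fin.sum_univ_castSucc]
  congr 1
  simp [chainEquiv, Finset.sum_add_distrib]
  ring

end Chain

/-! ### Sums of products and of determinants -/

section HasSum

theorem hasSum_fin_pi {n : ℕ} {κ : Fin n → Type*} {f : ∀ i, κ i → ℝ} {a : Fin n → ℝ}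
    (h0 : ∀ i x, 0 ≤ f i x) (h : ∀ i, HasSum (f i) (a i)) :
    HasSum (fun x : ∀ i, κ i => ∏ i, f i (x i)) (∏ i, a i) := by
  induction n with
  | zero => simp
  | succ n ih =>
    have h1 := hasSum_mul_of_nonneg (h0 0) (fun x => Finset.prod_nonneg fun i _ => h0 i.succ (x i))
      (h 0) (ih (κ := fun i => κ i.succ) (fun i => h0 i.succ) (fun i => h i.succ))
    rw [← (Fin.consEquiv κ).hasSum_iff, Fin.prod_univ_succ]
    convert! h1 using 2 with x
    simp [Fin.prod_univ_succ, Fin.consEquiv]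

theorem hasSum_pi {ι : Type*} [Fintype ι] {κ : ι → Type*} {f : ∀ i, κ i → ℝ} {a : ι → ℝ}
    (h0 : ∀ i x, 0 ≤ f i x) (h : ∀ i, HasSum (f i) (a i)) :
    HasSum (fun x : ∀ i, κ i => ∏ i, f i (x i)) (∏ i, a i) := by
  let e := Fintype.equivFin ι
  have h1 := hasSum_fin_pi (fun i x => h0 (e.symm i) x) (fun i => h (e.symm i))
  rw [← (Equiv.piCongrLeft' κ e).symm.hasSum_iff, ← e.symm.prod_comp a]
  convert! h1 using 2 with x
  rw [Function.comp_apply, ← e.symm.prod_comp]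
  refine Finset.prod_congr rfl fun i _ => congrArg _ ?_
  exact congrFun ((Equiv.piCongrLeft' κ e).apply_symm_apply x) i

/-- Row `i` depends only on the variable `x i`, so each term of the Leibniz formula is a product of
independent sums. Nonnegativity of the entries gives summability of these products before the signs
enter. -/
theorem hasSum_det {p : ℕ} {κ : Fin p → Type*} {m : ∀ i, Fin p → κ i → ℝ}
    {S : Matrix (Fin p) (Fin p) ℝ} (h0 : ∀ i j x, 0 ≤ m i j x) (h : ∀ i j, HasSum (m i j) (S i j)) :
    HasSum (fun x : ∀ i, κ i => Matrix.det (Matrix.of fun i j => m i j (x i))) S.det := by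
  simp only [Matrix.det_apply']
  refine hasSum_sum fun σ _ => HasSum.mul_left _ ?_
  have := hasSum_pi (κ := fun i => κ (σ i)) (f := fun i => m (σ i) i) (a := fun i => S (σ i) i)
    (fun i x => h0 _ _ _) (fun i => h _ _)
  rw [← (Equiv.piCongrLeft κ σ).hasSum_iff]
  convert! this using 2 with x
  simp [Equiv.piCongrLeft_apply_apply]

end HasSum

/-! ### Summation over interlacing sequences -/

section Interlace

/-- `(q; q)_m`. -/
def qPoch (q : ℝ) (m : ℕ) : ℝ := ∏ i ∈ Finset.range m, (1 - q ^ (i + 1))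

variable {q : ℝ}

theorem qPoch_pos (h0 : 0 < q) (h1 : q < 1) (m : ℕ) : 0 < qPoch q m :=
  Finset.prod_pos fun i _ => sub_pos.2 (pow_lt_one₀ h0.le h1 (Nat.succ_ne_zero i))

/-- Subtracting the next row is left multiplication by a unipotent upper triangular matrix. -/
theorem det_sub_succ_row {p : ℕ} (X : Matrix (Fin p) (Fin p) ℝ) :
    Matrix.det (Matrix.of fun i j => X i j - if h : (i : ℕ) + 1 < p then X ⟨i + 1, h⟩ j else 0) =
      X.det := by
  let U : Matrix (Fin p) (Fin p) ℝ := Matrix.of fun i j =>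
    if j = i then 1 else if (j : ℕ) = i + 1 then -1 else 0
  have hU : U.det = 1 := by
    rw [Matrix.det_of_isUpperTriangular]
    · exact Finset.prod_eq_one fun i _ => by simp [U]
    · intro i j hij
      simp only [id] at hij
      simp only [U, Matrix.of_apply]
      rw [if_neg (by omega), if_neg (by omega)]
  rw [← one_mul X.det, ← hU, ← Matrix.det_mul]
  congr 1
  ext i j
  simp only [Matrix.mul_apply, U, Matrix.of_apply, ite_mul, one_mul, neg_mul, zero_mul]
  have hsplit : ∀ x : Fin p, (if x = i then X x j else if (x : ℕ) = i + 1 then - X x j else 0) =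
      (if x = i then X x j else 0) + (if (x : ℕ) = i + 1 then - X x j else 0) := by
    intro x
    by_cases h : x = i
    · subst h
      simp
    · simp [h]
  rw [Finset.sum_congr rfl fun x _ => hsplit x, Finset.sum_add_distrib, Finset.sum_ite_eq',
    if_pos (Finset.mem_univ _), sub_eq_add_neg]
  congr 1
  split_ifs with h
  · rw [Finset.sum_eq_single ⟨i + 1, h⟩]
    · simp
    · intro b _ hb
      rw [if_neg]
      intro h'
      exact hb (Fin.ext h')
    · simp
  · rw [neg_zero, Finset.sum_eq_zero]
    intro x _
    rw [if_neg (by omega)]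

/-- If the last column consists of ones, the row differences clear it except for the last entry.
This is the case where peeling a diagonal also loses a row. -/
theorem det_sub_succ_row_of_last {p : ℕ} (X : Matrix (Fin (p + 1)) (Fin (p + 1)) ℝ)
    (hX : ∀ i, X i (Fin.last p) = 1) :
    Matrix.det (Matrix.of fun i j : Fin p => X i.castSucc j.castSucc - X i.succ j.castSucc) =
      X.det := by
  rw [← det_sub_succ_row X, Matrix.det_succ_column _ (Fin.last p),
    Finset.sum_eq_single (Fin.last p)]
  · simp only [Fin.val_last, Matrix.of_apply, hX, lt_irrefl, dite_false, ← two_mul, pow_mul]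
    rw [Fin.succAbove_last, show ((-1 : ℝ) ^ 2) ^ p = 1 by norm_num, one_mul, sub_zero, one_mul]
    congr 1
    ext i j
    simp
    rfl
  · intro i _ hi
    have : (i : ℕ) + 1 < p + 1 := by
      have := Fin.val_lt_last hi
      omega
    simp [hX, show (i : ℕ) < p by omega]
  · simp

theorem hasSum_pow_Ici (h0 : 0 < q) (h1 : q < 1) {a : ℕ} (ha : 1 ≤ a) (i Y : ℕ) :
    HasSum (fun z : {z : ℕ // Y ≤ z} => q ^ ((z + i) * a)) (q ^ ((Y + i) * a) / (1 - q ^ a)) := by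
  have hg := (hasSum_geometric_of_lt_one (pow_nonneg h0.le a)
    (pow_lt_one₀ h0.le h1 (by omega))).mul_left (q ^ ((Y + i) * a))
  let e : ℕ ≃ {z : ℕ // Y ≤ z} :=
    { toFun := fun m => ⟨Y + m, by omega⟩
      invFun := fun z => z.1 - Y
      left_inv := fun m => by simp
      right_inv := fun z => by ext; simp; omega }
  rw [← e.hasSum_iff, div_eq_mul_inv]
  convert! hg using 2 with m
  simp only [e, Function.comp_apply, Equiv.coe_fn_mk]
  rw [← pow_mul, ← pow_add]
  congr 1
  ring

/-- The shift by `i` is what makes the upper end of the geometric sum the entry of row `i + 1`: the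
sum over interlacing values becomes a difference of consecutive rows. -/
theorem hasSum_pow_Icc (h0 : 0 < q) (h1 : q < 1) {a : ℕ} (ha : 1 ≤ a) (i : ℕ) {Y Y' : ℕ}
    (hY : Y ≤ Y') : HasSum (fun z : {z : ℕ // Y ≤ z ∧ z ≤ Y'} => q ^ ((z + i) * a))
      ((q ^ ((Y + i) * a) - q ^ ((Y' + (i + 1)) * a)) / (1 - q ^ a)) := by
  have hne : 1 - q ^ a ≠ 0 := (sub_pos.2 (pow_lt_one₀ h0.le h1 (by omega))).ne'
  let e : Fin (Y' + 1 - Y) ≃ {z : ℕ // Y ≤ z ∧ z ≤ Y'} :=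
    { toFun := fun m => ⟨Y + m, by omega⟩
      invFun := fun z => ⟨z.1 - Y, by have := z.2; omega⟩
      left_inv := fun m => by simp
      right_inv := fun z => by ext; have := z.2; simp; omega }
  rw [← e.hasSum_iff]
  convert hasSum_fintype _ using 1
  rw [div_eq_iff hne]
  simp only [e, Function.comp_apply, Equiv.coe_fn_mk]
  obtain ⟨d, rfl⟩ := Nat.exists_eq_add_of_le hY
  rw [Fin.sum_univ_eq_sum_range (fun m => q ^ ((Y + m + i) * a)),
    show Y + d + 1 - Y = d + 1 by omega]
  have := geom_sum_mul_neg (q ^ a) (d + 1)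
  have h2 : ∀ m ∈ Finset.range (d + 1), q ^ ((Y + m + i) * a) = q ^ ((Y + i) * a) * (q ^ a) ^ m := by
    intro m _
    rw [← pow_mul, ← pow_add]
    congr 1
    ring
  rw [Finset.sum_congr rfl h2, ← Finset.mul_sum, mul_assoc, this, mul_sub, mul_one, ← pow_mul,
    ← pow_add]
  congr 2
  ring

end Interlace

/-! ### Shifted reverse plane partitions with a given diagonal -/

section Filling

/-- The cells of a shifted diagram with `p` rows, whose row `r` has `ℓ r` cells off the diagonal. -/
def ShiftedCell (ℓ : ℕ → ℕ) (p r c : ℕ) : Prop := r < p ∧ r ≤ c ∧ c ≤ r + ℓ r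

/-- The reverse plane partitions of shifted shape with the diagonal `Y`. -/
abbrev Filling (ℓ : ℕ → ℕ) (p : ℕ) (Y : Fin p → ℕ) : Type :=
  {F : ℕ → ℕ → ℕ // (∀ r c, ¬ ShiftedCell ℓ p r c → F r c = 0) ∧
    (∀ r c r' c', ShiftedCell ℓ p r c → ShiftedCell ℓ p r' c' → r ≤ r' → c ≤ c' →
      F r c ≤ F r' c') ∧ ∀ r : Fin p, F r r = Y r}

/-- The sum of the entries off the diagonal. -/
def Filling.weight {ℓ : ℕ → ℕ} {p : ℕ} {Y : Fin p → ℕ} (F : Filling ℓ p Y) : ℕ :=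
  ∑ r ∈ Finset.range p, ∑ c ∈ Finset.range (ℓ r), F.1 r (r + 1 + c)

/-- The possible values at the place `(r, r + 1)`. -/
abbrev Gap {p : ℕ} (Y : Fin p → ℕ) (r : ℕ) : Type :=
  {z : ℕ // ∀ i : Fin p, ((i : ℕ) = r → Y i ≤ z) ∧ ((i : ℕ) = r + 1 → z ≤ Y i)}

/-- Removing the diagonal of a filling. -/
def Filling.peel {ℓ : ℕ → ℕ} {p p' : ℕ} (Y : Fin p → ℕ) (hp : p' ≤ p) (hp' : p ≤ p' + 1)
    (hℓ : ∀ r < p', 1 ≤ ℓ r) (hℓ' : ∀ r < p, p' ≤ r → ℓ r = 0) (hY : Monotone Y) :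
    Filling ℓ p Y ≃ Σ Z : ∀ r : Fin p', Gap Y r, Filling (fun r => ℓ r - 1) p' (fun r => (Z r).1) where
  toFun F := ⟨fun r => ⟨F.1 r (r + 1), fun i => ⟨by
      rintro h
      have := hℓ r r.2
      rw [← F.2.2.2 i, h]
      exact F.2.2.1 _ _ _ _ ⟨by omega, by omega, by omega⟩ ⟨by omega, by omega, by omega⟩ le_rfl
        (by omega), by
      rintro h
      have := hℓ r r.2
      rw [← F.2.2.2 i, h]
      exact F.2.2.1 _ _ _ _ ⟨by omega, by omega, by omega⟩ ⟨by omega, by omega, by omega⟩ (by omega)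
        le_rfl⟩⟩,
    ⟨fun r c => if r < p' ∧ r ≤ c then F.1 r (c + 1) else 0, by
      intro r c h
      unfold ShiftedCell at h
      beta_reduce at h ⊢
      split_ifs with h'
      · refine F.2.1 _ _ ?_
        have := hℓ r h'.1
        unfold ShiftedCell
        omega
      · rfl, by
      intro r c r' c' h h' hr hc
      have h1 := hℓ r h.1
      have h2 := hℓ r' h'.1
      unfold ShiftedCell at h h'
      beta_reduce at h h' ⊢
      rw [if_pos (by omega), if_pos (by omega)]
      exact F.2.2.1 _ _ _ _ ⟨by omega, by omega, by omega⟩ ⟨by omega, by omega, by omega⟩ hr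
        (by omega), by
      intro r
      beta_reduce
      rw [if_pos ⟨r.2, le_rfl⟩]⟩⟩
  invFun Z := ⟨fun r c => if h : r < p ∧ c = r then Y ⟨r, h.1⟩ else
      if r < c then Z.2.1 r (c - 1) else 0, by
      intro r c h
      unfold ShiftedCell at h
      beta_reduce
      rw [dif_neg (by omega)]
      split_ifs with h'
      · refine Z.2.2.1 _ _ ?_
        unfold ShiftedCell
        beta_reduce
        intro h2
        have := hℓ r h2.1
        omega
      · rfl, by
      have hcell : ∀ {r c}, ShiftedCell ℓ p r c → r < c → r < p' ∧ c - 1 ≤ r + (ℓ r - 1) := by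
        intro r c h hlt
        unfold ShiftedCell at h
        have h1 : r < p' := by
          by_contra h'
          have := hℓ' r h.1 (by omega)
          omega
        exact ⟨h1, by omega⟩
      intro r c r' c' h h' hr hc
      beta_reduce
      by_cases h1 : c = r <;> by_cases h2 : c' = r'
      · rw [dif_pos ⟨h.1, h1⟩, dif_pos ⟨h'.1, h2⟩]
        exact hY (Fin.mk_le_mk.2 hr)
      · have hlt : r' < c' := lt_of_le_of_ne h'.2.1 (Ne.symm h2)
        have h3 := hcell h' hlt
        rw [dif_pos ⟨h.1, h1⟩, dif_neg (by omega), if_pos hlt]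
        calc Y ⟨r, h.1⟩ ≤ Y ⟨r', h'.1⟩ := hY (Fin.mk_le_mk.2 hr)
          _ ≤ (Z.1 ⟨r', h3.1⟩).1 := ((Z.1 ⟨r', h3.1⟩).2 ⟨r', h'.1⟩).1 rfl
          _ = Z.2.1 r' r' := (Z.2.2.2.2 ⟨r', h3.1⟩).symm
          _ ≤ Z.2.1 r' (c' - 1) := Z.2.2.2.1 _ _ _ _ ⟨h3.1, le_rfl, by omega⟩
            ⟨h3.1, by omega, h3.2⟩ le_rfl (by omega)
      · have hlt : r < c := lt_of_le_of_ne h.2.1 (Ne.symm h1)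
        have h3 := hcell h hlt
        have h4 := h'.1
        have h5 : r' - 1 < p' := by omega
        rw [dif_neg (by omega), if_pos hlt, dif_pos ⟨h'.1, h2⟩]
        calc Z.2.1 r (c - 1) ≤ Z.2.1 (r' - 1) (r' - 1) := Z.2.2.2.1 _ _ _ _
              ⟨h3.1, by omega, h3.2⟩ ⟨h5, le_rfl, by omega⟩ (by omega) (by omega)
          _ = (Z.1 ⟨r' - 1, h5⟩).1 := Z.2.2.2.2 ⟨r' - 1, h5⟩
          _ ≤ Y ⟨r', h'.1⟩ := ((Z.1 ⟨r' - 1, h5⟩).2 ⟨r', h'.1⟩).2 (by simp; omega)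
      · have hlt : r < c := lt_of_le_of_ne h.2.1 (Ne.symm h1)
        have hlt' : r' < c' := lt_of_le_of_ne h'.2.1 (Ne.symm h2)
        have h3 := hcell h hlt
        have h3' := hcell h' hlt'
        rw [dif_neg (by omega), if_pos hlt, dif_neg (by omega), if_pos hlt']
        exact Z.2.2.2.1 _ _ _ _ ⟨h3.1, by omega, h3.2⟩ ⟨h3'.1, by omega, h3'.2⟩ hr (by omega), by
      intro r
      beta_reduce
      rw [dif_pos ⟨r.2, rfl⟩]⟩
  left_inv F := by
    refine Subtype.ext (funext fun r => funext fun c => ?_)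
    dsimp only
    split_ifs with h1 h2 h3
    · obtain ⟨h1, rfl⟩ := h1
      exact (F.2.2.2 ⟨c, h1⟩).symm
    · rw [Nat.sub_add_cancel (by omega)]
    · refine (F.2.1 _ _ ?_).symm
      unfold ShiftedCell
      rintro ⟨h4, h5, h6⟩
      have := hℓ' r h4 (by omega)
      omega
    · refine (F.2.1 _ _ ?_).symm
      unfold ShiftedCell
      omega
  right_inv Z := by
    refine Sigma.subtype_ext ?_ ?_
    · funext r
      refine Subtype.ext ?_
      dsimp only
      rw [dif_neg (by omega), if_pos (by omega), Nat.add_sub_cancel]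
      exact Z.2.2.2.2 r
    · funext r c
      dsimp only
      split_ifs with h1 h2 h3
      · omega
      · rw [Nat.add_sub_cancel]
      · omega
      · refine (Z.2.2.1 _ _ ?_).symm
        unfold ShiftedCell
        omega


theorem Filling.weight_peel {ℓ : ℕ → ℕ} {p p' : ℕ} (Y : Fin p → ℕ) (hp : p' ≤ p)
    (hp' : p ≤ p' + 1) (hℓ : ∀ r < p', 1 ≤ ℓ r) (hℓ' : ∀ r < p, p' ≤ r → ℓ r = 0) (hY : Monotone Y)
    (F : Filling ℓ p Y) : F.weight = ∑ r, ((Filling.peel Y hp hp' hℓ hℓ' hY F).1 r).1 +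
      (Filling.peel Y hp hp' hℓ hℓ' hY F).2.weight := by
  have h1 : F.weight = ∑ r ∈ Finset.range p', ∑ c ∈ Finset.range (ℓ r), F.1 r (r + 1 + c) := by
    refine (Finset.sum_subset (Finset.range_mono hp) fun r hr hr' => ?_).symm
    rw [Finset.mem_range] at hr hr'
    rw [hℓ' r hr (by omega), Finset.range_zero, Finset.sum_empty]
  rw [h1, Filling.weight, Finset.sum_range, Finset.sum_range, ← Finset.sum_add_distrib]
  refine Finset.sum_congr rfl fun r _ => ?_
  obtain ⟨d, hd⟩ := Nat.exists_eq_add_of_le' (hℓ r r.2)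
  simp only [Filling.peel, Equiv.coe_fn_mk]
  rw [hd, Nat.add_sub_cancel, Finset.sum_range_succ', add_comm]
  congr 1
  refine Finset.sum_congr rfl fun c _ => ?_
  rw [if_pos ⟨r.2, by omega⟩]
  rfl

/-- The constant in `hasSum_filling`. -/
def fillConst (q : ℝ) (ℓ : ℕ → ℕ) (p : ℕ) : ℝ :=
  q ^ (∑ r ∈ Finset.range p, r * ℓ r) * ∏ r ∈ Finset.range p, qPoch q (ℓ r)

variable {q : ℝ}

theorem fillConst_pos (h0 : 0 < q) (h1 : q < 1) (ℓ : ℕ → ℕ) (p : ℕ) : 0 < fillConst q ℓ p :=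
  mul_pos (pow_pos h0 _) (Finset.prod_pos fun _ _ => qPoch_pos h0 h1 _)

/-- The effect of peeling one diagonal on the constant: the powers `q ^ i` come from rescaling the
rows of the determinant, the factors `1 - q ^ ℓ j` from the geometric sums in its columns. -/
theorem fillConst_eq {ℓ : ℕ → ℕ} {p : ℕ} (hℓ : ∀ r < p, 1 ≤ ℓ r) : fillConst q ℓ p =
    fillConst q (fun r => ℓ r - 1) p * (∏ i : Fin p, q ^ (i : ℕ)) * ∏ j : Fin p, (1 - q ^ ℓ j) := by
  have h1 : ∏ r ∈ Finset.range p, qPoch q (ℓ r) =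
      (∏ r ∈ Finset.range p, qPoch q (ℓ r - 1)) * ∏ j : Fin p, (1 - q ^ ℓ j) := by
    rw [← Finset.prod_range fun j => 1 - q ^ ℓ j, ← Finset.prod_mul_distrib]
    refine Finset.prod_congr rfl fun r hr => ?_
    obtain ⟨d, hd⟩ := Nat.exists_eq_add_of_le' (hℓ r (Finset.mem_range.1 hr))
    rw [hd, Nat.add_sub_cancel, qPoch, Finset.prod_range_succ, qPoch]
  have h2 : q ^ (∑ r ∈ Finset.range p, r * ℓ r) =
      q ^ (∑ r ∈ Finset.range p, r * (ℓ r - 1)) * ∏ i : Fin p, q ^ (i : ℕ) := by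
    rw [← Finset.prod_range fun i => q ^ i, Finset.prod_pow_eq_pow_sum, ← pow_add,
      ← Finset.sum_add_distrib]
    congr 1
    refine Finset.sum_congr rfl fun r hr => ?_
    obtain ⟨d, hd⟩ := Nat.exists_eq_add_of_le' (hℓ r (Finset.mem_range.1 hr))
    rw [hd, Nat.add_sub_cancel, mul_add, mul_one]
  rw [fillConst, fillConst, h1, h2]
  ring

theorem hasSum_gap (h0 : 0 < q) (h1 : q < 1) {a p : ℕ} (ha : 1 ≤ a) {Y : Fin p → ℕ}
    (hY : Monotone Y) (i : Fin p) : HasSum (fun z : Gap Y i => q ^ ((z.1 + i) * a))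
      ((q ^ ((Y i + i) * a) - if h : (i : ℕ) + 1 < p then q ^ ((Y ⟨i + 1, h⟩ + (i + 1)) * a) else 0) *
        (1 - q ^ a)⁻¹) := by
  split_ifs with h
  · have hle : Y i ≤ Y ⟨i + 1, h⟩ := hY (Fin.mk_le_mk.2 (Nat.le_succ _))
    have hiff : ∀ z, (∀ j : Fin p, ((j : ℕ) = i → Y j ≤ z) ∧ ((j : ℕ) = i + 1 → z ≤ Y j)) ↔
        Y i ≤ z ∧ z ≤ Y ⟨i + 1, h⟩ := fun z =>
      ⟨fun hz => ⟨(hz i).1 rfl, (hz ⟨i + 1, h⟩).2 rfl⟩, fun hz j =>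
        ⟨fun hj => (Fin.ext hj : j = i) ▸ hz.1,
          fun hj => (Fin.ext hj : j = ⟨i + 1, h⟩) ▸ hz.2⟩⟩
    exact (Equiv.subtypeEquivRight hiff).symm.hasSum_iff.1 (hasSum_pow_Icc h0 h1 ha i hle)
  · have hiff : ∀ z, (∀ j : Fin p, ((j : ℕ) = i → Y j ≤ z) ∧ ((j : ℕ) = i + 1 → z ≤ Y j)) ↔
        Y i ≤ z := fun z =>
      ⟨fun hz => (hz i).1 rfl, fun hz j => ⟨fun hj => (Fin.ext hj : j = i) ▸ hz,
        fun hj => absurd (hj ▸ j.2) h⟩⟩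
    rw [sub_zero]
    exact (Equiv.subtypeEquivRight hiff).symm.hasSum_iff.1 (hasSum_pow_Ici h0 h1 ha i (Y i))

/-- The weight `q ^ (∑ Z)` of the peeled diagonal raises the exponents `ℓ j - 1` in the determinant
to `ℓ j`. For fixed `Y` the entries of `Z` vary independently, so `hasSum_det` and the geometric
sums apply. -/
theorem hasSum_filling_step (h0 : 0 < q) (h1 : q < 1) {ℓ : ℕ → ℕ} {p p' : ℕ} (Y : Fin p → ℕ)
    (hp : p' ≤ p) (hp' : p ≤ p' + 1) (hℓ : ∀ r < p', 1 ≤ ℓ r) (hℓ' : ∀ r < p, p' ≤ r → ℓ r = 0)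
    (hY : Monotone Y)
    (ih : ∀ Z : Fin p' → ℕ, Monotone Z → HasSum (fun F : Filling (fun r => ℓ r - 1) p' Z =>
      q ^ F.weight) ((fillConst q (fun r => ℓ r - 1) p')⁻¹ *
        Matrix.det (Matrix.of fun i j : Fin p' => q ^ ((Z i + i) * (ℓ j - 1))))) :
    HasSum (fun F : Filling ℓ p Y => q ^ F.weight) ((fillConst q ℓ p')⁻¹ *
      Matrix.det (Matrix.of fun i j : Fin p' => q ^ ((Y (i.castLE hp) + i) * ℓ j) -
        if h : (i : ℕ) + 1 < p then q ^ ((Y ⟨i + 1, h⟩ + (i + 1)) * ℓ j) else 0)) := by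
  let K := (fillConst q (fun r => ℓ r - 1) p')⁻¹
  have hin : ∀ Z : ∀ r : Fin p', Gap Y r, HasSum
      (fun F : Filling (fun r => ℓ r - 1) p' (fun r => (Z r).1) => q ^ (∑ r, (Z r).1 + F.weight))
      (K * (∏ i : Fin p', q ^ (i : ℕ))⁻¹ *
        Matrix.det (Matrix.of fun i j : Fin p' => q ^ (((Z i).1 + i) * ℓ j))) := by
    intro Z
    have hmono : Monotone fun r => (Z r).1 := by
      refine monotone_iff_forall_lt.2 fun r s hrs => ?_
      have hs := s.2
      calc (Z r).1 ≤ Y ⟨r + 1, by omega⟩ := ((Z r).2 ⟨r + 1, by omega⟩).2 rfl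
        _ ≤ Y ⟨s, by omega⟩ := hY (Fin.mk_le_mk.2 hrs)
        _ ≤ (Z s).1 := ((Z s).2 ⟨s, by omega⟩).1 rfl
    convert! (ih _ hmono).mul_left (q ^ ∑ r, (Z r).1) using 1
    · funext F
      rw [pow_add]
    · have hrow : (Matrix.of fun i j : Fin p' => q ^ (((Z i).1 + i) * ℓ j)) =
          Matrix.of fun i j : Fin p' => q ^ ((Z i).1 + i) *
            (Matrix.of fun i j : Fin p' => q ^ (((Z i).1 + i) * (ℓ j - 1))) i j := by
        ext i j
        obtain ⟨d, hd⟩ := Nat.exists_eq_add_of_le' (hℓ j j.2)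
        simp only [Matrix.of_apply, hd, Nat.add_sub_cancel]
        ring
      rw [hrow, Matrix.det_mul_column, ← Finset.prod_pow_eq_pow_sum]
      simp only [pow_add, Finset.prod_mul_distrib]
      have : (∏ i : Fin p', q ^ (i : ℕ)) ≠ 0 := Finset.prod_ne_zero_iff.2 fun i _ => by positivity
      field_simp
      rw [div_eq_mul_inv]
      exact mul_comm _ _
  have hout := (hasSum_det (κ := fun i : Fin p' => Gap Y i)
    (m := fun i j z => q ^ ((z.1 + i) * ℓ j))
    (S := Matrix.of fun i j => (1 - q ^ ℓ j)⁻¹ *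
      (Matrix.of fun i j : Fin p' => q ^ ((Y (i.castLE hp) + i) * ℓ j) -
        if h : (i : ℕ) + 1 < p then q ^ ((Y ⟨i + 1, h⟩ + (i + 1)) * ℓ j) else 0) i j)
    (fun i j z => by positivity) (fun i j => by
      rw [Matrix.of_apply, mul_comm]
      exact hasSum_gap h0 h1 (hℓ j j.2) hY (i.castLE hp))).mul_left
      (K * (∏ i : Fin p', q ^ (i : ℕ))⁻¹)
  have hall := hasSum_sigma_of_nonneg (f := fun x : Σ Z : ∀ r : Fin p', Gap Y r,
    Filling (fun r => ℓ r - 1) p' (fun r => (Z r).1) => q ^ (∑ r, (x.1 r).1 + x.2.weight))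
    (fun x => by positivity) hin hout
  rw [← (Filling.peel Y hp hp' hℓ hℓ' hY).hasSum_iff] at hall
  convert! hall using 1
  · funext F
    rw [Filling.weight_peel Y hp hp' hℓ hℓ' hY F]
    rfl
  · rw [Matrix.det_mul_row, fillConst_eq hℓ, mul_inv, mul_inv, Finset.prod_inv_distrib]
    simp only [K]
    ring

/-- Peeling shortens all rows by one, so the induction is on a bound for the row lengths. As they
decrease strictly, at most the last row is empty off the diagonal; its exponent is then `0`, and the
last column of the determinant consists of ones. -/
theorem hasSum_filling (h0 : 0 < q) (h1 : q < 1) (M : ℕ) : ∀ (ℓ : ℕ → ℕ) (p : ℕ) (Y : Fin p → ℕ),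
    (∀ r < p, ℓ r < M) → (∀ r s, r < s → s < p → ℓ s < ℓ r) → Monotone Y →
    HasSum (fun F : Filling ℓ p Y => q ^ F.weight) ((fillConst q ℓ p)⁻¹ *
      Matrix.det (Matrix.of fun i j : Fin p => q ^ ((Y i + i) * ℓ j))) := by
  induction M with
  | zero =>
    intro ℓ p Y hM _ _
    obtain rfl : p = 0 := by
      by_contra hp
      exact absurd (hM 0 (by omega)) (by omega)
    have : Unique (Filling ℓ 0 Y) :=
      { default := ⟨fun _ _ => 0, fun _ _ _ => rfl, fun _ _ _ _ _ _ _ _ => le_rfl, fun r => r.elim0⟩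
        uniq := fun F => Subtype.ext (funext fun r => funext fun c =>
          F.2.1 r c fun h => absurd h.1 (by omega)) }
    convert! hasSum_unique (fun F : Filling ℓ 0 Y => q ^ F.weight) using 1
    simp [fillConst, Filling.weight]
  | succ M ih =>
    intro ℓ p Y hM hℓ hY
    have ih' : ∀ p' ≤ p, (∀ r < p', 1 ≤ ℓ r) → ∀ Z : Fin p' → ℕ, Monotone Z →
        HasSum (fun F : Filling (fun r => ℓ r - 1) p' Z =>
          q ^ F.weight) ((fillConst q (fun r => ℓ r - 1) p')⁻¹ *
            Matrix.det (Matrix.of fun i j : Fin p' => q ^ ((Z i + i) * (ℓ j - 1)))) := by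
      intro p' hp hpos Z hZ
      refine ih _ p' Z (fun r hr => ?_) (fun r s hrs hs => ?_) hZ
      · have := hM r (by omega)
        have := hpos r hr
        omega
      · have := hℓ r s hrs (by omega)
        have := hpos s hs
        omega
    by_cases hpos : ∀ r < p, 1 ≤ ℓ r
    · have := hasSum_filling_step h0 h1 Y le_rfl (Nat.le_succ p) hpos (fun r hr hr' => by omega) hY
        (ih' p le_rfl hpos)
      convert! this using 2
      exact (det_sub_succ_row _).symm
    · push Not at hpos
      obtain ⟨r, hr, hr0⟩ := hpos
      obtain rfl : p = r + 1 := by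
        by_contra hne
        have := hℓ r (p - 1) (by omega) (by omega)
        omega
      have hpos : ∀ s < r, 1 ≤ ℓ s := fun s hs => by
        have := hℓ s r hs hr
        omega
      have hzero : ℓ r = 0 := by omega
      have := hasSum_filling_step h0 h1 Y (Nat.le_succ r) le_rfl hpos
        (fun s hs hs' => by rwa [show s = r by omega]) hY (ih' r (Nat.le_succ r) hpos)
      convert! this using 2
      · rw [fillConst, fillConst, Finset.sum_range_succ, Finset.prod_range_succ, hzero, mul_zero,
          add_zero]
        simp [qPoch]
      · rw [← det_sub_succ_row_of_last _ fun i => by simp [hzero]]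
        congr 1
        ext i j
        simp
        rfl

end Filling

/-! ### Fillings of a block -/

section BlockFilling

/-- The number of cells off the diagonal in row `r` of a block. -/
def Block.offLen (B : Block) (r : ℕ) : ℕ := B.part r + (B.size - 1 - r)

/-- The restrictions to the cells off the diagonal of the order-reversing maps on a shifted Young
poset with the values `Y` on the diagonal. -/
abbrev BlockFilling (B : Block) (Y : ℕ → ℕ) : Type :=
  {f : B.OffCell → ℕ // (∀ c d, CellLE c.pos d.pos → f d ≤ f c) ∧
    ∀ c, ∀ r < B.size, (CellLE c.pos (r, r) → Y r ≤ f c) ∧ (CellLE (r, r) c.pos → f c ≤ Y r)}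

theorem Block.mem_Ioo_iff {B : Block} {r : ℕ} (hr : r < B.size) {c : ℕ} :
    c ∈ Finset.Ioo r (r + (B.part r + staircase (B.size + 1) r)) ↔
      r < c ∧ c ≤ r + B.offLen r := by
  rw [Finset.mem_Ioo, Block.offLen, staircase]
  omega

/-- Fillings of the cells off the diagonal, as functions on `ℕ × ℕ`. -/
def blockFillingEquiv (B : Block) (Y : ℕ → ℕ) (hY : Monotone fun r : Fin B.size => Y r) :
    BlockFilling B Y ≃ Filling B.offLen B.size (fun r => Y r) where
  toFun f := ⟨fun r c => if h : r < B.size ∧ r < c ∧ c ≤ r + B.offLen r then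
      f.1 ⟨⟨r, h.1⟩, ⟨c, (Block.mem_Ioo_iff h.1).2 h.2⟩⟩ else if r < B.size ∧ c = r then Y r else 0, by
      intro r c h
      unfold ShiftedCell at h
      beta_reduce
      rw [dif_neg (by omega), if_neg (by omega)], by
      intro r c r' c' h h' hr hc
      unfold ShiftedCell at h h'
      beta_reduce
      by_cases h1 : c = r <;> by_cases h2 : c' = r'
      · rw [dif_neg (by omega), dif_neg (by omega), if_pos (by omega), if_pos (by omega)]
        exact hY (show (⟨r, h.1⟩ : Fin B.size) ≤ ⟨r', h'.1⟩ from hr)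
      · rw [dif_neg (by omega), if_pos (by omega), dif_pos (by omega)]
        exact (f.2.2 _ r h.1).1 ⟨hr, by simp only [Block.OffCell.pos]; omega⟩
      · rw [dif_pos (by omega), dif_neg (by omega), if_pos (by omega)]
        exact (f.2.2 _ r' h'.1).2 ⟨hr, by simp only [Block.OffCell.pos]; omega⟩
      · rw [dif_pos (by omega), dif_pos (by omega)]
        exact f.2.1 _ _ ⟨hr, hc⟩, by
      intro r
      beta_reduce
      rw [dif_neg (by omega), if_pos ⟨r.2, rfl⟩]⟩
  invFun F := ⟨fun c => F.1 c.1 c.2, by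
      have hcell : ∀ c : B.OffCell, ShiftedCell B.offLen B.size c.1 c.2 := fun c => by
        have := (Block.mem_Ioo_iff c.1.2).1 c.2.2
        exact ⟨c.1.2, by omega, by omega⟩
      refine ⟨fun c d h => F.2.2.1 _ _ _ _ (hcell d) (hcell c) h.1 h.2, fun c r hr =>
        ⟨fun h => ?_, fun h => ?_⟩⟩
      · exact (F.2.2.2 ⟨r, hr⟩).symm.le.trans
          (F.2.2.1 _ _ _ _ ⟨hr, le_rfl, Nat.le_add_right _ _⟩ (hcell c) h.1 h.2)
      · exact (F.2.2.1 _ _ _ _ (hcell c) ⟨hr, le_rfl, Nat.le_add_right _ _⟩ h.1 h.2).trans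
          (F.2.2.2 ⟨r, hr⟩).le⟩
  left_inv f := by
    refine Subtype.ext (funext fun c => ?_)
    dsimp only
    rw [dif_pos ⟨c.1.2, (Block.mem_Ioo_iff c.1.2).1 c.2.2⟩]
  right_inv F := by
    refine Subtype.ext (funext fun r => funext fun c => ?_)
    dsimp only
    split_ifs with h1 h2
    · rfl
    · obtain ⟨h2, rfl⟩ := h2
      exact (F.2.2.2 ⟨c, h2⟩).symm
    · refine (F.2.1 _ _ ?_).symm
      unfold ShiftedCell
      omega

theorem sum_offCell (B : Block) (F : ℕ → ℕ → ℕ) : ∑ c : B.OffCell, F c.1 c.2 =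
    ∑ r ∈ Finset.range B.size, ∑ c ∈ Finset.range (B.offLen r), F r (r + 1 + c) := by
  rw [Fintype.sum_sigma, Finset.sum_range]
  refine Finset.sum_congr rfl fun r _ => ?_
  have h : Finset.Ioo (r : ℕ) (r + (B.part r + staircase (B.size + 1) r)) =
      Finset.Ico ((r : ℕ) + 1) (r + 1 + B.offLen r) := by
    ext c
    rw [Block.mem_Ioo_iff r.2, Finset.mem_Ico]
    omega
  rw [Finset.sum_coe_sort _ fun c => F r c, h, Finset.sum_Ico_eq_sum_range, Nat.add_sub_cancel_left]

/-- The generating function of the fillings of a block with the diagonal `Y`. -/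
noncomputable def blockValue (q : ℝ) (B : Block) (Y : ℕ → ℕ) : ℝ :=
  (fillConst q B.offLen B.size)⁻¹ *
    Matrix.det (Matrix.of fun i j : Fin B.size => q ^ ((Y i + i) * B.offLen j))

variable {q : ℝ}

theorem blockValue_congr {B : Block} {Y Y' : ℕ → ℕ} (h : ∀ r < B.size, Y r = Y' r) :
    blockValue q B Y = blockValue q B Y' := by
  have : ∀ i : Fin B.size, Y i = Y' i := fun i => h i i.2
  simp only [blockValue, this]

theorem hasSum_blockFilling (h0 : 0 < q) (h1 : q < 1) (B : Block) (hB : Antitone B.part) (Y : ℕ → ℕ)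
    (hY : Monotone fun r : Fin B.size => Y r) :
    HasSum (fun f : BlockFilling B Y => q ^ ∑ c, f.1 c) (blockValue q B Y) := by
  have := hasSum_filling h0 h1 (B.part 0 + B.size + 1) B.offLen B.size (fun r => Y r)
    (fun r _ => by
      have := hB (Nat.zero_le r)
      unfold Block.offLen
      omega)
    (fun r s hrs hs => by
      have := hB hrs.le
      unfold Block.offLen
      omega) hY
  rw [← (blockFillingEquiv B Y hY).symm.hasSum_iff]
  convert! this using 2 with F
  exact congrArg (q ^ ·) (sum_offCell B F.1)

end BlockFilling

/-! ### Gluing the blocks along the diagonal -/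

section Glue

/-- Weakly increasing sequences of length `N`. -/
abbrev MonoSeq (N : ℕ) : Type := {y : Fin N → ℕ // Monotone y}

/-- The extension of a finite sequence by zeros. -/
def extendSeq {N : ℕ} (y : Fin N → ℕ) (j : ℕ) : ℕ := if h : j < N then y ⟨j, h⟩ else 0

theorem extendSeq_of_lt {N : ℕ} (y : Fin N → ℕ) {j : ℕ} (h : j < N) : extendSeq y j = y ⟨j, h⟩ :=
  dif_pos h

variable {ι : Type} {N : ℕ} {X : ι → Block}

theorem extendSeq_mono {y : Fin N → ℕ} (hy : Monotone y) {i j : ℕ} (hij : i ≤ j) (hj : j < N) :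
    extendSeq y i ≤ extendSeq y j := by
  rw [extendSeq_of_lt y hj, extendSeq_of_lt y (by omega)]
  exact hy (Fin.mk_le_mk.2 hij)

/-- An order-reversing map on `P_N(X)` consists of its values on the diagonal and independent
fillings of the blocks. -/
def posetEquiv (hX : ∀ i, 1 ≤ (X i).start ∧ (X i).start + (X i).size ≤ N + 1) :
    {σ : PosetP N X → ℕ // Antitone σ} ≃
      Σ y : MonoSeq N, ∀ i, BlockFilling (X i) fun r => extendSeq y.1 (N - (X i).diagIndex r) where
  toFun σ := ⟨⟨fun i => σ.1 (.inl ⟨N - i, Finset.mem_Icc.2 (by omega)⟩), fun i j hij => σ.2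
      (show N - (j : ℕ) ≤ N - i by have : (i : ℕ) ≤ j := hij; omega)⟩,
    fun i => ⟨fun c => σ.1 (.inr ⟨i, c⟩), fun c d h => σ.2 (Or.inl ⟨rfl, h⟩), fun c r hr => by
      have h1 := hX i
      have h2 : 1 ≤ (X i).diagIndex r ∧ (X i).diagIndex r ≤ N := by
        unfold Block.diagIndex
        omega
      beta_reduce
      rw [extendSeq_of_lt _ (show N - (X i).diagIndex r < N by omega)]
      refine ⟨fun h => σ.2 ⟨r, hr, h, ?_⟩, fun h => σ.2 ⟨r, hr, ?_, h⟩⟩ <;> dsimp only <;> omega⟩⟩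
  invFun y := ⟨Sum.elim (fun a => extendSeq y.1.1 (N - a)) fun c => (y.2 c.1).1 c.2, by
      have hext : ∀ a b : ℕ, 1 ≤ a → a ≤ b → extendSeq y.1.1 (N - b) ≤ extendSeq y.1.1 (N - a) := by
        intro a b ha hab
        by_cases hN : N = 0
        · subst hN
          simp [extendSeq]
        · exact extendSeq_mono y.1.2 (by omega) (by omega)
      have hd : ∀ i r, 1 ≤ (X i).diagIndex r := fun i r => by
        have := hX i
        unfold Block.diagIndex
        omega
      intro u v huv
      rcases u with a | ⟨i, c⟩ <;> rcases v with b | ⟨j, d⟩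
      · exact hext _ _ (Finset.mem_Icc.1 a.2).1 huv
      · obtain ⟨s, hs, h, h'⟩ := huv
        exact (((y.2 j).2.2 d s hs).2 h').trans (hext _ _ (Finset.mem_Icc.1 a.2).1 h)
      · obtain ⟨r, hr, h, h'⟩ := huv
        exact (hext _ _ (hd _ _) h').trans (((y.2 i).2.2 c r hr).1 h)
      · rcases huv with ⟨rfl, h⟩ | ⟨r, hr, s, hs, h, h', h''⟩
        · exact (y.2 i).2.1 c d h
        · exact (((y.2 j).2.2 d s hs).2 h'').trans
            ((hext _ _ (hd _ _) h').trans (((y.2 i).2.2 c r hr).1 h))⟩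
  left_inv σ := by
    refine Subtype.ext (funext fun u => ?_)
    rcases u with a | ⟨i, c⟩
    · have ha := Finset.mem_Icc.1 a.2
      dsimp only [Sum.elim_inl]
      rw [extendSeq_of_lt _ (show N - (a : ℕ) < N by omega)]
      exact congrArg (fun b => σ.1 (.inl b)) (Subtype.ext (show N - (N - (a : ℕ)) = a by omega))
    · rfl
  right_inv y := by
    obtain ⟨y, f⟩ := y
    -- Stated for a variable `z` equal to `y`, so that the dependent second components can be
    -- compared entrywise without casts.
    have h1 : ∀ (z : MonoSeq N) (_ : z = y)
        (g : ∀ i, BlockFilling (X i) fun r => extendSeq z.1 (N - (X i).diagIndex r))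
        (_ : ∀ i c, (g i).1 c = (f i).1 c), (⟨z, g⟩ : Σ y : MonoSeq N, ∀ i, BlockFilling (X i)
          fun r => extendSeq y.1 (N - (X i).diagIndex r)) = ⟨y, f⟩ := by
      rintro z rfl g hg
      congr 1
      funext i
      exact Subtype.ext (funext (hg i))
    refine h1 _ ?_ _ fun i c => rfl
    refine Subtype.ext (funext fun i => ?_)
    dsimp only [Sum.elim_inl]
    rw [extendSeq_of_lt _ (show N - (N - (i : ℕ)) < N by omega)]
    exact congrArg y.1 (Fin.ext (show N - (N - (i : ℕ)) = i by omega))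

variable {q : ℝ} [Fintype ι]

/-- The sequence `y` lists the values from `x_N` downwards, so the top diagonal cell of a block has
the index `N + 1 - start - size` in it. -/
theorem hasPartitionSum_posetP (h0 : 0 < q) (h1 : q < 1)
    (hX : ∀ i, 1 ≤ (X i).start ∧ (X i).start + (X i).size ≤ N + 1 ∧ Antitone (X i).part) {a : ℝ}
    (h : HasSum (fun y : MonoSeq N => q ^ (∑ i, y.1 i) *
      ∏ i, blockValue q (X i) fun r => extendSeq y.1 (N + 1 - (X i).start - (X i).size + r)) a) :
    HasPartitionSum (PosetP N X) q a := by
  have hX' : ∀ i, 1 ≤ (X i).start ∧ (X i).start + (X i).size ≤ N + 1 := fun i => ⟨(hX i).1, (hX i).2.1⟩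
  have hin : ∀ y : MonoSeq N, HasSum (fun f : ∀ i, BlockFilling (X i)
      fun r => extendSeq y.1 (N - (X i).diagIndex r) => q ^ (∑ i, y.1 i) * ∏ i, q ^ ∑ c, (f i).1 c)
      (q ^ (∑ i, y.1 i) *
        ∏ i, blockValue q (X i) fun r => extendSeq y.1 (N + 1 - (X i).start - (X i).size + r)) := by
    intro y
    refine (hasSum_pi (κ := fun i => BlockFilling (X i)
      fun r => extendSeq y.1 (N - (X i).diagIndex r)) (f := fun i f => q ^ ∑ c, f.1 c)
      (a := fun i => blockValue q (X i)
        fun r => extendSeq y.1 (N + 1 - (X i).start - (X i).size + r))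
      (fun i f => by positivity) fun i => ?_).mul_left _
    have hidx : ∀ r < (X i).size, N - (X i).diagIndex r =
        N + 1 - (X i).start - (X i).size + r := fun r hr => by
      have := hX i
      unfold Block.diagIndex
      omega
    rw [← blockValue_congr fun r hr => congrArg (extendSeq y.1) (hidx r hr)]
    refine hasSum_blockFilling h0 h1 (X i) (hX i).2.2 _ fun r s hrs => ?_
    have hrs : (r : ℕ) ≤ s := hrs
    beta_reduce
    rw [hidx r r.2, hidx s s.2]
    have := hX i
    have := s.2
    exact extendSeq_mono y.2 (by omega) (by omega)
  have hall := hasSum_sigma_of_nonneg (f := fun x : Σ y : MonoSeq N, ∀ i, BlockFilling (X i)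
    fun r => extendSeq y.1 (N - (X i).diagIndex r) =>
      q ^ (∑ i, x.1.1 i) * ∏ i, q ^ ∑ c, (x.2 i).1 c) (fun x => by positivity) hin h
  rw [HasPartitionSum, ← (posetEquiv hX').symm.hasSum_iff]
  convert! hall using 2 with x
  rw [Finset.prod_pow_eq_pow_sum, ← pow_add]
  refine congrArg (q ^ ·) ((Fintype.sum_sum_type _).trans (congrArg₂ (· + ·) ?_ ?_))
  · symm
    refine Fintype.sum_bijective (fun i : Fin N => (⟨N - i, Finset.mem_Icc.2 (by omega)⟩ :
      Finset.Icc 1 N)) ⟨fun i j hij => ?_, fun a => ?_⟩ _ _ fun i => ?_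
    · have := Subtype.mk.inj hij
      omega
    · have ha := Finset.mem_Icc.1 a.2
      exact ⟨⟨N - a, by omega⟩, Subtype.ext (by dsimp only; omega)⟩
    · refine (Eq.trans (extendSeq_of_lt _ (show N - (N - (i : ℕ)) < N by omega)) ?_).symm
      exact congrArg x.1.1 (Fin.ext (show N - (N - (i : ℕ)) = i by omega))
  · exact Fintype.sum_sigma _

end Glue

/-! ### Lagrange interpolation -/

section Lagrange

/-- The sum `∑ᵢ f(xᵢ) / ∏_{k ≠ i} (xᵢ - x_k)`. -/
noncomputable def lagrangeSum {N : ℕ} (x : Fin (N + 1) → ℝ) (f : ℝ → ℝ) : ℝ :=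
  ∑ i, f (x i) / ∏ k : Fin N, (x i - x (i.succAbove k))

/-- Used to split off the additional nodes `0`, `-1` and `Q`, leaving a sum over the variables `v`.
-/
theorem lagrangeSum_cons {N : ℕ} (a : ℝ) (x : Fin (N + 1) → ℝ) (f : ℝ → ℝ) :
    lagrangeSum (Fin.cons a x : Fin (N + 2) → ℝ) f =
      f a / ∏ i, (a - x i) + lagrangeSum x fun t => f t / (t - a) := by
  rw [lagrangeSum, Fin.sum_univ_succ, lagrangeSum]
  congr 1
  refine Finset.sum_congr rfl fun i _ => ?_
  rw [Fin.prod_univ_succ]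
  simp [Fin.succ_succAbove_succ, div_div]

/-- Lagrange interpolation for the leading coefficient of a product of linear forms. -/
theorem lagrangeSum_prod {M : ℕ} (a b : Fin M → ℝ) (x : Fin (M + 1) → ℝ)
    (hx : Function.Injective x) : lagrangeSum x (fun t => ∏ k, (b k + a k * t)) = ∏ k, a k := by
  let P : Polynomial ℝ := ∏ k, (Polynomial.C (b k) + Polynomial.C (a k) * Polynomial.X)
  have hdeg : ∀ k, (Polynomial.C (b k) + Polynomial.C (a k) * Polynomial.X).natDegree ≤ 1 := by
    intro k
    rw [add_comm]
    exact Polynomial.natDegree_linear_le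
  have hP : P.natDegree ≤ M := by
    refine (Polynomial.natDegree_prod_le _ _).trans ((Finset.sum_le_sum fun k _ => hdeg k).trans ?_)
    simp
  have hcoeff : P.coeff M = ∏ k, a k := by
    have := Polynomial.coeff_prod_of_natDegree_le Finset.univ
      (fun k => Polynomial.C (b k) + Polynomial.C (a k) * Polynomial.X) 1 (fun k _ => hdeg k)
    rw [Finset.card_univ, Fintype.card_fin, mul_one] at this
    rw [this]
    simp
  have h := Lagrange.coeff_eq_sum (s := Finset.univ) (v := x) hx.injOn (P := P) (by
    refine lt_of_le_of_lt Polynomial.degree_le_natDegree ?_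
    rw [Finset.card_univ, Fintype.card_fin]
    exact_mod_cast Nat.lt_succ_of_le hP)
  rw [Finset.card_univ, Fintype.card_fin, Nat.add_sub_cancel, hcoeff] at h
  rw [h, lagrangeSum]
  refine Finset.sum_congr rfl fun i _ => ?_
  congr 1
  · simp [P, Polynomial.eval_prod]
  · rw [← Finset.compl_singleton, ← Fin.image_succAbove_univ,
      Finset.prod_image fun _ _ _ _ h => Fin.succAbove_right_injective h]

end Lagrange

/-! ### A quotient of Vandermonde type -/

section Vdm

/-- The product of `(v_k - v_i) / (1 - v_i v_k)` over `i < k`. -/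
noncomputable def vdm {p : ℕ} (v : Fin p → ℝ) : ℝ :=
  ∏ i, ∏ k, if i < k then (v k - v i) / (1 - v i * v k) else 1

theorem prod_succAbove_sign {p : ℕ} (j : Fin (p + 1)) :
    ∏ i : Fin p, (if j.succAbove i < j then (-1 : ℝ) else 1) = (-1) ^ (j : ℕ) := by
  rw [Finset.prod_ite, Finset.prod_const_one, mul_one, Finset.prod_const]
  congr 1
  have : (Finset.univ.filter fun i : Fin p => j.succAbove i < j) =
      Finset.univ.filter fun i : Fin p => (i : ℕ) < j := by
    ext i
    rw [Finset.mem_filter, Finset.mem_filter, Fin.succAbove_lt_iff_castSucc_lt, Fin.lt_def,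
      Fin.val_castSucc]
  rw [this, Fin.card_filter_val_lt, min_eq_right (by omega)]

/-- Each index smaller than `j` reverses one difference. The resulting sign `(-1) ^ j` is the one
that cancels the sign of the Laplace expansion. -/
theorem vdm_succAbove {p : ℕ} (v : Fin (p + 1) → ℝ) (j : Fin (p + 1)) :
    vdm v = (-1) ^ (j : ℕ) * vdm (v ∘ j.succAbove) *
      ∏ i, ((v (j.succAbove i) - v j) / (1 - v (j.succAbove i) * v j)) := by
  have hfac : ∀ i : Fin p, (v (j.succAbove i) - v j) / (1 - v (j.succAbove i) * v j) *
      (if j.succAbove i < j then (-1 : ℝ) else 1) =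
      (if j < j.succAbove i then (v (j.succAbove i) - v j) / (1 - v j * v (j.succAbove i)) else 1) *
      (if j.succAbove i < j then (v j - v (j.succAbove i)) / (1 - v (j.succAbove i) * v j) else 1) := by
    intro i
    rcases lt_or_gt_of_ne (Fin.succAbove_ne j i) with h | h
    · rw [if_pos h, if_pos h, if_neg (not_lt_of_gt h)]
      ring
    · rw [if_neg (not_lt_of_gt h), if_neg (not_lt_of_gt h), if_pos h, mul_comm (v j)]
  rw [← prod_succAbove_sign j, mul_right_comm, mul_comm _ (∏ i, (_ / _)), ← Finset.prod_mul_distrib,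
    Finset.prod_congr rfl fun i _ => hfac i, Finset.prod_mul_distrib, vdm,
    Fin.prod_univ_succAbove _ j, Fin.prod_univ_succAbove _ j, if_neg (lt_irrefl _), one_mul, mul_assoc]
  congr 1
  rw [vdm, ← Finset.prod_mul_distrib]
  refine Finset.prod_congr rfl fun i _ => ?_
  rw [Fin.prod_univ_succAbove _ j]
  simp only [Fin.succAbove_lt_succAbove_iff, Function.comp_apply]

end Vdm

/-! ### The two summation identities -/

section Identities

variable {m : ℕ} {v : Fin (m + 1) → ℝ}

theorem prod_fin_neg {p : ℕ} (f : Fin p → ℝ) : ∏ i, (-f i) = (-1) ^ p * ∏ i, f i := by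
  simp [Finset.prod_neg]

/-- Restoring the missing factor `1 - v j ^ 2` completes the product over `i ≠ j`, so that the
numerator is one function of `t` evaluated at `v j`. -/
theorem lagrangeSum_vdm (f : ℝ → ℝ) (h1 : ∀ j, 1 - v j ^ 2 ≠ 0) :
    ∑ j, f (v j) * ∏ i, ((1 - v (j.succAbove i) * v j) / (v (j.succAbove i) - v j)) =
      (-1) ^ m * lagrangeSum v fun t => f t * (∏ i, (1 - v i * t)) / (1 - t ^ 2) := by
  rw [lagrangeSum, Finset.mul_sum]
  refine Finset.sum_congr rfl fun j _ => ?_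
  rw [Fin.prod_univ_succAbove _ j, Finset.prod_div_distrib, ← pow_two]
  have : ∏ k, (v j - v (j.succAbove k)) = (-1) ^ m * ∏ k, (v (j.succAbove k) - v j) := by
    rw [← prod_fin_neg]
    exact Finset.prod_congr rfl fun k _ => by ring
  rw [this, Finset.prod_congr rfl fun k _ => congrArg (1 - ·) (mul_comm (v (j.succAbove k)) (v j))]
  have h2 := h1 j
  have h3 : ((-1 : ℝ) ^ m) ≠ 0 := by positivity
  field_simp

theorem prod_sub_ne_zero {x : ℝ} (h : ∀ i, v i ≠ x) : ∏ i, (x - v i) ≠ 0 :=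
  Finset.prod_ne_zero_iff.2 fun i _ => sub_ne_zero.2 (h i).symm

/-- Interpolation of `(1 - g t) ∏ (1 - v i t)`, of degree at most `m + 2`, at the `m + 3` nodes `0`,
`-1` and `v i`. The factor `1 - t` of the summand cancels against `1 - t ^ 2`, leaving the node
`-1`; the node `0` comes from `∏_{i ≠ j} v i = V / v j`, where `V` is the full product. -/
theorem sum_removal (g : ℝ) (hpos : ∀ i, 0 < v i) (hlt : ∀ i, v i < 1) (hinj : Function.Injective v) :
    ∑ j, (∏ i, v (j.succAbove i)) * ((1 - v j) * (1 - g * v j)) *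
      ∏ i, ((1 - v (j.succAbove i) * v j) / (v (j.succAbove i) - v j)) =
      (1 - ∏ i, v i) * (1 - g * ∏ i, v i) := by
  have hV : ∏ i, v i ≠ 0 := (Finset.prod_pos fun i _ => hpos i).ne'
  have h1 : ∀ j, 1 - v j ^ 2 ≠ 0 := fun j => by
    have := hpos j
    have := hlt j
    nlinarith
  have hprod : ∀ j, ∏ i, v (j.succAbove i) = (∏ i, v i) / v j := fun j => by
    rw [Fin.prod_univ_succAbove _ j, mul_div_cancel_left₀ _ (hpos j).ne']
  have hL := lagrangeSum_prod (Fin.cons (-g) fun i => -v i : Fin (m + 2) → ℝ) (fun _ => 1)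
    (Fin.cons 0 (Fin.cons (-1) v)) (by
      rw [Fin.cons_injective_iff, Fin.cons_injective_iff]
      refine ⟨?_, ?_, hinj⟩
      · rintro ⟨i, hi⟩
        induction i using Fin.cases with
        | zero => simp at hi
        | succ i => exact (hpos i).ne' (by simpa using hi)
      · rintro ⟨i, hi⟩
        have := hpos i
        linarith)
  rw [lagrangeSum_cons, lagrangeSum_cons] at hL
  simp only [Fin.prod_univ_succ (n := m + 1), Fin.cons_zero, Fin.cons_succ] at hL
  simp only [hprod]
  rw [lagrangeSum_vdm (v := v) (fun t => (∏ i, v i) / t * ((1 - t) * (1 - g * t))) h1]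
  have hcongr : ∀ j, (∏ i, v i) / v j * ((1 - v j) * (1 - g * v j)) * (∏ i, (1 - v i * v j)) /
      (1 - v j ^ 2) = (∏ i, v i) * ((1 + -g * v j) * (∏ i, (1 + -v i * v j)) / (v j - 0) /
        (v j - -1)) := by
    intro j
    have e : 1 - v j ^ 2 = (1 - v j) * (1 + v j) := by ring
    have h2 : 1 - v j ≠ 0 := by linarith [hlt j]
    have h3 : 1 + v j ≠ 0 := by linarith [hpos j]
    have h4 := (hpos j).ne'
    simp only [neg_mul, ← sub_eq_add_neg, sub_zero, sub_neg_eq_add, e]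
    rw [add_comm (v j) 1]
    field_simp
  have hsum : (lagrangeSum v fun t => (∏ i, v i) / t * ((1 - t) * (1 - g * t)) *
      (∏ i, (1 - v i * t)) / (1 - t ^ 2)) = (∏ i, v i) * lagrangeSum v fun t =>
        (1 + -g * t) * (∏ i, (1 + -v i * t)) / (t - 0) / (t - -1) := by
    rw [lagrangeSum, lagrangeSum, Finset.mul_sum]
    refine Finset.sum_congr rfl fun j _ => ?_
    rw [hcongr]
    ring
  rw [hsum]
  have hm1 : ∏ i, (1 + -v i * -1) = (-1) ^ (m + 1) * ∏ i, (-1 - v i) := by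
    rw [← prod_fin_neg]
    exact Finset.prod_congr rfl fun k _ => by ring
  have hm2 := prod_sub_ne_zero (v := v) (x := -1) fun i => by linarith [hpos i]
  rw [hm1] at hL
  simp only [mul_zero, add_zero, Finset.prod_const_one, one_mul, zero_sub, prod_fin_neg] at hL
  have hs : ((-1 : ℝ) ^ m) * (-1) ^ m = 1 := by rw [← mul_pow]; norm_num
  have h5 : ((-1 : ℝ) ^ m) ≠ 0 := by positivity
  rw [pow_succ] at hL
  generalize (lagrangeSum v fun t =>
        (1 + -g * t) * (∏ i, (1 + -v i * t)) / (t - 0) / (t - -1)) = L at *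
  generalize ∏ i, v i = V at *
  generalize ∏ i, (-1 - v i) = U at *
  generalize (-1 : ℝ) ^ m = s at *
  field_simp at hL
  field_simp
  linear_combination -hL + (V ^ 2 * g - V * (1 + g)) * hs

/-- As in `sum_removal`, with another linear factor `n₁ t + n₀` and another node `Q`. The hypothesis
`hcancel` says exactly that the contributions of the nodes `0` and `-1` cancel against the leading
coefficient, so only the node `Q` remains and the sum is a product. -/
theorem sum_removal_node {g Q n₀ n₁ : ℝ} (hpos : ∀ i, 0 < v i) (hlt : ∀ i, v i < 1)
    (hinj : Function.Injective v) (hQ : 0 < Q) (hQv : ∀ i, v i ≠ Q)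
    (hcancel : n₀ / (Q * ∏ i, v i) - g * (∏ i, v i) * n₁ = (1 + g) * (n₀ - n₁) / (1 + Q)) :
    ∑ j, ((1 - v j) * (1 - g * v j)) * ((n₁ * v j + n₀) / (v j * (v j - Q))) *
      ∏ i, ((1 - v (j.succAbove i) * v j) / (v (j.succAbove i) - v j)) =
      (∏ i, (1 - v i * Q)) / (∏ i, (v i - Q)) * ((1 - g * Q) * (n₁ * Q + n₀)) / (Q * (1 + Q)) := by
  have hV : ∏ i, v i ≠ 0 := (Finset.prod_pos fun i _ => hpos i).ne'
  have h1 : ∀ j, 1 - v j ^ 2 ≠ 0 := fun j => by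
    have := hpos j
    have := hlt j
    nlinarith
  have hL := lagrangeSum_prod (Fin.cons n₁ (Fin.cons (-g) fun i => -v i) : Fin (m + 3) → ℝ)
    (Fin.cons n₀ fun _ => 1) (Fin.cons Q (Fin.cons 0 (Fin.cons (-1) v))) (by
      rw [Fin.cons_injective_iff, Fin.cons_injective_iff, Fin.cons_injective_iff]
      refine ⟨?_, ?_, ?_, hinj⟩
      · rintro ⟨i, hi⟩
        induction i using Fin.cases with
        | zero => exact hQ.ne (by simpa using hi)
        | succ i =>
          induction i using Fin.cases with
          | zero =>
            have : -1 = Q := by simpa using hi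
            linarith
          | succ i => exact hQv i (by simpa using hi)
      · rintro ⟨i, hi⟩
        induction i using Fin.cases with
        | zero => simp at hi
        | succ i => exact (hpos i).ne' (by simpa using hi)
      · rintro ⟨i, hi⟩
        have := hpos i
        linarith)
  rw [lagrangeSum_cons, lagrangeSum_cons, lagrangeSum_cons] at hL
  simp only [Fin.prod_univ_succ (n := m + 1), Fin.prod_univ_succ (n := m + 1 + 1), Fin.cons_zero,
    Fin.cons_succ] at hL
  rw [lagrangeSum_vdm (v := v)
    (fun t => ((1 - t) * (1 - g * t)) * ((n₁ * t + n₀) / (t * (t - Q)))) h1]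
  have hsum : (lagrangeSum v fun t => ((1 - t) * (1 - g * t)) * ((n₁ * t + n₀) / (t * (t - Q))) *
      (∏ i, (1 - v i * t)) / (1 - t ^ 2)) = lagrangeSum v fun t =>
        (n₀ + n₁ * t) * ((1 + -g * t) * (∏ i, (1 + -v i * t))) / (t - Q) / (t - 0) / (t - -1) := by
    rw [lagrangeSum, lagrangeSum]
    refine Finset.sum_congr rfl fun j _ => ?_
    congr 1
    have e : 1 - v j ^ 2 = (1 - v j) * (1 + v j) := by ring
    have h2 : 1 - v j ≠ 0 := by linarith [hlt j]
    have h3 : 1 + v j ≠ 0 := by linarith [hpos j]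
    have h4 := (hpos j).ne'
    have h5 : v j - Q ≠ 0 := sub_ne_zero.2 (hQv j)
    simp only [neg_mul, ← sub_eq_add_neg, sub_zero, sub_neg_eq_add, e]
    rw [add_comm (v j) 1, add_comm n₀]
    field_simp
  rw [hsum]
  have hm1 : ∏ i, (1 + -v i * -1) = (-1) ^ (m + 1) * ∏ i, (-1 - v i) := by
    rw [← prod_fin_neg]
    exact Finset.prod_congr rfl fun k _ => by ring
  have hm3 : ∏ i, (Q - v i) = (-1) ^ (m + 1) * ∏ i, (v i - Q) := by
    rw [← prod_fin_neg]
    exact Finset.prod_congr rfl fun k _ => by ring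
  have hm2 := prod_sub_ne_zero (v := v) (x := -1) fun i => by linarith [hpos i]
  have hm4 : ∏ i, (v i - Q) ≠ 0 := Finset.prod_ne_zero_iff.2 fun i _ => sub_ne_zero.2 (hQv i)
  rw [hm1, hm3] at hL
  simp only [mul_zero, add_zero, Finset.prod_const_one, mul_one, zero_sub, prod_fin_neg] at hL
  simp only [neg_mul, ← sub_eq_add_neg] at hL ⊢
  have hs : ((-1 : ℝ) ^ m) * (-1) ^ m = 1 := by rw [← mul_pow]; norm_num
  have h5 : ((-1 : ℝ) ^ m) ≠ 0 := by positivity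
  rw [pow_succ] at hL
  generalize (lagrangeSum v fun t =>
    (n₀ + n₁ * t) * ((1 - g * t) * (∏ i, (1 - v i * t))) / (t - Q) / (t - 0) / (t - -1)) = L at *
  generalize ∏ i, v i = V at *
  generalize ∏ i, (-1 - v i) = U at *
  generalize ∏ i, (v i - Q) = W at *
  generalize ∏ i, (1 - v i * Q) = W' at *
  generalize (-1 : ℝ) ^ m = s at *
  have hQ1 : 1 + Q ≠ 0 := by positivity
  have hQ2 : -1 - Q ≠ 0 := by linarith
  have hQ3 : Q - -1 ≠ 0 := by linarith
  have hQ4 := hQ.ne'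
  have e1 : (n₀ + n₁ * Q) * ((1 - g * Q) * W') / ((Q - 0) * ((Q - -1) * (s * -1 * W))) =
      -s * (W' / W * ((1 - g * Q) * (n₁ * Q + n₀)) / (Q * (1 + Q))) := by
    rw [sub_zero, sub_neg_eq_add, add_comm Q 1]
    field_simp
    linear_combination ((1 - g * Q) * (n₀ + n₁ * Q) * W') * hs
  have e2 : n₀ / -Q / - -(1 * (s * -1 * V)) = s * (n₀ / (Q * V)) := by
    field_simp
    linear_combination -n₀ * hs
  have e3 : (n₀ + n₁ * -1) * ((1 - g * -1) * (s * -1 * U)) / (-1 - Q) / (-1 - 0) / U =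
      -s * ((1 + g) * (n₀ - n₁) / (1 + Q)) := by
    rw [sub_zero, show -1 - Q = -(1 + Q) by ring]
    field_simp
    ring
  rw [e1, e2, e3, ← hcancel] at hL
  linear_combination s * hL + (W' / W * ((1 - g * Q) * (n₁ * Q + n₀)) / (Q * (1 + Q))) * hs

end Identities

/-! ### The sum over the tail of the diagonal -/

section ChainSum

/-- A weakly increasing sequence is its first entry followed by the remaining differences. -/
def monoSeqEquiv (p : ℕ) : MonoSeq (p + 1) ≃ ℕ × MonoSeq p where
  toFun y := (y.1 0, ⟨fun i => y.1 i.succ - y.1 0, fun i j hij =>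
    Nat.sub_le_sub_right (y.2 (Fin.succ_le_succ_iff.2 hij)) _⟩)
  invFun x := ⟨Fin.cons x.1 fun i => x.1 + x.2.1 i, by
    intro i j hij
    induction i using Fin.cases with
    | zero =>
      induction j using Fin.cases with
      | zero => rfl
      | succ j => simp
    | succ i =>
      induction j using Fin.cases with
      | zero => exact absurd hij (not_le_of_gt (Fin.succ_pos i))
      | succ j => simpa using x.2.2 (Fin.succ_le_succ_iff.1 hij)⟩
  left_inv y := by
    refine Subtype.ext (funext fun i => ?_)
    induction i using Fin.cases with
    | zero => rfl
    | succ i => simpa using Nat.add_sub_cancel' (y.2 (Fin.zero_le i.succ))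
  right_inv x := by
    refine Prod.ext rfl (Subtype.ext (funext fun i => ?_))
    simp

/-- The strictly decreasing sequence `1, q ^ (y₀ + 1), q ^ (y₁ + 2), …`. -/
def chainSeq (q : ℝ) {p : ℕ} (y : MonoSeq p) : Fin (p + 1) → ℝ :=
  Fin.cons 1 fun i => q ^ (y.1 i + i + 1)

variable {q : ℝ} {p : ℕ}

theorem chainSeq_symm (s : ℕ) (y : MonoSeq p) : chainSeq q ((monoSeqEquiv p).symm (s, y)) =
    Fin.cons 1 fun i => q ^ (s + 1) * chainSeq q y i := by
  rw [chainSeq]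
  congr 1
  funext i
  induction i using Fin.cases with
  | zero => simp [monoSeqEquiv, chainSeq]
  | succ i =>
    simp only [monoSeqEquiv, chainSeq, Equiv.coe_fn_symm_mk, Fin.cons_succ, Fin.val_succ, ← pow_add]
    congr 1
    ring

/-- The product of an alternant with the variables and their successive differences. -/
noncomputable def chainWeight (ε : ℕ) (ℓ : Fin (p + 1) → ℕ) (z : Fin (p + 1) → ℝ) : ℝ :=
  (∏ i, z i) * Matrix.det (Matrix.of fun i j => z i ^ ℓ j) * z (Fin.last p) ^ ε *
    ∏ i : Fin p, (z i.castSucc - z i.succ)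

/-- Homogeneity: the common scale of the remaining variables separates, and summing over it gives a
geometric series. -/
theorem chainWeight_smul (ε : ℕ) (ℓ : Fin (p + 1) → ℕ) (z : Fin (p + 1) → ℝ) (a : ℝ) :
    chainWeight ε ℓ (fun i => a * z i) =
      a ^ (2 * p + 1 + ∑ i, ℓ i + ε) * chainWeight ε ℓ z := by
  have h1 : (Matrix.of fun i j => (a * z i) ^ ℓ j) =
      Matrix.of fun i j => a ^ ℓ j * (Matrix.of fun i j => z i ^ ℓ j) i j := by
    ext i j
    simp [mul_pow]
  have h2 : ∏ i : Fin p, (a * z i.castSucc - a * z i.succ) =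
      a ^ p * ∏ i : Fin p, (z i.castSucc - z i.succ) := by
    simp only [← mul_sub, Finset.prod_mul_distrib]
    simp
  rw [chainWeight, h1, Matrix.det_mul_row, h2, Finset.prod_mul_distrib, Finset.prod_pow_eq_pow_sum,
    mul_pow, chainWeight]
  simp only [Finset.prod_const, Finset.card_univ, Fintype.card_fin]
  ring

theorem det_cons_mul (ε : ℕ) (ℓ : Fin (p + 2) → ℕ) (b : ℝ) (z : Fin (p + 1) → ℝ) :
    (b * ∏ i, z i) * Matrix.det (Matrix.of fun i j => (Fin.cons b z : Fin (p + 2) → ℝ) i ^ ℓ j) *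
      z (Fin.last p) ^ ε * ∏ i : Fin p, (z i.castSucc - z i.succ) =
    ∑ j : Fin (p + 2), (-1) ^ (j : ℕ) * b ^ (ℓ j + 1) * chainWeight ε (ℓ ∘ j.succAbove) z := by
  rw [Matrix.det_succ_row_zero, Finset.mul_sum, Finset.sum_mul, Finset.sum_mul]
  refine Finset.sum_congr rfl fun j _ => ?_
  have : (Matrix.of fun i j => (Fin.cons b z : Fin (p + 2) → ℝ) i ^ ℓ j).submatrix Fin.succ
      j.succAbove = Matrix.of fun i k => z i ^ (ℓ ∘ j.succAbove) k := by
    ext i k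
    simp
  rw [this, chainWeight]
  simp only [Matrix.of_apply, Fin.cons_zero]
  ring

theorem chainWeight_cons (ε : ℕ) (ℓ : Fin (p + 2) → ℕ) (b : ℝ) (z : Fin (p + 1) → ℝ) :
    chainWeight ε ℓ (Fin.cons b z) = ∑ j : Fin (p + 2),
      (-1) ^ (j : ℕ) * (b ^ (ℓ j + 1) * (b - z 0)) * chainWeight ε (ℓ ∘ j.succAbove) z := by
  have h := congrArg (· * (b - z 0)) (det_cons_mul ε ℓ b z)
  rw [Finset.sum_mul] at h
  have h1 : ∏ i, (Fin.cons b z : Fin (p + 2) → ℝ) i = b * ∏ i, z i := by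
    simp [Fin.prod_univ_succ]
  have h2 : ∏ i : Fin (p + 1), ((Fin.cons b z : Fin (p + 2) → ℝ) i.castSucc -
      (Fin.cons b z : Fin (p + 2) → ℝ) i.succ) = (b - z 0) * ∏ i : Fin p, (z i.castSucc - z i.succ) := by
    rw [Fin.prod_univ_succ]
    rfl
  rw [Finset.sum_congr rfl fun (j : Fin (p + 2)) _ => show (-1) ^ (j : ℕ) * (b ^ (ℓ j + 1) *
    (b - z 0)) * chainWeight ε (ℓ ∘ j.succAbove) z = (-1) ^ (j : ℕ) * b ^ (ℓ j + 1) *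
      chainWeight ε (ℓ ∘ j.succAbove) z * (b - z 0) by ring, ← h, chainWeight, h1, h2,
    ← Fin.succ_last, Fin.cons_succ]
  ring

theorem hasSum_mul_prod {α β : Type*} {f : α → ℝ} {g : β → ℝ} {a b : ℝ} (hf : HasSum f a)
    (hg : HasSum g b) : HasSum (fun x : α × β => f x.1 * g x.2) (a * b) :=
  hf.mul hg (summable_mul_of_summable_norm hf.summable.norm hg.summable.norm)

theorem hasSum_pow_succ (h0 : 0 < q) (h1 : q < 1) {E : ℕ} (hE : 1 ≤ E) :
    HasSum (fun s : ℕ => (q ^ (s + 1)) ^ E) (q ^ E / (1 - q ^ E)) := by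
  convert! (hasSum_geometric_of_lt_one (pow_nonneg h0.le E)
    (pow_lt_one₀ h0.le h1 (by omega))).mul_left (q ^ E) using 1
  funext s
  rw [← pow_mul, ← pow_mul, ← pow_add]
  congr 1
  ring

/-- The product `(1 - q^ε x) (1 - q^(ε-1) x)`. -/
noncomputable def endFactor (q : ℝ) (ε : ℕ) (x : ℝ) : ℝ := (1 - q ^ ε * x) * (1 - q ^ ε / q * x)

/-- The use of `ε ∈ {0, 1}`: one of `q ^ ε` and `q ^ ε / q` equals `1`, which provides the factor `1
- x` needed in `sum_removal`. -/
theorem endFactor_eq (h0 : 0 < q) {ε : ℕ} (hε : ε = 0 ∨ ε = 1) (x : ℝ) :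
    endFactor q ε x = (1 - x) * (1 - q ^ ε * (q ^ ε / q) * x) := by
  have := h0.ne'
  rcases hε with rfl | rfl
  · simp [endFactor]
  · rw [endFactor, pow_one, div_self this]
    ring

/-- The value of the sum of `chainWeight`. -/
noncomputable def chainValue (q : ℝ) (ε : ℕ) (v : Fin (p + 1) → ℝ) : ℝ :=
  (q ^ ε / q - q ^ ε) ^ p * (∏ i, endFactor q ε (v i))⁻¹ * vdm v * endFactor q ε (∏ i, v i)

theorem endFactor_pos (h0 : 0 < q) (h1 : q < 1) (ε : ℕ) {e : ℕ} (he : 2 ≤ e) :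
    0 < endFactor q ε (q ^ e) := by
  have e2 : q ^ ε / q * q ^ e = q ^ (ε + (e - 1)) := by
    obtain ⟨d, rfl⟩ := Nat.exists_eq_add_of_le' (show 1 ≤ e by omega)
    rw [Nat.add_sub_cancel, pow_succ, pow_add]
    field_simp
  rw [endFactor, ← pow_add, e2]
  exact mul_pos (sub_pos.2 (pow_lt_one₀ h0.le h1 (by omega)))
    (sub_pos.2 (pow_lt_one₀ h0.le h1 (by omega)))

theorem prod_pow_add_two (ℓ : Fin (p + 1) → ℕ) :
    ∏ i, q ^ (ℓ i + 2) = q ^ (∑ i, ℓ i + 2 * p + 2) := by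
  rw [Finset.prod_pow_eq_pow_sum, Finset.sum_add_distrib]
  congr 1
  simp
  ring

theorem vdm_div (v : Fin (p + 2) → ℝ) (hinj : Function.Injective v)
    (h1 : ∀ i j, 1 - v i * v j ≠ 0) (j : Fin (p + 2)) :
    (-1) ^ (j : ℕ) * vdm (v ∘ j.succAbove) =
      vdm v * ∏ i, ((1 - v (j.succAbove i) * v j) / (v (j.succAbove i) - v j)) := by
  rw [vdm_succAbove v j, mul_assoc, ← Finset.prod_mul_distrib, Finset.prod_eq_one, mul_one]
  intro i _
  have h2 : v (j.succAbove i) - v j ≠ 0 := sub_ne_zero.2 (hinj.ne (Fin.succAbove_ne j i))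
  have h3 := h1 (j.succAbove i) j
  field_simp

/-- The values of the chain sum after removal of one exponent. -/
theorem chainValue_succAbove (v : Fin (p + 2) → ℝ) (hinj : Function.Injective v)
    (h1 : ∀ i j, 1 - v i * v j ≠ 0) {ε : ℕ} (hD : ∀ i, endFactor q ε (v i) ≠ 0) (j : Fin (p + 2)) :
    (-1) ^ (j : ℕ) * chainValue q ε (v ∘ j.succAbove) =
      (q ^ ε / q - q ^ ε) ^ p * (∏ i, endFactor q ε (v i))⁻¹ * vdm v *
        (endFactor q ε (v j) * endFactor q ε (∏ i, v (j.succAbove i)) *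
          ∏ i, ((1 - v (j.succAbove i) * v j) / (v (j.succAbove i) - v j))) := by
  have h2 := vdm_div v hinj h1 j
  have h3 : (∏ i, endFactor q ε ((v ∘ j.succAbove) i))⁻¹ =
      (∏ i, endFactor q ε (v i))⁻¹ * endFactor q ε (v j) := by
    rw [Fin.prod_univ_succAbove (fun i => endFactor q ε (v i)) j, mul_inv, mul_right_comm,
      inv_mul_cancel₀ (hD j), one_mul]
    rfl
  rw [chainValue, h3]
  simp only [Function.comp_apply (f := v)]
  linear_combination ((q ^ ε / q - q ^ ε) ^ p * (∏ i, endFactor q ε (v i))⁻¹ *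
    endFactor q ε (v j) * endFactor q ε (∏ i, v (j.succAbove i))) * h2

/-- Induction on the length, by expansion along the first row. The difference of the geometric sums
with exponents `E` and `E + 1` has the denominator `(1 - q ^ E) (1 - q ^ (E + 1))`, which is
`endFactor` at the product of the remaining variables; it cancels, and `sum_removal` evaluates what
is left. -/
theorem hasSum_chainWeight (h0 : 0 < q) (h1 : q < 1) {ε : ℕ} (hε : ε = 0 ∨ ε = 1)
    (ℓ : Fin (p + 1) → ℕ) (hℓ : Function.Injective ℓ) :
    HasSum (fun y : MonoSeq p => chainWeight ε ℓ (chainSeq q y))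
      (chainValue q ε fun i => q ^ (ℓ i + 2)) := by
  induction p with
  | zero =>
    have : Unique (MonoSeq 0) :=
      { default := ⟨Fin.elim0, fun i => i.elim0⟩
        uniq := fun y => Subtype.ext (funext fun i => i.elim0) }
    convert! hasSum_unique (fun y : MonoSeq 0 => chainWeight ε ℓ (chainSeq q y)) using 1
    have := (endFactor_pos h0 h1 ε (show 2 ≤ ℓ 0 + 2 by omega)).ne'
    simp [chainValue, chainWeight, chainSeq, vdm, this]
  | succ p ih =>
    have hpow : ∀ e : ℕ, 1 ≤ e → 0 < 1 - q ^ e := fun e he =>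
      sub_pos.2 (pow_lt_one₀ h0.le h1 (by omega))
    have hterm : ∀ j : Fin (p + 2), HasSum (fun x : ℕ × MonoSeq p => (-1) ^ (j : ℕ) *
        (((q ^ (x.1 + 1)) ^ (2 * p + 1 + ∑ i, (ℓ ∘ j.succAbove) i + ε) * (1 - q ^ (x.1 + 1))) *
          chainWeight ε (ℓ ∘ j.succAbove) (chainSeq q x.2)))
        ((q ^ ε / q - q ^ ε) ^ (p + 1) * (∏ i, endFactor q ε (q ^ (ℓ i + 2)))⁻¹ *
          vdm (fun i => q ^ (ℓ i + 2)) * ((∏ i, q ^ (ℓ (j.succAbove i) + 2)) *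
            endFactor q ε (q ^ (ℓ j + 2)) * ∏ i, ((1 - q ^ (ℓ (j.succAbove i) + 2) * q ^ (ℓ j + 2)) /
              (q ^ (ℓ (j.succAbove i) + 2) - q ^ (ℓ j + 2))))) := by
      intro j
      have hs := (hasSum_pow_succ h0 h1
        (show 1 ≤ 2 * p + 1 + ∑ i, (ℓ ∘ j.succAbove) i + ε by omega)).sub
        (hasSum_pow_succ h0 h1 (show 1 ≤ 2 * p + 1 + ∑ i, (ℓ ∘ j.succAbove) i + ε + 1 by omega))
      have hm := (hasSum_mul_prod hs (ih (ℓ ∘ j.succAbove)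
        (hℓ.comp Fin.succAbove_right_injective))).mul_left ((-1) ^ (j : ℕ))
      have hv := chainValue_succAbove (q := q) (ε := ε) (fun i => q ^ (ℓ i + 2))
        (fun a b hab => hℓ (by
          have := (pow_right_injective₀ h0 h1.ne) hab
          omega))
        (fun a b => by
          rw [← pow_add]
          exact (hpow _ (by omega)).ne')
        (fun a => (endFactor_pos h0 h1 ε (by omega)).ne') j
      convert! hm using 1
      · funext x
        ring
      · have e1 : (chainValue q ε fun i => q ^ ((ℓ ∘ j.succAbove) i + 2)) =
          chainValue q ε ((fun i => q ^ (ℓ i + 2)) ∘ j.succAbove) := rfl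
        rw [e1, mul_left_comm ((-1 : ℝ) ^ (j : ℕ)), hv]
        -- The degree of homogeneity of the remaining `chainWeight`.
        set E := 2 * p + 1 + ∑ i, (ℓ ∘ j.succAbove) i + ε with hE
        have hV : ∏ i, q ^ (ℓ (j.succAbove i) + 2) = q ^ (∑ i, (ℓ ∘ j.succAbove) i + 2 * p + 2) :=
          prod_pow_add_two (ℓ ∘ j.succAbove)
        have hα : q ^ ε * ∏ i, q ^ (ℓ (j.succAbove i) + 2) = q ^ (E + 1) := by
          rw [hV, ← pow_add]
          congr 1
          omega
        have hβ : q ^ ε / q * ∏ i, q ^ (ℓ (j.succAbove i) + 2) = q ^ E := by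
          rw [div_mul_eq_mul_div, hα, pow_succ, mul_div_assoc, div_self h0.ne', mul_one]
        have hn1 := (hpow E (by omega)).ne'
        have hn2 := (hpow (E + 1) (by omega)).ne'
        have hfin : (q ^ E / (1 - q ^ E) - q ^ (E + 1) / (1 - q ^ (E + 1))) *
            endFactor q ε (∏ i, q ^ (ℓ (j.succAbove i) + 2)) =
            (q ^ ε / q - q ^ ε) * ∏ i, q ^ (ℓ (j.succAbove i) + 2) := by
          rw [endFactor, hα, hβ, sub_mul (q ^ ε / q), hα, hβ]
          field_simp
          ring
        linear_combination (-(q ^ ε / q - q ^ ε) ^ p * (∏ i, endFactor q ε (q ^ (ℓ i + 2)))⁻¹ *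
          vdm (fun i => q ^ (ℓ i + 2)) * (endFactor q ε (q ^ (ℓ j + 2)) *
            ∏ i, ((1 - q ^ (ℓ (j.succAbove i) + 2) * q ^ (ℓ j + 2)) /
              (q ^ (ℓ (j.succAbove i) + 2) - q ^ (ℓ j + 2))))) * hfin
    have hall := hasSum_sum fun j (_ : j ∈ Finset.univ) => hterm j
    rw [← (monoSeqEquiv p).symm.hasSum_iff]
    convert! hall using 1
    · funext x
      obtain ⟨s, y⟩ := x
      rw [Function.comp_apply, chainSeq_symm, chainWeight_cons]
      refine Finset.sum_congr rfl fun j _ => ?_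
      rw [chainWeight_smul]
      simp only [one_pow, one_mul, chainSeq, Fin.cons_zero, mul_one]
      ring
    · rw [← Finset.mul_sum, chainValue]
      have h2 := sum_removal (v := fun i => q ^ (ℓ i + 2)) (q ^ ε * (q ^ ε / q))
        (fun i => pow_pos h0 _) (fun i => pow_lt_one₀ h0.le h1 (by omega))
        (fun a b hab => hℓ (by
          have := (pow_right_injective₀ h0 h1.ne) hab
          omega))
      rw [endFactor_eq h0 hε (∏ i, q ^ (ℓ i + 2)), ← h2]
      simp only [endFactor_eq h0 hε (q ^ (ℓ _ + 2))]

end ChainSum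

/-! ### Rational identities for the additional node -/

section Algebra

variable {q r K c₀ c₁ c₂ : ℝ}

/-- The numerator factor `1 + r q K` is what removes the denominator `1 + Q` of `sum_removal_node`,
where `Q = r q K`. -/
theorem second_difference (h1 : 1 - r * K ≠ 0) (h2 : 1 - r * q * K ≠ 0) (h3 : 1 - r * q ^ 2 * K ≠ 0)
    (hc₂ : c₂ = r * K / (1 - r * K) - 2 * (r * q * K / (1 - r * q * K)) +
      r * q ^ 2 * K / (1 - r * q ^ 2 * K)) :
    c₂ = r * K * (1 - q) ^ 2 * (1 + r * q * K) /
      ((1 - r * K) * (1 - r * q * K) * (1 - r * q ^ 2 * K)) := by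
  have h2' : 1 - r * K * q ≠ 0 := by rwa [mul_right_comm]
  have h3' : 1 - r * K * q ^ 2 ≠ 0 := by rwa [mul_right_comm]
  rw [hc₂]
  field_simp
  ring

theorem node_value (hq : q ≠ 0) (hr : r ≠ 0) (hK : K ≠ 0) (g : ℝ) (h1 : 1 - r * K ≠ 0)
    (h2 : 1 - r * q * K ≠ 0) (h3 : 1 - r * q ^ 2 * K ≠ 0) (h4 : 1 + r * q * K ≠ 0)
    (hc₁ : c₁ = -c₀ - c₂) (hc₂ : c₂ = r * K / (1 - r * K) - 2 * (r * q * K / (1 - r * q * K)) +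
      r * q ^ 2 * K / (1 - r * q ^ 2 * K)) :
    (1 - g * (r * q * K)) * (r * (c₂ * q * K + c₁ * q + c₀) * (r * q * K) +
      -(r ^ 2 * q * (c₂ * K * (q + 1) + c₁ * (1 + q * K) + c₀ * (1 + K)))) /
        (r * q * K * (1 + r * q * K)) =
    (1 - g * (r * q * K)) * ((1 - q) ^ 2 * r ^ 2 * (1 - K) * (1 - q * K)) /
      ((1 - r * K) * (1 - r * q * K) * (1 - r * q ^ 2 * K)) := by
  have e : r * (c₂ * q * K + c₁ * q + c₀) * (r * q * K) +
      -(r ^ 2 * q * (c₂ * K * (q + 1) + c₁ * (1 + q * K) + c₀ * (1 + K))) =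
      c₂ * (r ^ 2 * q * ((1 - K) * (1 - q * K))) := by
    rw [hc₁]
    ring
  rw [e, second_difference h1 h2 h3 hc₂]
  field_simp

/-- This is the hypothesis `hcancel` of `sum_removal_node`; the alternatives for `V` and `g` are the
cases `ε = 0` and `ε = 1`. -/
theorem cancel_of_zero (hq : q ≠ 0) (hr : r ≠ 0) (hK : K ≠ 0) (h0 : 1 - r ≠ 0)
    (h0' : 1 - r * q ≠ 0) (h1 : 1 - r * K ≠ 0)
    (h2 : 1 - r * q * K ≠ 0) (h3 : 1 - r * q ^ 2 * K ≠ 0) (h4 : 1 + r * q * K ≠ 0)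
    (hc₁ : c₁ = -c₀ - c₂) (hc₂ : c₂ = r * K / (1 - r * K) - 2 * (r * q * K / (1 - r * q * K)) +
      r * q ^ 2 * K / (1 - r * q ^ 2 * K))
    (hc₀ : c₀ = r / (1 - r) - r * q / (1 - r * q) - r * K / (1 - r * K) +
      r * q * K / (1 - r * q * K)) {n₀ n₁ V g : ℝ} (hV : V = r * q ∧ g = 1 / q ∨ V = r ∧ g = q)
    (hn₁ : n₁ = r * (c₂ * q * K + c₁ * q + c₀))
    (hn₀ : n₀ = -(r ^ 2 * q * (c₂ * K * (q + 1) + c₁ * (1 + q * K) + c₀ * (1 + K)))) :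
    n₀ / (r * q * K * V) - g * V * n₁ = (1 + g) * (n₀ - n₁) / (1 + r * q * K) := by
  have hc₀' : c₀ = (1 - q) * r * (1 / ((1 - r) * (1 - r * q)) -
      K / ((1 - r * K) * (1 - r * q * K))) := by
    rw [hc₀]
    field_simp
    ring
  have hc₂' := second_difference h1 h2 h3 hc₂
  have e₁ : n₁ = r * (c₂ * (q * K - q) + c₀ * (1 - q)) := by
    rw [hn₁, hc₁]
    ring
  have e₀ : n₀ = -(r ^ 2 * q * (c₂ * (K - 1) + c₀ * K * (1 - q))) := by
    rw [hn₀, hc₁]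
    ring
  rw [e₀, e₁, hc₂', hc₀']
  rcases hV with ⟨rfl, rfl⟩ | ⟨rfl, rfl⟩
  · field_simp
    ring
  · field_simp
    ring

/-- Two of the three denominators are cancelled by `endFactor`. The coefficients sum to zero by
`hc₁`, which removes the cubic term in `X`; hence the numerator is linear in `t` and the surviving
denominator gives the node `r q K`. -/
theorem partial_fraction {t X : ℝ} (ht : t ≠ 0) (hX : X = r / t) (h0 : 1 - X ≠ 0)
    (h1 : 1 - q * X ≠ 0) (h2 : 1 - q * K * X ≠ 0) (hc₁ : c₁ = -c₀ - c₂) :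
    (1 - q * X) * (1 - X) * (c₂ * (q * K * X / (1 - q * K * X)) + c₁ * (q * X / (1 - q * X)) +
      c₀ * (X / (1 - X))) =
      (r * (c₂ * q * K + c₁ * q + c₀) * t +
        -(r ^ 2 * q * (c₂ * K * (q + 1) + c₁ * (1 + q * K) + c₀ * (1 + K)))) /
        (t * (t - r * q * K)) := by
  have e : (1 - q * X) * (1 - X) * (c₂ * (q * K * X / (1 - q * K * X)) +
      c₁ * (q * X / (1 - q * X)) + c₀ * (X / (1 - X))) =
      (c₂ * (q * K * X) * ((1 - q * X) * (1 - X)) + c₁ * (q * X) * ((1 - X) * (1 - q * K * X)) +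
        c₀ * X * ((1 - q * X) * (1 - q * K * X))) / (1 - q * K * X) := by
    have h2' : 1 - q * X * K ≠ 0 := by rwa [mul_right_comm]
    field_simp
  have e2 : 1 - q * K * X = (t - r * q * K) / t := by
    rw [hX]
    field_simp
  rw [e, e2, hX, hc₁]
  field_simp
  ring

end Algebra

/-! ### The sum over the diagonal of a swivel shifted -/

section SwivelSum

variable {m : ℕ}

/-- The determinant for the block `((k - 1), 3, n - 1)`. -/
def detThree (k : ℕ) (a b c : ℝ) : ℝ :=
  a ^ (k + 1) * (b - c) - a * (b ^ (k + 1) - c ^ (k + 1)) + (b ^ (k + 1) * c - b * c ^ (k + 1))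

/-- The weight of a weakly increasing sequence of diagonal entries of a swivel shifted, up to a
constant factor. -/
noncomputable def swivelWeight (ε k : ℕ) (ℓ : Fin (m + 2) → ℕ) (w : Fin (m + 3) → ℝ) : ℝ :=
  (∏ i, w i) * Matrix.det (Matrix.of fun i j : Fin (m + 2) => w i.succ ^ ℓ j) *
    w (Fin.last (m + 2)) ^ ε * ((w 0 - w 1) * detThree k (w 0) (w 1) (w 2)) *
    ∏ i : Fin m, (w i.castSucc.succ.succ - w i.succ.succ.succ)

/-- The degree of homogeneity is the number of elements of the main part, compare
`card_swivelPoset`. -/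
theorem swivelWeight_smul (ε k : ℕ) (ℓ : Fin (m + 2) → ℕ) (w : Fin (m + 3) → ℝ) (s : ℝ) :
    swivelWeight ε k ℓ (fun i => s * w i) =
      s ^ (∑ i, ℓ i + 2 * m + 6 + ε + k) * swivelWeight ε k ℓ w := by
  have h1 : (Matrix.of fun i j : Fin (m + 2) => (s * w i.succ) ^ ℓ j) =
      Matrix.of fun i j => s ^ ℓ j * (Matrix.of fun i j : Fin (m + 2) => w i.succ ^ ℓ j) i j := by
    ext i j
    simp [mul_pow]
  have h2 : ∏ i : Fin m, (s * w i.castSucc.succ.succ - s * w i.succ.succ.succ) =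
      s ^ m * ∏ i : Fin m, (w i.castSucc.succ.succ - w i.succ.succ.succ) := by
    simp only [← mul_sub, Finset.prod_mul_distrib]
    simp
  rw [swivelWeight, h1, Matrix.det_mul_row, h2, Finset.prod_mul_distrib,
    Finset.prod_pow_eq_pow_sum, swivelWeight]
  simp only [Finset.prod_const, Finset.card_univ, Fintype.card_fin, mul_pow, detThree]
  ring

/-- The first three variables are written as `1`, `a`, `a b`. The determinant for `λ` starts with
the variable `a`, and is expanded along that row; the remaining variables carry the common scale `a
b`. -/
theorem swivelWeight_cons (ε k : ℕ) (ℓ : Fin (m + 2) → ℕ) (a b : ℝ) (x : Fin (m + 1) → ℝ)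
    (hx : x 0 = 1) :
    swivelWeight ε k ℓ (Fin.cons 1 (Fin.cons a fun i => a * b * x i)) =
      ∑ j : Fin (m + 2), (-1) ^ (j : ℕ) * ((a ^ (ℓ j + 1) *
        (a * b) ^ (2 * m + 1 + ∑ i, (ℓ ∘ j.succAbove) i + ε) * (1 - a) *
        detThree k 1 a (a * b)) * chainWeight ε (ℓ ∘ j.succAbove) x) := by
  have h := congrArg (· * ((1 - a) * detThree k 1 a (a * b)))
    (det_cons_mul ε ℓ a fun i => a * b * x i)
  rw [Finset.sum_mul] at h
  simp only [chainWeight_smul] at h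
  rw [Finset.sum_congr rfl fun (j : Fin (m + 2)) _ => show (-1) ^ (j : ℕ) * ((a ^ (ℓ j + 1) *
        (a * b) ^ (2 * m + 1 + ∑ i, (ℓ ∘ j.succAbove) i + ε) * (1 - a) *
        detThree k 1 a (a * b)) * chainWeight ε (ℓ ∘ j.succAbove) x) = (-1) ^ (j : ℕ) *
      a ^ (ℓ j + 1) * ((a * b) ^ (2 * m + 1 + ∑ i, (ℓ ∘ j.succAbove) i + ε) *
        chainWeight ε (ℓ ∘ j.succAbove) x) * ((1 - a) * detThree k 1 a (a * b)) by ring, ← h]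
  have h2 : (2 : Fin (m + 3)) = (0 : Fin (m + 1)).succ.succ := rfl
  have h1 : (1 : Fin (m + 3)) = (0 : Fin (m + 2)).succ := rfl
  rw [swivelWeight, Fin.prod_univ_succ, Fin.prod_univ_succ, h1, h2, ← Fin.succ_last, ← Fin.succ_last]
  simp only [Fin.cons_zero, Fin.cons_succ, hx]
  ring_nf

variable {q : ℝ}

/-- The sum of `detThree`, against the weights of the second and third diagonal entries. -/
theorem hasSum_detThree (h0 : 0 < q) (h1 : q < 1) (k : ℕ) {l A : ℕ} (hA : 1 ≤ A) {Z : ℕ → ℝ}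
    (hZ : ∀ i, Z i = q ^ (l + A + 1 + i) / (1 - q ^ (l + A + 1 + i))) :
    HasSum (fun x : ℕ × ℕ => (q ^ (x.1 + 1)) ^ (l + 1) * (q ^ (x.1 + 1) * q ^ (x.2 + 1)) ^ A *
      (1 - q ^ (x.1 + 1)) * detThree k 1 (q ^ (x.1 + 1)) (q ^ (x.1 + 1) * q ^ (x.2 + 1)))
      ((Z (k + 1) - 2 * Z (k + 2) + Z (k + 3)) * (q ^ (A + k + 1) / (1 - q ^ (A + k + 1))) +
        (Z 2 - Z 1 + Z (k + 2) - Z (k + 3)) * (q ^ (A + 1) / (1 - q ^ (A + 1))) +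
        (Z 1 - Z 2 - Z (k + 1) + Z (k + 2)) * (q ^ A / (1 - q ^ A))) := by
  have hs : ∀ i, HasSum (fun s : ℕ => (q ^ (s + 1)) ^ (l + A + 1 + i)) (Z i) := fun i => by
    rw [hZ]
    exact hasSum_pow_succ h0 h1 (by omega)
  have h2 := hasSum_mul_prod (((hs (k + 1)).sub ((hs (k + 2)).mul_left 2)).add (hs (k + 3)))
    (hasSum_pow_succ h0 h1 (show 1 ≤ A + k + 1 by omega))
  have h3 := hasSum_mul_prod ((((hs 2).sub (hs 1)).add (hs (k + 2))).sub (hs (k + 3)))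
    (hasSum_pow_succ h0 h1 (show 1 ≤ A + 1 by omega))
  have h4 := hasSum_mul_prod ((((hs 1).sub (hs 2)).sub (hs (k + 1))).add (hs (k + 2)))
    (hasSum_pow_succ h0 h1 hA)
  convert! (h2.add h3).add h4 using 1
  funext x
  generalize q ^ (x.1 + 1) = a
  generalize q ^ (x.2 + 1) = b
  simp only [detThree]
  ring

/-- The sum of `swivelWeight` over the sequences with first entry `0`. -/
noncomputable def swivelValue (q : ℝ) (ε k : ℕ) (v : Fin (m + 2) → ℝ) : ℝ :=
  let r := q ^ ε / q * ∏ i, v i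
  let K := q ^ k
  (q ^ ε / q - q ^ ε) ^ m * (∏ i, endFactor q ε (v i))⁻¹ * vdm v *
    ((∏ i, (1 - v i * (r * q * K))) / (∏ i, (v i - r * q * K)) *
      ((1 - q ^ ε * (q ^ ε / q) * (r * q * K)) * ((1 - q) ^ 2 * r ^ 2 * (1 - K) * (1 - q * K)) /
        ((1 - r * K) * (1 - r * q * K) * (1 - r * q ^ 2 * K))))

/-- For each removed exponent the tail is summed by `hasSum_chainWeight` and the ratios of the first
three variables by `hasSum_detThree`. After `partial_fraction` the sum over the removed exponent has
the shape of `sum_removal_node`. -/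
theorem hasSum_swivelWeight (h0 : 0 < q) (h1 : q < 1) {ε : ℕ} (hε : ε = 0 ∨ ε = 1) {k : ℕ}
    (ℓ : Fin (m + 2) → ℕ) (hℓ : Function.Injective ℓ) :
    HasSum (fun y : MonoSeq (m + 2) => swivelWeight ε k ℓ (chainSeq q y))
      (swivelValue q ε k fun i => q ^ (ℓ i + 2)) := by
  have hpow : ∀ e : ℕ, 1 ≤ e → 0 < 1 - q ^ e := fun e he =>
    sub_pos.2 (pow_lt_one₀ h0.le h1 (by omega))
  have hq := h0.ne'
  set v : Fin (m + 2) → ℝ := fun i => q ^ (ℓ i + 2) with hv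
  have hinj : Function.Injective v := fun a b hab => hℓ (by
    have := (pow_right_injective₀ h0 h1.ne) hab
    omega)
  set S := ∑ i, ℓ i with hS
  have hSj : ∀ j, S = ℓ j + ∑ i, (ℓ ∘ j.succAbove) i := fun j => Fin.sum_univ_succAbove ℓ j
  set r := q ^ ε / q * ∏ i, v i with hr
  set K := q ^ k with hK
  have hprod : ∏ i, v i = q ^ (S + 2 * m + 4) := prod_pow_add_two ℓ
  have hr' : r = q ^ (S + 2 * m + 3 + ε) := by
    rw [hr, hprod, div_mul_eq_mul_div, ← pow_add,
      show ε + (S + 2 * m + 4) = S + 2 * m + 3 + ε + 1 by ring, pow_succ _ (_ + ε),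
      mul_div_assoc, div_self hq, mul_one]
  -- Total degrees are used here, so `Z` and the coefficients `c₀`, `c₁`, `c₂` do not depend on the
  -- removed index `j`.
  let Z : ℕ → ℝ := fun i => q ^ (S + 2 * m + 2 + ε + i) / (1 - q ^ (S + 2 * m + 2 + ε + i))
  let c₀ := Z 1 - Z 2 - Z (k + 1) + Z (k + 2)
  let c₁ := Z 2 - Z 1 + Z (k + 2) - Z (k + 3)
  let c₂ := Z (k + 1) - 2 * Z (k + 2) + Z (k + 3)
  have hZ : ∀ {i : ℕ} {x : ℝ}, x = q ^ (S + 2 * m + 2 + ε + i) → Z i = x / (1 - x) := by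
    rintro i x rfl
    rfl
  have z1 : Z 1 = r / (1 - r) := hZ (by rw [hr']; congr 1; omega)
  have z2 : Z 2 = r * q / (1 - r * q) := hZ (by rw [hr']; ring)
  have zk1 : Z (k + 1) = r * K / (1 - r * K) := hZ (by rw [hr']; ring)
  have zk2 : Z (k + 2) = r * q * K / (1 - r * q * K) := hZ (by rw [hr']; ring)
  have zk3 : Z (k + 3) = r * q ^ 2 * K / (1 - r * q ^ 2 * K) := hZ (by rw [hr']; ring)
  have hc₁ : c₁ = -c₀ - c₂ := by
    simp only [c₀, c₁, c₂]
    ring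
  have hc₂ : c₂ = r * K / (1 - r * K) - 2 * (r * q * K / (1 - r * q * K)) +
      r * q ^ 2 * K / (1 - r * q ^ 2 * K) := by
    simp only [c₂, zk1, zk2, zk3]
  have hc₀ : c₀ = r / (1 - r) - r * q / (1 - r * q) - r * K / (1 - r * K) +
      r * q * K / (1 - r * q * K) := by
    simp only [c₀, z1, z2, zk1, zk2]
  have hne : ∀ {x : ℝ} {e : ℕ}, x = q ^ (e + 1) → 1 - x ≠ 0 := by
    rintro x e rfl
    exact (hpow _ (by omega)).ne'
  have d1 : 1 - r ≠ 0 := hne (e := S + 2 * m + 2 + ε) (by rw [hr']; congr 1; omega)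
  have d2 : 1 - r * q ≠ 0 := hne (e := S + 2 * m + 3 + ε) (by rw [hr']; ring)
  have d3 : 1 - r * K ≠ 0 := hne (e := S + 2 * m + 2 + ε + k) (by rw [hr']; ring)
  have d4 : 1 - r * q * K ≠ 0 := hne (e := S + 2 * m + 3 + ε + k) (by rw [hr']; ring)
  have d5 : 1 - r * q ^ 2 * K ≠ 0 := hne (e := S + 2 * m + 4 + ε + k) (by rw [hr']; ring)
  have hrpos : 0 < r := by rw [hr']; positivity
  have hKpos : 0 < K := by positivity
  have hQ : 0 < r * q * K := by positivity
  have hQv : ∀ i, v i ≠ r * q * K := fun i hi => by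
    have e : q ^ (ℓ i + 2) = q ^ (S + 2 * m + 4 + ε + k) := by
      rw [hv] at hi
      refine hi.trans ?_
      rw [hr', hK]
      ring
    have h2 := (pow_right_injective₀ h0 h1.ne) e
    have := hSj i
    omega
  have hterm : ∀ j : Fin (m + 2), HasSum (fun x : (ℕ × ℕ) × MonoSeq m => (-1) ^ (j : ℕ) *
      (((q ^ (x.1.1 + 1)) ^ (ℓ j + 1) * (q ^ (x.1.1 + 1) * q ^ (x.1.2 + 1)) ^
          (2 * m + 1 + ∑ i, (ℓ ∘ j.succAbove) i + ε) * (1 - q ^ (x.1.1 + 1)) *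
        detThree k 1 (q ^ (x.1.1 + 1)) (q ^ (x.1.1 + 1) * q ^ (x.1.2 + 1))) *
          chainWeight ε (ℓ ∘ j.succAbove) (chainSeq q x.2)))
      ((q ^ ε / q - q ^ ε) ^ m * (∏ i, endFactor q ε (v i))⁻¹ * vdm v *
        (((1 - v j) * (1 - q ^ ε * (q ^ ε / q) * v j)) *
          ((r * (c₂ * q * K + c₁ * q + c₀) * v j +
            -(r ^ 2 * q * (c₂ * K * (q + 1) + c₁ * (1 + q * K) + c₀ * (1 + K)))) /
            (v j * (v j - r * q * K))) *
          ∏ i, ((1 - v (j.succAbove i) * v j) / (v (j.succAbove i) - v j)))) := by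
    intro j
    set A := 2 * m + 1 + ∑ i, (ℓ ∘ j.succAbove) i + ε with hA
    have hs := hasSum_detThree h0 h1 k (l := ℓ j) (A := A) (by omega) (Z := Z) (fun i => by
      have : ℓ j + A + 1 + i = S + 2 * m + 2 + ε + i := by
        have := hSj j
        omega
      rw [this])
    have hm := (hasSum_mul_prod hs (hasSum_chainWeight h0 h1 hε (ℓ ∘ j.succAbove)
        (hℓ.comp Fin.succAbove_right_injective))).mul_left ((-1) ^ (j : ℕ))
    have hval := chainValue_succAbove (q := q) (ε := ε) v hinj
      (fun a b => by
        rw [hv, ← pow_add]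
        exact (hpow _ (by omega)).ne')
      (fun a => (endFactor_pos h0 h1 ε (by omega)).ne') j
    convert! hm using 1
    have e1 : (chainValue q ε fun i => q ^ ((ℓ ∘ j.succAbove) i + 2)) =
      chainValue q ε (v ∘ j.succAbove) := rfl
    rw [e1, mul_left_comm ((-1 : ℝ) ^ (j : ℕ)), hval]
    have hV : ∏ i, v (j.succAbove i) = q ^ (∑ i, (ℓ ∘ j.succAbove) i + 2 * m + 2) :=
      prod_pow_add_two (ℓ ∘ j.succAbove)
    have hα : q ^ ε * ∏ i, v (j.succAbove i) = q * q ^ A := by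
      rw [hV, ← pow_add, ← pow_succ']
      congr 1
      omega
    have hβ : q ^ ε / q * ∏ i, v (j.succAbove i) = q ^ A := by
      rw [div_mul_eq_mul_div, hα, mul_div_assoc, mul_comm q, div_mul_cancel₀ _ hq]
    have hvj : v j ≠ 0 := (pow_pos h0 _).ne'
    have hX : q ^ A = r / v j := by
      rw [eq_div_iff hvj, hr', hv, ← pow_add]
      congr 1
      have := hSj j
      omega
    have hpf := partial_fraction (q := q) (K := K) hvj hX (hne (e := A - 1) (by congr 1; omega))
      (hne (e := A) (by ring)) (hne (e := A + k) (by rw [hK]; ring)) hc₁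
    rw [← hpf, endFactor_eq h0 hε (v j), show endFactor q ε (∏ i, v (j.succAbove i)) =
      (1 - q * q ^ A) * (1 - q ^ A) by rw [endFactor, hα, hβ],
      show q ^ (A + k + 1) = q * K * q ^ A by rw [hK]; ring, pow_succ' q A]
    ring
  have hall := hasSum_sum fun j (_ : j ∈ Finset.univ) => hterm j
  rw [← Finset.mul_sum, sum_removal_node (v := v) (fun i => pow_pos h0 _)
    (fun i => pow_lt_one₀ h0.le h1 (by omega)) hinj hQ hQv
    (cancel_of_zero hq hrpos.ne' hKpos.ne' d1 d2 d3 d4 d5 (by positivity) hc₁ hc₂ hc₀ (by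
      rcases hε with rfl | rfl
      · left
        refine ⟨?_, by simp⟩
        rw [hr, pow_zero]
        field_simp
      · right
        refine ⟨?_, by rw [pow_one, div_self hq, mul_one]⟩
        rw [hr, pow_one, div_self hq, one_mul]) rfl rfl), mul_div_assoc (_ / _),
    node_value hq hrpos.ne' hKpos.ne' _ d3 d4 d5 (by positivity) hc₁ hc₂] at hall
  rw [← ((monoSeqEquiv (m + 1)).trans ((Equiv.prodCongr (Equiv.refl ℕ) (monoSeqEquiv m)).trans
    (Equiv.prodAssoc ℕ ℕ (MonoSeq m)).symm)).symm.hasSum_iff]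
  convert! hall using 1
  funext x
  obtain ⟨⟨s, u⟩, y⟩ := x
  have e : (((monoSeqEquiv (m + 1)).trans ((Equiv.prodCongr (Equiv.refl ℕ) (monoSeqEquiv m)).trans
    (Equiv.prodAssoc ℕ ℕ (MonoSeq m)).symm)).symm ((s, u), y)) =
    (monoSeqEquiv (m + 1)).symm (s, (monoSeqEquiv m).symm (u, y)) := rfl
  rw [Function.comp_apply, e, chainSeq_symm, chainSeq_symm]
  have e2 : (Fin.cons 1 fun i => q ^ (s + 1) * (Fin.cons 1 fun i => q ^ (u + 1) * chainSeq q y i :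
      Fin (m + 2) → ℝ) i : Fin (m + 3) → ℝ) =
      Fin.cons 1 (Fin.cons (q ^ (s + 1)) fun i => q ^ (s + 1) * q ^ (u + 1) * chainSeq q y i) := by
    congr 1
    funext i
    induction i using Fin.cases with
    | zero => simp
    | succ i => simp [mul_assoc]
  rw [e2, swivelWeight_cons _ _ _ _ _ _ rfl]

theorem hasSum_swivelWeight' (h0 : 0 < q) (h1 : q < 1) {ε : ℕ} (hε : ε = 0 ∨ ε = 1) {k : ℕ}
    (ℓ : Fin (m + 2) → ℕ) (hℓ : Function.Injective ℓ) :
    HasSum (fun y : MonoSeq (m + 3) => swivelWeight ε k ℓ fun i => q ^ (y.1 i + i))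
      ((1 - q ^ (∑ i, ℓ i + 2 * m + 6 + ε + k))⁻¹ * swivelValue q ε k fun i => q ^ (ℓ i + 2)) := by
  have hg := hasSum_geometric_of_lt_one (pow_nonneg h0.le (∑ i, ℓ i + 2 * m + 6 + ε + k))
    (pow_lt_one₀ h0.le h1 (by omega))
  rw [← (monoSeqEquiv (m + 2)).symm.hasSum_iff]
  convert! hasSum_mul_prod hg (hasSum_swivelWeight h0 h1 hε ℓ hℓ) using 1
  funext x
  obtain ⟨s, y⟩ := x
  rw [Function.comp_apply, ← pow_mul, mul_comm _ s, pow_mul, ← swivelWeight_smul]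
  congr 1
  funext i
  induction i using Fin.cases with
  | zero => simp [monoSeqEquiv, chainSeq]
  | succ i =>
    simp only [monoSeqEquiv, chainSeq, Equiv.coe_fn_symm_mk, Fin.cons_succ, Fin.val_succ, ← pow_add]
    congr 1
    ring

end SwivelSum

/-! ### The weights of the blocks -/

section SwivelBlocks

variable {q : ℝ}

/-- The free parameter `e` converts the numbering of the rows of a block from `0` into the index
along the whole diagonal, so that all blocks are expressed in the variables `q ^ (y i + i)`. -/
theorem blockValue_one (h0 : 0 < q) (ε s : ℕ) (Y : ℕ → ℕ) (e : ℕ) :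
    blockValue q ⟨Pi.single 0 ε, 1, s⟩ Y = (q ^ (e * ε) * qPoch q ε)⁻¹ * (q ^ (Y 0 + e)) ^ ε := by
  simp only [blockValue, fillConst, Block.offLen, Matrix.det_fin_one, Finset.sum_range_one,
    Finset.prod_range_one, Matrix.of_apply]
  simp
  have := h0.ne'
  rw [pow_add, mul_pow, ← pow_mul, ← pow_mul, mul_comm e]
  field_simp

theorem blockValue_two (h0 : 0 < q) (s : ℕ) (Y : ℕ → ℕ) (e : ℕ) :
    blockValue q ⟨0, 2, s⟩ Y =
      (q ^ e * (1 - q))⁻¹ * (q ^ (Y 0 + e) - q ^ (Y 1 + (e + 1))) := by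
  have h := h0.ne'
  simp only [blockValue, fillConst, Block.offLen, Matrix.det_fin_two, Finset.sum_range_succ,
    Finset.prod_range_succ, Matrix.of_apply, qPoch]
  simp
  rw [mul_assoc]
  congr 1
  rw [pow_add q (Y 0), pow_add, pow_add, pow_add]
  field_simp

theorem blockValue_three (k s : ℕ) (hk : 1 ≤ k) (Y : ℕ → ℕ) :
    blockValue q ⟨Pi.single 0 (k - 1), 3, s⟩ Y =
      (q * (qPoch q (k + 1) * (1 - q)))⁻¹ *
        detThree k (q ^ (Y 0 + 0)) (q ^ (Y 1 + 1)) (q ^ (Y 2 + 2)) := by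
  have hk1 : k - 1 + 2 = k + 1 := by omega
  simp only [blockValue, fillConst, Block.offLen, Matrix.det_fin_three, Finset.sum_range_succ,
    Finset.prod_range_succ, Matrix.of_apply]
  simp [hk1, detThree]
  simp only [qPoch, Finset.prod_range_one, Finset.prod_range_zero]
  simp only [← pow_mul]
  ring

theorem blockValue_main (h0 : 0 < q) (lam : ℕ → ℕ) (n s : ℕ) (Y : ℕ → ℕ) :
    blockValue q ⟨lam, n, s⟩ Y =
      (q ^ (∑ i : Fin n, (lam i + (n - 1 - i))) *
        fillConst q (fun r => lam r + (n - 1 - r)) n)⁻¹ *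
        Matrix.det (Matrix.of fun i j : Fin n => (q ^ (Y i + (i + 1))) ^ (lam j + (n - 1 - j))) := by
  have hm : (Matrix.of fun i j : Fin n => (q ^ (Y i + (i + 1))) ^ (lam j + (n - 1 - j))) =
      Matrix.of fun i j : Fin n => q ^ (lam j + (n - 1 - j)) *
        (Matrix.of fun i j : Fin n => q ^ ((Y i + i) * (lam j + (n - 1 - j)))) i j := by
    ext i j
    simp only [Matrix.of_apply]
    ring
  have := h0.ne'
  rw [hm, Matrix.det_mul_row, Finset.prod_pow_eq_pow_sum, mul_inv]
  simp only [blockValue]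
  field_simp
  rfl

/-- The constant factor in the weights of the diagonals of a swivel shifted. -/
noncomputable def swivelConst (q : ℝ) (m k ε : ℕ) (lam : ℕ → ℕ) : ℝ :=
  q ^ (∑ i : Fin (m + 3), (i : ℕ)) *
    (q ^ (∑ i : Fin (m + 2), (lam i + (m + 1 - i))) *
      fillConst q (fun r => lam r + (m + 1 - r)) (m + 2)) * (q * (qPoch q (k + 1) * (1 - q))) *
    (1 - q) * (q ^ ((m + 2) * ε) * qPoch q ε) * ∏ i : Fin m, (q ^ ((i : ℕ) + 2) * (1 - q))

theorem weight_X11 (h0 : 0 < q) {m k ε : ℕ} (hk : 1 ≤ k) (lam : ℕ → ℕ) (y : Fin (m + 3) → ℕ) :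
    q ^ (∑ i, y i) * ∏ i, blockValue q (X11 (m + 2) k ε lam i) (fun r => extendSeq y
        (m + 2 + 1 + 1 - (X11 (m + 2) k ε lam i).start - (X11 (m + 2) k ε lam i).size + r)) =
      (swivelConst q m k ε lam)⁻¹ *
        swivelWeight ε k (fun i : Fin (m + 2) => lam i + (m + 1 - i)) fun i => q ^ (y i + i) := by
  have hq := h0.ne'
  have hsum : q ^ (∑ i, y i) = (q ^ (∑ i : Fin (m + 3), (i : ℕ)))⁻¹ * ∏ i, q ^ (y i + i) := by
    rw [Finset.prod_pow_eq_pow_sum, Finset.sum_add_distrib, pow_add]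
    field_simp
  have hext : ∀ j : Fin (m + 3), extendSeq y j = y j := fun j => extendSeq_of_lt y j.2
  have b0 := blockValue_main h0 lam (m + 2) 1 (fun r => extendSeq y (1 + r))
  have b1 := blockValue_three (q := q) k (m + 1) hk (fun r => extendSeq y (0 + r))
  have b2 := blockValue_two h0 (m + 2) (fun r => extendSeq y (0 + r)) 0
  have b3 := blockValue_one h0 ε 1 (fun r => extendSeq y (m + 2 + r)) (m + 2)
  have b4 : ∀ i : Fin m, blockValue q ⟨0, 2, (i.rev : ℕ) + 1⟩ (fun r => extendSeq y (i + 2 + r)) =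
      (q ^ ((i : ℕ) + 2) * (1 - q))⁻¹ * (q ^ (y i.castSucc.succ.succ + (i + 2)) -
        q ^ (y i.succ.succ.succ + (i + 3))) := fun i => by
    rw [← hext, ← hext]
    exact blockValue_two h0 _ (fun r => extendSeq y (i + 2 + r)) (i + 2)
  have hidx : ∀ (i : Fin 4 ⊕ Fin m) (B : Block) (s : ℕ), X11 (m + 2) k ε lam i = B →
      m + 2 + 1 + 1 - B.start - B.size = s →
      blockValue q (X11 (m + 2) k ε lam i) (fun r => extendSeq y (m + 2 + 1 + 1 -
        (X11 (m + 2) k ε lam i).start - (X11 (m + 2) k ε lam i).size + r)) =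
      blockValue q B (fun r => extendSeq y (s + r)) := by
    rintro i B s rfl rfl
    rfl
  have hrev : ∏ i : Fin m, blockValue q (X11 (m + 2) k ε lam (.inr i)) (fun r => extendSeq y
      (m + 2 + 1 + 1 - (X11 (m + 2) k ε lam (.inr i)).start -
        (X11 (m + 2) k ε lam (.inr i)).size + r)) =
      ∏ i : Fin m, ((q ^ ((i : ℕ) + 2) * (1 - q))⁻¹ * (q ^ (y i.castSucc.succ.succ + (i + 2)) -
        q ^ (y i.succ.succ.succ + (i + 3)))) := by
    -- The blocks are numbered from the bottom of the chain, the sequence `y` from its top.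
    rw [← Equiv.prod_comp Fin.revPerm]
    refine Finset.prod_congr rfl fun i _ => ?_
    rw [← b4]
    exact hidx (.inr i.rev) ⟨0, 2, (i.rev : ℕ) + 1⟩ (i + 2) rfl (by
      have := Fin.val_rev i
      dsimp only
      omega)
  have hprod : ∏ i, blockValue q (X11 (m + 2) k ε lam i) (fun r => extendSeq y
        (m + 2 + 1 + 1 - (X11 (m + 2) k ε lam i).start - (X11 (m + 2) k ε lam i).size + r)) =
      blockValue q ⟨lam, m + 2, 1⟩ (fun r => extendSeq y (1 + r)) *
      blockValue q ⟨Pi.single 0 (k - 1), 3, m + 1⟩ (fun r => extendSeq y (0 + r)) *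
      blockValue q ⟨0, 2, m + 2⟩ (fun r => extendSeq y (0 + r)) *
      blockValue q ⟨Pi.single 0 ε, 1, 1⟩ (fun r => extendSeq y (m + 2 + r)) *
      ∏ i : Fin m, ((q ^ ((i : ℕ) + 2) * (1 - q))⁻¹ * (q ^ (y i.castSucc.succ.succ + (i + 2)) -
        q ^ (y i.succ.succ.succ + (i + 3)))) := by
    refine (Fintype.prod_sum_type _).trans ?_
    rw [Fin.prod_univ_four]
    refine congrArg₂ (· * ·) (congrArg₂ (· * ·) (congrArg₂ (· * ·) (congrArg₂ (· * ·) ?_ ?_) ?_) ?_)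
      hrev
    · exact hidx (.inl 0) _ _ rfl (by dsimp only; omega)
    · exact hidx (.inl 1) _ _ rfl (by dsimp only; omega)
    · exact hidx (.inl 2) _ _ rfl (by dsimp only; omega)
    · exact hidx (.inl 3) _ _ rfl (by dsimp only; omega)
  have hdet : (Matrix.of fun i j : Fin (m + 2) =>
      (q ^ (extendSeq y (1 + i) + (i + 1))) ^ (lam j + (m + 2 - 1 - j))) =
      Matrix.of fun i j : Fin (m + 2) => (q ^ (y i.succ + i.succ)) ^ (lam j + (m + 1 - j)) := by
    ext i j
    simp only [Matrix.of_apply]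
    rw [← hext i.succ, Fin.val_succ, add_comm 1 (i : ℕ)]
    rfl
  have y0 : extendSeq y 0 = y 0 := hext 0
  have y1 : extendSeq y 1 = y 1 := hext 1
  have y2 : extendSeq y 2 = y 2 := extendSeq_of_lt y (by omega)
  have yl : extendSeq y (m + 2) = y (Fin.last (m + 2)) := hext (Fin.last (m + 2))
  have v1 : ((1 : Fin (m + 3)) : ℕ) = 1 := rfl
  have v2 : ((2 : Fin (m + 3)) : ℕ) = 2 := rfl
  rw [hprod, hsum, b0, b1, b2, b3, hdet, swivelConst, swivelWeight, Finset.prod_mul_distrib,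
    Finset.prod_inv_distrib]
  simp only [zero_add, add_zero, y0, y1, y2, yl, v1, v2, Fin.val_zero, Fin.val_last, Fin.val_succ,
    Fin.val_castSucc, pow_zero, one_mul, mul_inv, show m + 2 - 1 = m + 1 from rfl]
  ring_nf

theorem hasPartitionSum_swivelPoset (h0 : 0 < q) (h1 : q < 1) {m k ε : ℕ} (hk : 1 ≤ k)
    (hε : ε = 0 ∨ ε = 1) {lam : ℕ → ℕ} (hlam : IsPar (m + 2) lam) :
    HasPartitionSum (PosetP (m + 2 + 1) (X11 (m + 2) k ε lam)) q ((swivelConst q m k ε lam)⁻¹ *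
      ((1 - q ^ (∑ i : Fin (m + 2), (lam i + (m + 1 - i)) + 2 * m + 6 + ε + k))⁻¹ *
        swivelValue q ε k fun i : Fin (m + 2) => q ^ (lam i + (m + 1 - i) + 2))) := by
  have hsingle : ∀ a : ℕ, Antitone (Pi.single 0 a : ℕ → ℕ) := by
    intro a i j hij
    rcases j with _ | j
    · rw [show i = 0 by omega]
    · simp
  refine hasPartitionSum_posetP h0 h1 ?_ ?_
  · rintro (i | i)
    · fin_cases i
      · exact ⟨le_rfl, by simp [X11]; omega, hlam.1⟩
      · exact ⟨by simp [X11], by simp [X11], hsingle _⟩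
      · exact ⟨by simp [X11], by simp [X11], antitone_const⟩
      · exact ⟨le_rfl, by simp [X11], hsingle _⟩
    · have hi : (i : ℕ) < m := i.2
      exact ⟨by simp [X11], by simp [X11]; omega, antitone_const⟩
  · convert! (hasSum_swivelWeight' h0 h1 hε (k := k) (fun i : Fin (m + 2) => lam i + (m + 1 - i))
      fun i j hij => ?_).mul_left (swivelConst q m k ε lam)⁻¹ using 1
    · funext y
      exact weight_X11 h0 hk lam y.1
    · rcases lt_trichotomy i j with h | h | h
      · have h2 : (i : ℕ) < j := h
        have := hlam.1 h2.le
        dsimp only at hij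
        omega
      · exact h
      · have h2 : (j : ℕ) < i := h
        have := hlam.1 h2.le
        dsimp only at hij
        omega

theorem card_swivelPoset {m k ε : ℕ} (hk : 1 ≤ k) (lam : ℕ → ℕ) :
    Fintype.card (PosetP (m + 2 + 1) (X11 (m + 2) k ε lam)) =
      ∑ i : Fin (m + 2), (lam i + (m + 1 - i)) + 2 * m + 6 + ε + k := by
  have hcard : ∀ B : Block, Fintype.card B.OffCell = ∑ r ∈ Finset.range B.size, B.offLen r := by
    intro B
    have := sum_offCell B fun _ _ => 1
    simpa using this
  have h : Fintype.card (PosetP (m + 2 + 1) (X11 (m + 2) k ε lam)) =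
      (m + 3) + ∑ i : Fin 4 ⊕ Fin m, Fintype.card (X11 (m + 2) k ε lam i).OffCell := by
    refine (Fintype.card_sum).trans (congrArg₂ (· + ·) (by simp) ?_)
    exact Fintype.card_sigma
  rw [h, Fintype.sum_sum_type, Fin.sum_univ_four]
  simp only [hcard]
  have e0 : ∑ r ∈ Finset.range (X11 (m + 2) k ε lam (.inl 0)).size,
      (X11 (m + 2) k ε lam (.inl 0)).offLen r = ∑ i : Fin (m + 2), (lam i + (m + 1 - i)) :=
    Finset.sum_range fun r => lam r + (m + 1 - r)
  have e1 : ∑ r ∈ Finset.range (X11 (m + 2) k ε lam (.inl 1)).size,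
      (X11 (m + 2) k ε lam (.inl 1)).offLen r = k + 2 := by
    simp [X11, Block.offLen, Finset.sum_range_succ]
    omega
  have e2 : ∑ r ∈ Finset.range (X11 (m + 2) k ε lam (.inl 2)).size,
      (X11 (m + 2) k ε lam (.inl 2)).offLen r = 1 := by
    simp [X11, Block.offLen, Finset.sum_range_succ]
  have e3 : ∑ r ∈ Finset.range (X11 (m + 2) k ε lam (.inl 3)).size,
      (X11 (m + 2) k ε lam (.inl 3)).offLen r = ε := by
    simp [X11, Block.offLen]
  have e4 : ∀ i : Fin m, ∑ r ∈ Finset.range (X11 (m + 2) k ε lam (.inr i)).size,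
      (X11 (m + 2) k ε lam (.inr i)).offLen r = 1 := by
    intro i
    simp [X11, Block.offLen, Finset.sum_range_succ]
  rw [e0, e1, e2, e3, Finset.sum_congr rfl fun i _ => e4 i]
  simp
  ring

theorem HasPartitionSum.chain_zero {Q : Type} [PartialOrder Q] [Fintype Q] {a : ℝ}
    (h : HasPartitionSum Q q a) : HasPartitionSum (Q ⊕ₗ Fin 0) q a := by
  let e : {σ : Q → ℕ // Antitone σ} ≃ {σ : Q ⊕ₗ Fin 0 → ℕ // Antitone σ} :=
    { toFun := fun σ => ⟨fun x => Sum.elim σ.1 Fin.elim0 (ofLex x), antitone_sumLex_iff.2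
        ⟨σ.2, fun i => i.elim0, fun _ i => i.elim0⟩⟩
      invFun := fun σ => ⟨fun a => σ.1 (toLex (.inl a)), (antitone_sumLex_iff.1 σ.2).1⟩
      left_inv := fun σ => rfl
      right_inv := fun σ => by
        refine Subtype.ext (funext fun x => ?_)
        obtain ⟨x, rfl⟩ := toLex.surjective x
        rcases x with x | x
        · rfl
        · exact x.elim0 }
  rw [HasPartitionSum, ← e.hasSum_iff]
  have hf : ((fun σ : {σ : Q ⊕ₗ Fin 0 → ℕ // Antitone σ} => q ^ ∑ x, σ.1 x) ∘ e) =
      fun σ => q ^ ∑ x, σ.1 x := by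
    funext σ
    rw [Function.comp_apply, sum_sumLex]
    simp [e]
    rfl
  rw [hf]
  exact h

theorem HasPartitionSum.chain {Q : Type} [PartialOrder Q] [Fintype Q] {a : ℝ} (h0 : 0 < q)
    (h1 : q < 1) (h : HasPartitionSum Q q a) (M : ℕ) : HasPartitionSum (Q ⊕ₗ Fin M) q
      ((∏ i ∈ Finset.range M, (1 - q ^ (Fintype.card Q + i + 1)))⁻¹ * a) := by
  induction M with
  | zero => simpa using h.chain_zero
  | succ M ih =>
    rw [Finset.prod_range_succ, mul_comm (Finset.prod _ _), mul_inv, mul_assoc]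
    exact ih.chain_succ h0 h1

end SwivelBlocks

/-! ### Products over all positions -/

section HookProduct

theorem prod_offCell (B : Block) (f : ℕ → ℕ → ℝ) :
    ∏ c : B.OffCell, f c.pos.1 c.pos.2 = ∏ r ∈ Finset.range B.size,
      ∏ c ∈ Finset.Ioo r (r + (B.part r + staircase (B.size + 1) r)), f r c := by
  rw [Finset.prod_range, Fintype.prod_sigma]
  refine Finset.prod_congr rfl fun r _ => ?_
  exact Finset.prod_coe_sort _ fun c => f r c

/-- Each row `0, …, n - 1` is taken together with its diagonal and subdiagonal cell. The index `c`
is the column plus one, so that column `-1` of row `0` fits into a range of natural numbers. -/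
theorem prod_plane {m k ε : ℕ} (hk : 1 ≤ k) (lam : ℕ → ℕ) (F : ℤ × ℤ → ℝ) :
    ∏ x, F (plane (m + 2) k ε lam x) =
      (∏ r ∈ Finset.range (m + 2), ∏ c ∈ Finset.Ico r (lam r + m + 3), F (r, (c : ℤ) - 1)) *
        (F (-1, 0) * (∏ i ∈ Finset.range (k - 1), F ((m : ℤ) + 3 + i, -1)) *
          ∏ _i ∈ Finset.range ε, F ((m : ℤ) + 2, (m : ℤ) + 1)) *
        (F (1, -1) * F (-1, -1) *
          ∏ j ∈ Finset.range (lam 0 + (m + 2) - 1), F (-2 - (j : ℤ), -2 - (j : ℤ))) := by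
  have hchain : ∏ j : Fin (lam 0 + (m + 2) - 1), F (plane (m + 2) k ε lam (toLex (Sum.inr j))) =
      ∏ j ∈ Finset.range (lam 0 + (m + 2) - 1), F (-2 - (j : ℤ), -2 - (j : ℤ)) := by
    rw [Finset.prod_range]
    rfl
  have hdiag : ∏ a : Finset.Icc 1 (m + 2 + 1),
      F (plane (m + 2) k ε lam (toLex (Sum.inl (PosetP.diag _ a)))) =
      (∏ r ∈ Finset.range (m + 2), F ((r : ℤ), (r : ℤ))) * F (-1, -1) := by
    have h1 : ∏ a : Finset.Icc 1 (m + 2 + 1),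
        F (plane (m + 2) k ε lam (toLex (Sum.inl (PosetP.diag _ a)))) =
        ∏ a ∈ Finset.Icc 1 (m + 2 + 1), F (((m + 2 : ℕ) : ℤ) - a, ((m + 2 : ℕ) : ℤ) - a) :=
      Finset.prod_coe_sort _ fun a : ℕ => F (((m + 2 : ℕ) : ℤ) - a, ((m + 2 : ℕ) : ℤ) - a)
    have h2 : Finset.Icc 1 (m + 2 + 1) = Finset.Ico 1 (m + 2 + 2) := by ext; simp; omega
    rw [h1, h2, Finset.prod_Ico_eq_prod_range, ← Finset.prod_range_reflect,
      show m + 2 + 2 - 1 = m + 2 + 1 from rfl, Finset.prod_range_succ', mul_comm, mul_comm]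
    refine congrArg₂ (· * ·) (Finset.prod_congr rfl fun r hr => ?_) ?_
    · have hr := Finset.mem_range.1 hr
      rw [show (((m + 2 : ℕ) : ℤ) - ((1 + (m + 2 + 1 - 1 - (r + 1)) : ℕ) : ℤ)) = r by omega]
    · rw [show (((m + 2 : ℕ) : ℤ) - ((1 + (m + 2 + 1 - 1 - 0) : ℕ) : ℤ)) = -1 by omega]
  have hcell : ∏ c : Σ i, (X11 (m + 2) k ε lam i).OffCell,
      F (plane (m + 2) k ε lam (toLex (Sum.inl (PosetP.cell (m + 2 + 1) c.1 c.2)))) =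
      (∏ r ∈ Finset.range (m + 2), F (r, (r : ℤ) - 1)) * F (1, -1) *
      (∏ r ∈ Finset.range (m + 2), ∏ c ∈ Finset.Ioo r (lam r + m + 2), F (r, (c : ℤ))) *
        (F (-1, 0) * (∏ i ∈ Finset.range (k - 1), F ((m : ℤ) + 3 + i, -1)) *
          ∏ _i ∈ Finset.range ε, F ((m : ℤ) + 2, (m : ℤ) + 1)) := by
    have hB : ∀ i, ∏ c : (X11 (m + 2) k ε lam i).OffCell,
        F (plane (m + 2) k ε lam (toLex (Sum.inl (PosetP.cell (m + 2 + 1) i c)))) = 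
        ∏ r ∈ Finset.range (X11 (m + 2) k ε lam i).size,
      ∏ c ∈ Finset.Ioo r (r + ((X11 (m + 2) k ε lam i).part r +
        staircase ((X11 (m + 2) k ε lam i).size + 1) r)), F (cellPlane (m + 2) i (r, c)) := fun i =>
      prod_offCell (X11 (m + 2) k ε lam i) fun r c => F (cellPlane (m + 2) i (r, c))
    rw [Fintype.prod_sigma]
    rw [Finset.prod_congr rfl fun i _ => hB i, Fintype.prod_sum_type]
    have e0 : ∏ r ∈ Finset.range (m + 2), ∏ c ∈ Finset.Ioo r (r + (lam r +
        staircase (m + 2 + 1) r)), F (cellPlane (m + 2) (.inl 0) (r, c)) =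
        ∏ r ∈ Finset.range (m + 2), ∏ c ∈ Finset.Ioo r (lam r + m + 2), F (r, (c : ℤ)) := by
      refine Finset.prod_congr rfl fun r hr => ?_
      have hr := Finset.mem_range.1 hr
      rw [show r + (lam r + staircase (m + 2 + 1) r) = lam r + m + 2 by unfold staircase; omega]
      rfl
    have e1 : ∏ r ∈ Finset.range 3, ∏ c ∈ Finset.Ioo r (r + ((Pi.single 0 (k - 1) : ℕ → ℕ) r +
        staircase (3 + 1) r)), F (cellPlane (m + 2) (.inl 1) (r, c)) =
        F (1, 0) * F (0, -1) * F (1, -1) * ∏ i ∈ Finset.range (k - 1), F ((m : ℤ) + 3 + i, -1) := by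
      have hI : Finset.Ioo 0 (0 + (k - 1 + 3)) = Finset.Ico 1 (k + 2) := by ext; simp; omega
      simp only [Finset.prod_range_succ, Finset.prod_range_zero, staircase]
      simp only [Pi.single_eq_same, hI]
      rw [Finset.prod_eq_prod_Ico_succ_bot (by omega), Finset.prod_eq_prod_Ico_succ_bot (by omega),
        Finset.prod_Ico_eq_prod_range, show k + 2 - (1 + 1 + 1) = k - 1 by omega]
      have : ∏ i ∈ Finset.range (k - 1), F (cellPlane (m + 2) (.inl 1) (0, 1 + 1 + 1 + i)) =
          ∏ i ∈ Finset.range (k - 1), F ((m : ℤ) + 3 + i, -1) := by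
        refine Finset.prod_congr rfl fun i _ => ?_
        simp only [cellPlane]
        rw [if_neg (by omega), if_neg (by omega), if_neg (by omega)]
        congr 2
        push_cast
        ring
      rw [this]
      simp [cellPlane, show Finset.Ioo 1 3 = {2} from rfl, show Finset.Ioo 2 3 = ∅ from rfl]
      ring
    have e2 : ∏ r ∈ Finset.range 2, ∏ c ∈ Finset.Ioo r (r + ((0 : ℕ → ℕ) r +
        staircase (2 + 1) r)), F (cellPlane (m + 2) (.inl 2) (r, c)) = F (-1, 0) := by
      simp [Finset.prod_range_succ, staircase, cellPlane]
    have e3 : ∏ r ∈ Finset.range 1, ∏ c ∈ Finset.Ioo r (r + ((Pi.single 0 ε : ℕ → ℕ) r +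
        staircase (1 + 1) r)), F (cellPlane (m + 2) (.inl 3) (r, c)) =
        ∏ _i ∈ Finset.range ε, F ((m : ℤ) + 2, (m : ℤ) + 1) := by
      simp [staircase, cellPlane]
      congr 3
      ring
    have e4 : ∀ i : Fin m, ∏ r ∈ Finset.range 2, ∏ c ∈ Finset.Ioo r (r + ((0 : ℕ → ℕ) r +
        staircase (2 + 1) r)), F (cellPlane (m + 2) (.inr i) (r, c)) =
        F ((m : ℤ) + 1 - i, (m : ℤ) - i) := by
      intro i
      simp [Finset.prod_range_succ, staircase, cellPlane]
      congr 2 <;> ring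
    have e5 : ∏ i : Fin m, F ((m : ℤ) + 1 - (i : ℕ), (m : ℤ) - (i : ℕ)) =
        ∏ r ∈ Finset.range m, F (((r + 1 + 1 : ℕ) : ℤ), ((r + 1 + 1 : ℕ) : ℤ) - 1) := by
      rw [← Finset.prod_range fun i : ℕ => F ((m : ℤ) + 1 - i, (m : ℤ) - i),
        ← Finset.prod_range_reflect]
      refine Finset.prod_congr rfl fun r hr => ?_
      have hr := Finset.mem_range.1 hr
      rw [show (m : ℤ) + 1 - ((m - 1 - r : ℕ) : ℤ) = ((r + 1 + 1 : ℕ) : ℤ) by omega,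
        show (m : ℤ) - ((m - 1 - r : ℕ) : ℤ) = ((r + 1 + 1 : ℕ) : ℤ) - 1 by omega]
    refine (congrArg₂ (· * ·) (Fin.prod_univ_four _) rfl).trans ?_
    rw [Finset.prod_range_succ', Finset.prod_range_succ', ← e5, ← Finset.prod_congr rfl fun i _ => e4 i]
    refine (congrArg₂ (· * ·) (congrArg₂ (· * ·) (congrArg₂ (· * ·) (congrArg₂ (· * ·) e0 e1) e2)
      e3) rfl).trans ?_
    simp only [Nat.cast_zero, zero_add, Nat.cast_one, zero_sub, sub_self]
    refine (mul_comm _ _).trans ?_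
    generalize (∏ r ∈ Finset.range (m + 2), ∏ c ∈ Finset.Ioo r (lam r + m + 2), F (r, (c : ℤ))) = A
    simp only [mul_assoc]
    refine congrArg₂ (· * ·) rfl ?_
    ring
  have hall : ∏ x, F (plane (m + 2) k ε lam x) =
      ((∏ a : Finset.Icc 1 (m + 2 + 1),
        F (plane (m + 2) k ε lam (toLex (Sum.inl (PosetP.diag _ a))))) *
       ∏ c : Σ i, (X11 (m + 2) k ε lam i).OffCell,
        F (plane (m + 2) k ε lam (toLex (Sum.inl (PosetP.cell (m + 2 + 1) c.1 c.2))))) *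
      ∏ j : Fin (lam 0 + (m + 2) - 1), F (plane (m + 2) k ε lam (toLex (Sum.inr j))) := by
    rw [← toLex.prod_comp]
    refine (Fintype.prod_sum_type _).trans (congrArg (· * _) ?_)
    exact Fintype.prod_sum_type _
  have hrow : ∀ r ∈ Finset.range (m + 2),
      ∏ c ∈ Finset.Ico r (lam r + m + 3), F (r, (c : ℤ) - 1) =
      F (r, (r : ℤ) - 1) * F ((r : ℤ), (r : ℤ)) *
        ∏ c ∈ Finset.Ioo r (lam r + m + 2), F (r, (c : ℤ)) := by
    intro r hr
    have hr := Finset.mem_range.1 hr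
    rw [Finset.prod_eq_prod_Ico_succ_bot (by omega), Finset.prod_eq_prod_Ico_succ_bot (by omega),
      ← Finset.prod_Ico_add' _ (r + 1) (lam r + m + 2) 1, ← mul_assoc]
    congr 1
    · simp
    · refine Finset.prod_congr (by ext; simp) fun c _ => ?_
      simp
  rw [hall, hchain, hdiag, hcell, Finset.prod_congr rfl hrow, Finset.prod_mul_distrib,
    Finset.prod_mul_distrib]
  ring

end HookProduct

/-! ### Hook products of the rows and of the top -/

section HookRows

variable {m : ℕ} {lam : ℕ → ℕ}

/-- The exponent `(λ + δ)_r` of a partition with at most `m + 2` parts. -/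
def shiftedPart (m : ℕ) (lam : ℕ → ℕ) (r : ℕ) : ℕ := lam r + (m + 1 - r)

/-- The number of the column `c ≥ m + 2`, minus its length. -/
def columnGap (m : ℕ) (lam : ℕ → ℕ) (c : ℕ) : ℕ :=
  c - ((Finset.range (m + 2)).filter fun s => c < lam s + (m + 2)).card

theorem card_column_le (c : ℕ) :
    ((Finset.range (m + 2)).filter fun s => c < lam s + (m + 2)).card ≤ m + 2 :=
  (Finset.card_filter_le _ _).trans (Finset.card_range _).le

theorem shiftedPart_lt (hlam : Antitone lam) {r s : ℕ} (hrs : r < s) (hs : s < m + 2) :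
    shiftedPart m lam s < shiftedPart m lam r := by
  have := hlam hrs.le
  unfold shiftedPart
  omega

theorem columnGap_lt (hlam : Antitone lam) {c s : ℕ} (hs : s < m + 2) (hc : m + 2 ≤ c)
    (h : c < lam s + (m + 2)) : columnGap m lam c < shiftedPart m lam s := by
  have h1 : Finset.range (s + 1) ⊆
      (Finset.range (m + 2)).filter fun s => c < lam s + (m + 2) := fun t ht => by
    have ht := Finset.mem_range.1 ht
    have := hlam (show t ≤ s by omega)
    exact Finset.mem_filter.2 ⟨Finset.mem_range.2 (by omega), by omega⟩
  have h2 := Finset.card_le_card h1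
  rw [Finset.card_range] at h2
  unfold columnGap shiftedPart
  omega

theorem lt_columnGap (hlam : Antitone lam) {c s : ℕ} (hs : s < m + 2) (h : lam s + (m + 2) ≤ c) :
    shiftedPart m lam s < columnGap m lam c := by
  have h1 : ((Finset.range (m + 2)).filter fun s => c < lam s + (m + 2)) ⊆ Finset.range s :=
    fun t ht => by
      have ht := (Finset.mem_filter.1 ht).2
      by_contra hts
      have := hlam (show s ≤ t by simpa using hts)
      omega
  have h2 := Finset.card_le_card h1
  rw [Finset.card_range] at h2
  unfold columnGap shiftedPart
  omega

theorem columnGap_strictMono {c d : ℕ} (hc : m + 2 ≤ c) (hcd : c < d) :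
    columnGap m lam c < columnGap m lam d := by
  have h1 : ((Finset.range (m + 2)).filter fun s => d < lam s + (m + 2)) ⊆
      (Finset.range (m + 2)).filter fun s => c < lam s + (m + 2) :=
    Finset.monotone_filter_right _ fun s _ hs => hcd.trans hs
  have h2 := Finset.card_le_card h1
  have h3 := card_column_le (m := m) (lam := lam) c
  unfold columnGap
  omega

/-- The numbers `shiftedPart s` of the rows below `r` and the gaps of the columns that row `r`
reaches are distinct and less than `shiftedPart r`. There are `m + 1 - r` of the former and `lam r`
of the latter, so together they exhaust the interval. -/
theorem prod_shiftedPart_mul_prod_columnGap (hlam : Antitone lam) {r : ℕ} (hr : r < m + 2)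
    (f : ℕ → ℝ) :
    (∏ s ∈ Finset.Ioo r (m + 2), f (shiftedPart m lam s)) *
        ∏ c ∈ Finset.Ico (m + 2) (lam r + (m + 2)), f (columnGap m lam c) =
      ∏ i ∈ Finset.range (shiftedPart m lam r), f i := by
  have inj1 : Set.InjOn (shiftedPart m lam) (Finset.Ioo r (m + 2)) := fun s hs t ht hst => by
    have hs := Finset.mem_Ioo.1 hs
    have ht := Finset.mem_Ioo.1 ht
    rcases lt_trichotomy s t with h | h | h
    · exact absurd hst (shiftedPart_lt hlam h ht.2).ne'
    · exact h
    · exact absurd hst (shiftedPart_lt hlam h hs.2).ne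
  have inj2 : Set.InjOn (columnGap m lam) (Finset.Ico (m + 2) (lam r + (m + 2))) :=
    fun s hs t ht hst => by
      have hs := Finset.mem_Ico.1 hs
      have ht := Finset.mem_Ico.1 ht
      rcases lt_trichotomy s t with h | h | h
      · exact absurd hst (columnGap_strictMono hs.1 h).ne
      · exact h
      · exact absurd hst (columnGap_strictMono ht.1 h).ne'
  have hdis : Disjoint ((Finset.Ioo r (m + 2)).image (shiftedPart m lam))
      ((Finset.Ico (m + 2) (lam r + (m + 2))).image (columnGap m lam)) := by
    rw [Finset.disjoint_left]
    intro x hx hy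
    obtain ⟨s, hs, rfl⟩ := Finset.mem_image.1 hx
    obtain ⟨c, hc, h⟩ := Finset.mem_image.1 hy
    have hs := Finset.mem_Ioo.1 hs
    rcases lt_or_ge c (lam s + (m + 2)) with h' | h'
    · exact absurd h (columnGap_lt hlam hs.2 (Finset.mem_Ico.1 hc).1 h').ne
    · exact absurd h (lt_columnGap hlam hs.2 h').ne'
  have heq : ((Finset.Ioo r (m + 2)).image (shiftedPart m lam)) ∪
      ((Finset.Ico (m + 2) (lam r + (m + 2))).image (columnGap m lam)) =
      Finset.range (shiftedPart m lam r) := by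
    refine Finset.eq_of_subset_of_card_le (fun x hx => Finset.mem_range.2 ?_) ?_
    · rcases Finset.mem_union.1 hx with hx | hx
      · obtain ⟨s, hs, rfl⟩ := Finset.mem_image.1 hx
        have hs := Finset.mem_Ioo.1 hs
        exact shiftedPart_lt hlam hs.1 hs.2
      · obtain ⟨c, hc, rfl⟩ := Finset.mem_image.1 hx
        exact columnGap_lt hlam hr (Finset.mem_Ico.1 hc).1 (Finset.mem_Ico.1 hc).2
    · rw [Finset.card_union_of_disjoint hdis, Finset.card_image_of_injOn inj1,
        Finset.card_image_of_injOn inj2, Finset.card_range, Nat.card_Ioo, Nat.card_Ico]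
      unfold shiftedPart
      omega
  rw [← heq, Finset.prod_union hdis, Finset.prod_image inj1, Finset.prod_image inj2]

variable {k ε : ℕ} {q : ℝ}

theorem rowHook_eq_shiftedPart {r : ℕ} (hr : r < m + 2) :
    rowHook (m + 2) ε lam r = (shiftedPart m lam r + 2 : ℕ) := by
  rw [rowHook_of_lt (by omega) (by omega), Int.toNat_natCast, shiftedPart]
  omega

theorem colHook_eq_columnGap (hm : 1 ≤ m) {c : ℕ} (hc : m + 2 ≤ c) :
    colHook (m + 2) k ε lam c = -(columnGap m lam c + 2 : ℕ) := by
  have h1 : ((Finset.range (m + 2)).filter fun s => (c : ℤ) ≤ (lam s : ℤ) + (m + 2 : ℕ) - 1) =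
      (Finset.range (m + 2)).filter fun s => c < lam s + (m + 2) :=
    Finset.filter_congr fun s _ => by omega
  have h3 := card_column_le (m := m) (lam := lam) c
  rw [colHook_of_ge (by omega) (by omega), h1, columnGap]
  omega

/-- Columns up to `n - 3` pair row `r` with row `c + 2`, the columns `n - 2` and `n - 1` give the
two factors of `endFactor`, and the columns from `n` on give the ordinary hooks of `λ`. -/
theorem prod_row (h0 : 0 < q) (hm : 1 ≤ m) (hlam : Antitone lam) {r a : ℕ} (hr : r < m + 2)
    (ha1 : 1 ≤ a) (ha : a ≤ m + 1) :
    ∏ c ∈ Finset.Ico a (lam r + m + 3), (1 - q ^ planeHook (m + 2) k ε lam r ((c : ℤ) - 1)) =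
      (∏ s ∈ Finset.Ico (a + 1) (m + 2),
        (1 - q ^ (shiftedPart m lam r + 2) * q ^ (shiftedPart m lam s + 2))) *
        endFactor q ε (q ^ (shiftedPart m lam r + 2)) *
        ∏ c ∈ Finset.Ico (m + 2) (lam r + (m + 2)),
          (1 - q ^ (shiftedPart m lam r - columnGap m lam c)) := by
  have hq := h0.ne'
  have hH : ∀ c : ℤ, 0 ≤ c → planeHook (m + 2) k ε lam r c =
      (shiftedPart m lam r + 2 : ℕ) + colHook (m + 2) k ε lam c := fun c hc => by
    rw [planeHook, if_neg (by omega), if_neg (by omega), rowHook_eq_shiftedPart hr]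
  rw [← Finset.prod_Ico_consecutive _ (show a ≤ m + 1 + 1 + 1 by omega)
    (show m + 1 + 1 + 1 ≤ lam r + m + 3 by omega),
    Finset.prod_Ico_succ_top (by omega), Finset.prod_Ico_succ_top (by omega)]
  refine congrArg₂ (· * ·) ?_ ?_
  · rw [mul_assoc]
    refine congrArg₂ (· * ·) ?_ ?_
    · rw [← Finset.prod_Ico_add' _ a (m + 1) 1]
      refine Finset.prod_congr rfl fun c hc => ?_
      have hc := Finset.mem_Ico.1 hc
      rw [hH _ (by omega), colHook_of_le (by omega) (by omega),
        show (c : ℤ) - 1 + 2 = ((c + 1 : ℕ) : ℤ) by push_cast; ring,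
        rowHook_eq_shiftedPart (by omega), ← Nat.cast_add, zpow_natCast, pow_add]
    · rw [hH _ (by omega), hH _ (by omega), colHook_of_le (by omega) (by omega),
        show ((m + 1 : ℕ) : ℤ) - 1 + 2 = ((m + 2 : ℕ) : ℤ) by push_cast; ring, rowHook_self,
        show ((m + 1 + 1 : ℕ) : ℤ) - 1 = ((m + 2 : ℕ) : ℤ) - 1 by push_cast; ring,
        colHook_sub_one (by omega), endFactor, ← Nat.cast_add, zpow_natCast, zpow_add₀ hq,
        zpow_natCast, zpow_sub₀ hq, zpow_natCast, zpow_one]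
      ring
  · rw [show lam r + m + 3 = lam r + (m + 2) + 1 by ring, ← Finset.prod_Ico_add' _ (m + 2) _ 1]
    refine Finset.prod_congr rfl fun c hc => ?_
    have hc := Finset.mem_Ico.1 hc
    have := columnGap_lt hlam hr hc.1 hc.2
    rw [Nat.cast_add, Nat.cast_one, add_sub_cancel_right, hH _ (by omega),
      colHook_eq_columnGap hm hc.1,
      show ((shiftedPart m lam r + 2 : ℕ) : ℤ) + -((columnGap m lam c + 2 : ℕ) : ℤ) =
        ((shiftedPart m lam r - columnGap m lam c : ℕ) : ℤ) by omega, zpow_natCast]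

theorem prod_sub_mul_prod_columnGap (hlam : Antitone lam) {r : ℕ} (hr : r < m + 2) :
    (∏ s ∈ Finset.Ioo r (m + 2), (1 - q ^ (shiftedPart m lam r - shiftedPart m lam s))) *
      ∏ c ∈ Finset.Ico (m + 2) (lam r + (m + 2)),
        (1 - q ^ (shiftedPart m lam r - columnGap m lam c)) = qPoch q (shiftedPart m lam r) := by
  rw [prod_shiftedPart_mul_prod_columnGap hlam hr fun i => 1 - q ^ (shiftedPart m lam r - i),
    qPoch, ← Finset.prod_range_reflect]
  refine Finset.prod_congr rfl fun i hi => ?_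
  have hi := Finset.mem_range.1 hi
  rw [show shiftedPart m lam r - (shiftedPart m lam r - 1 - i) = i + 1 by omega]

/-- The hook length of the diagonal element in row `r < 0` is this number minus the contribution of
the column `-1 - r`. -/
def topExp (m k ε : ℕ) (lam : ℕ → ℕ) : ℕ :=
  ∑ i ∈ Finset.range (m + 2), shiftedPart m lam i + 2 * m + 4 + ε + k

theorem topExp_eq : (k : ℤ) + shiftedSize (m + 2) ε lam = (topExp m k ε lam : ℕ) := by
  have : ∑ s ∈ Finset.range (m + 2), ((lam s : ℤ) + (m + 2 : ℕ) + 1 - s) =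
      ∑ s ∈ Finset.range (m + 2), ((shiftedPart m lam s : ℤ) + 2) := by
    refine Finset.sum_congr rfl fun s hs => ?_
    have hs := Finset.mem_range.1 hs
    unfold shiftedPart
    omega
  rw [shiftedSize, this, topExp, Finset.sum_add_distrib]
  push_cast
  simp
  ring

/-- The cells `(0, -1)` and `(1, -1)` supply the factors for rows `1` and `0`, which the diagonal
cells lack: the diagonal cell `(-1 - c, -1 - c)` belongs to column `c`, hence for small `c` to row
`c + 2`. -/
theorem prod_top (h0 : 0 < q) (hm : 1 ≤ m) :
    (1 - q ^ planeHook (m + 2) k ε lam 0 (-1)) * ((1 - q ^ planeHook (m + 2) k ε lam 1 (-1)) *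
      (1 - q ^ planeHook (m + 2) k ε lam (-1) (-1)) *
      ∏ j ∈ Finset.range (lam 0 + (m + 2) - 1),
        (1 - q ^ planeHook (m + 2) k ε lam (-2 - (j : ℤ)) (-2 - (j : ℤ)))) =
      (∏ s ∈ Finset.range (m + 2),
        (1 - q ^ topExp m k ε lam / q ^ (shiftedPart m lam s + 2))) *
      ((1 - q ^ topExp m k ε lam / q ^ ε) * (1 - q ^ topExp m k ε lam * q / q ^ ε)) *
      ∏ c ∈ Finset.Ico (m + 2) (lam 0 + (m + 2)),
        (1 - q ^ (topExp m k ε lam + 2 + columnGap m lam c)) := by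
  have hq := h0.ne'
  have hH : ∀ c : ℕ, planeHook (m + 2) k ε lam (-1 - (c : ℤ)) (-1 - (c : ℤ)) =
      (topExp m k ε lam : ℕ) - colHook (m + 2) k ε lam c := fun c => by
    rw [planeHook, if_pos ⟨rfl, by omega⟩, topExp_eq, show -1 - (-1 - (c : ℤ)) = c by ring]
  have hs : ∀ c : ℕ, c + 2 < m + 2 → 1 - q ^ planeHook (m + 2) k ε lam (-1 - (c : ℤ)) (-1 - (c : ℤ)) =
      1 - q ^ topExp m k ε lam / q ^ (shiftedPart m lam (c + 2) + 2) := fun c hc => by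
    rw [hH, colHook_of_le (by omega) (by omega),
      show (c : ℤ) + 2 = ((c + 2 : ℕ) : ℤ) by push_cast; ring,
      rowHook_eq_shiftedPart hc, zpow_sub₀ hq, zpow_natCast, zpow_natCast]
  have h00 : planeHook (m + 2) k ε lam 0 (-1) =
      (topExp m k ε lam : ℕ) - ((shiftedPart m lam 1 + 2 : ℕ) : ℤ) := by
    rw [planeHook, if_neg (by omega), if_neg (by omega), colHook_neg_one, topExp_eq,
      rowHook_of_lt le_rfl (by omega), shiftedPart]
    simp
    omega
  have h10 : planeHook (m + 2) k ε lam 1 (-1) =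
      (topExp m k ε lam : ℕ) - ((shiftedPart m lam 0 + 2 : ℕ) : ℤ) := by
    rw [planeHook, if_neg (by omega), if_neg (by omega), colHook_neg_one, topExp_eq,
      rowHook_of_lt (by omega) (by omega), shiftedPart]
    simp
    omega
  have hprod : (1 - q ^ planeHook (m + 2) k ε lam (-1) (-1)) *
      ∏ j ∈ Finset.range (lam 0 + (m + 2) - 1),
        (1 - q ^ planeHook (m + 2) k ε lam (-2 - (j : ℤ)) (-2 - (j : ℤ))) =
      ∏ c ∈ Finset.range (lam 0 + (m + 2)),
        (1 - q ^ planeHook (m + 2) k ε lam (-1 - (c : ℤ)) (-1 - (c : ℤ))) := by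
    rw [show lam 0 + (m + 2) = lam 0 + (m + 2) - 1 + 1 by omega, Finset.prod_range_succ', mul_comm]
    refine congrArg₂ (· * ·) (Finset.prod_congr (by simp) fun j _ => ?_) (by simp)
    rw [show -2 - (j : ℤ) = -1 - ((j + 1 : ℕ) : ℤ) by push_cast; ring]
  have hsplit : ∏ c ∈ Finset.range (lam 0 + (m + 2)),
      (1 - q ^ planeHook (m + 2) k ε lam (-1 - (c : ℤ)) (-1 - (c : ℤ))) =
      (∏ c ∈ Finset.range m, (1 - q ^ topExp m k ε lam / q ^ (shiftedPart m lam (c + 2) + 2))) *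
      ((1 - q ^ topExp m k ε lam / q ^ ε) * (1 - q ^ topExp m k ε lam * q / q ^ ε)) *
      ∏ c ∈ Finset.Ico (m + 2) (lam 0 + (m + 2)),
        (1 - q ^ (topExp m k ε lam + 2 + columnGap m lam c)) := by
    rw [← Finset.prod_range_mul_prod_Ico _ (show m + 2 ≤ lam 0 + (m + 2) by omega),
      Finset.prod_range_succ, Finset.prod_range_succ, mul_assoc (Finset.prod _ _)]
    refine congrArg₂ (· * ·) (congrArg₂ (· * ·) (Finset.prod_congr rfl fun c hc => ?_)
      (congrArg₂ (· * ·) ?_ ?_)) (Finset.prod_congr rfl fun c hc => ?_)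
    · exact hs c (by have := Finset.mem_range.1 hc; omega)
    · rw [hH, colHook_of_le (by omega) (by omega),
        show (m : ℤ) + 2 = ((m + 2 : ℕ) : ℤ) by push_cast; ring, rowHook_self, zpow_sub₀ hq,
        zpow_natCast, zpow_natCast]
    · rw [hH, show ((m + 1 : ℕ) : ℤ) = ((m + 2 : ℕ) : ℤ) - 1 by push_cast; ring,
        colHook_sub_one (by omega), zpow_sub₀ hq, zpow_sub₀ hq, zpow_natCast, zpow_natCast,
        zpow_one, div_div_eq_mul_div]
    · have hc := Finset.mem_Ico.1 hc
      rw [hH, colHook_eq_columnGap hm hc.1, sub_neg_eq_add, ← Nat.cast_add, zpow_natCast,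
        show topExp m k ε lam + (columnGap m lam c + 2) =
          topExp m k ε lam + 2 + columnGap m lam c by ring]
  rw [mul_assoc (1 - q ^ planeHook (m + 2) k ε lam 1 (-1)), hprod, hsplit,
    Finset.prod_range_succ', Finset.prod_range_succ', h00, h10, zpow_sub₀ hq, zpow_sub₀ hq,
    zpow_natCast, zpow_natCast, zpow_natCast]
  simp only [zero_add]
  ring

/-- The interval statement for row `0`. With `D` the size of the main part, the right-hand side
consists of the geometric factor of the diagonal and the factors of the chain on top. -/
theorem prod_top_columnGap (hlam : Antitone lam) (D : ℕ) :
    (∏ s ∈ Finset.range (m + 2), (1 - q ^ (D + shiftedPart m lam s))) *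
      ∏ c ∈ Finset.Ico (m + 2) (lam 0 + (m + 2)), (1 - q ^ (D + columnGap m lam c)) =
    (1 - q ^ D) * ∏ i ∈ Finset.range (lam 0 + (m + 2) - 1), (1 - q ^ (D + i + 1)) := by
  have h := prod_shiftedPart_mul_prod_columnGap (m := m) hlam (show 0 < m + 2 by omega)
    fun i => 1 - q ^ (D + i)
  have hM : lam 0 + (m + 2) - 1 = shiftedPart m lam 0 := by
    unfold shiftedPart
    omega
  rw [Finset.range_eq_Ico, Finset.prod_eq_prod_Ico_succ_bot (by omega), mul_assoc]
  have hI : Finset.Ico (0 + 1) (m + 2) = Finset.Ioo 0 (m + 2) := rfl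
  rw [hI, h, hM, mul_comm, ← Finset.prod_range_succ fun i => 1 - q ^ (D + i), Finset.prod_range_succ',
    mul_comm]
  rfl

end HookRows

/-! ### Comparison of the hook product with the sum -/

section HookFormulaProduct

variable {m k ε : ℕ} {lam : ℕ → ℕ} {q : ℝ}

theorem prod_one_sub_pow_hookLength (h0 : 0 < q) (hm : 1 ≤ m) (hk : 1 ≤ k) (hε : ε = 0 ∨ ε = 1)
    (hlam : IsPar (m + 2) lam) :
    ∏ x : SwivelShifted (m + 2) k ε lam, (1 - q ^ hookLength x) =
      (∏ r ∈ Finset.range (m + 2), ((∏ s ∈ Finset.Ioo r (m + 2),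
          (1 - q ^ (shiftedPart m lam r + 2) * q ^ (shiftedPart m lam s + 2))) *
        ∏ c ∈ Finset.Ico (m + 2) (lam r + (m + 2)),
          (1 - q ^ (shiftedPart m lam r - columnGap m lam c)))) *
      (∏ r ∈ Finset.range (m + 2), endFactor q ε (q ^ (shiftedPart m lam r + 2))) *
      (qPoch q (k - 1) * (1 - q) ^ ε) *
      ((∏ s ∈ Finset.range (m + 2),
        (1 - q ^ topExp m k ε lam / q ^ (shiftedPart m lam s + 2))) *
      ((1 - q ^ topExp m k ε lam / q ^ ε) * (1 - q ^ topExp m k ε lam * q / q ^ ε)) *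
      ∏ c ∈ Finset.Ico (m + 2) (lam 0 + (m + 2)),
        (1 - q ^ (topExp m k ε lam + 2 + columnGap m lam c))) := by
  have hn : 3 ≤ m + 2 := by omega
  have hcongr : ∏ x : SwivelShifted (m + 2) k ε lam, (1 - q ^ hookLength x) =
      ∏ x, (fun p : ℤ × ℤ => 1 - q ^ planeHook (m + 2) k ε lam p.1 p.2)
        (plane (m + 2) k ε lam x) := by
    refine Finset.prod_congr rfl fun x _ => ?_
    dsimp only
    rw [← hookLength_eq_planeHook hn hk hε hlam, zpow_natCast]
  have h01 : planeHook (m + 2) k ε lam (-1) 0 =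
      ((shiftedPart m lam 0 + 2 + (shiftedPart m lam 1 + 2) : ℕ) : ℤ) := by
    rw [planeHook, if_neg (by omega), if_neg (by omega), rowHook_neg_one,
      colHook_of_le le_rfl (by omega), rowHook_of_lt (by omega) (by omega)]
    simp [shiftedPart]
    omega
  have hrow : ∀ r ∈ Finset.range (m + 1),
      ∏ c ∈ Finset.Ico (r + 1) (lam (r + 1) + m + 3),
        (1 - q ^ planeHook (m + 2) k ε lam ((r + 1 : ℕ) : ℤ) ((c : ℤ) - 1)) =
      (∏ s ∈ Finset.Ioo (r + 1) (m + 2),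
        (1 - q ^ (shiftedPart m lam (r + 1) + 2) * q ^ (shiftedPart m lam s + 2))) *
        endFactor q ε (q ^ (shiftedPart m lam (r + 1) + 2)) *
        ∏ c ∈ Finset.Ico (m + 2) (lam (r + 1) + (m + 2)),
          (1 - q ^ (shiftedPart m lam (r + 1) - columnGap m lam c)) := fun r hr => by
    have hr := Finset.mem_range.1 hr
    exact prod_row h0 hm hlam.1 (by omega) (by omega) (by omega)
  -- The hook at `(-1, 0)` is the sum of the row contributions of rows `0` and `1`. That cell
  -- therefore takes the place of `(0, -1)` in row `0`, and `(0, -1)` is counted with the top.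
  have hrow0 : (∏ c ∈ Finset.Ico 0 (lam 0 + m + 3),
        (1 - q ^ planeHook (m + 2) k ε lam ((0 : ℕ) : ℤ) ((c : ℤ) - 1))) *
        (1 - q ^ planeHook (m + 2) k ε lam (-1) 0) =
      (∏ s ∈ Finset.Ioo 0 (m + 2),
        (1 - q ^ (shiftedPart m lam 0 + 2) * q ^ (shiftedPart m lam s + 2))) *
        endFactor q ε (q ^ (shiftedPart m lam 0 + 2)) *
        (∏ c ∈ Finset.Ico (m + 2) (lam 0 + (m + 2)),
          (1 - q ^ (shiftedPart m lam 0 - columnGap m lam c))) *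
        (1 - q ^ planeHook (m + 2) k ε lam 0 (-1)) := by
    have hI : Finset.Ioo 0 (m + 2) = Finset.Ico 1 (m + 2) := rfl
    rw [Finset.prod_eq_prod_Ico_succ_bot (by omega), hI,
      Finset.prod_eq_prod_Ico_succ_bot (show 1 < m + 2 by omega), zero_add,
      prod_row h0 hm hlam.1 (by omega) le_rfl (by omega), h01, zpow_natCast,
      pow_add q (shiftedPart m lam 0 + 2)]
    simp only [Nat.cast_zero, zero_sub]
    ring
  have hleg : ∏ i ∈ Finset.range (k - 1),
      (1 - q ^ planeHook (m + 2) k ε lam ((m : ℤ) + 3 + i) (-1)) = qPoch q (k - 1) := by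
    rw [qPoch, ← Finset.prod_range_reflect]
    refine Finset.prod_congr rfl fun i hi => ?_
    have hi := Finset.mem_range.1 hi
    rw [planeHook, if_neg (by omega), if_pos (by omega),
      show ((m + 2 : ℕ) : ℤ) + k - ((m : ℤ) + 3 + ((k - 1 - 1 - i : ℕ) : ℤ)) =
        ((i + 1 : ℕ) : ℤ) by omega, zpow_natCast]
  have heps : ∏ _i ∈ Finset.range ε,
      (1 - q ^ planeHook (m + 2) k ε lam ((m : ℤ) + 2) ((m : ℤ) + 1)) = (1 - q) ^ ε := by
    rw [Finset.prod_const, Finset.card_range]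
    rcases hε with rfl | rfl
    · rw [pow_zero, pow_zero]
    · rw [planeHook, if_neg (by omega), if_neg (by omega),
        show (m : ℤ) + 2 = ((m + 2 : ℕ) : ℤ) by push_cast; ring,
        show (m : ℤ) + 1 = ((m + 2 : ℕ) : ℤ) - 1 by push_cast; ring, rowHook_self,
        colHook_sub_one hn]
      simp
  have htop := prod_top (k := k) (ε := ε) (lam := lam) h0 hm
  have hp := prod_plane (m := m) (ε := ε) hk lam
    (fun p : ℤ × ℤ => 1 - q ^ planeHook (m + 2) k ε lam p.1 p.2)
  refine (hcongr.trans hp).trans ?_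
  dsimp only
  rw [hleg, heps, ← htop, ← Finset.prod_mul_distrib, Finset.prod_range_succ',
    Finset.prod_congr rfl hrow, Finset.prod_range_succ' _ (m + 1),
    Finset.prod_congr rfl fun r _ => mul_right_comm _ (endFactor _ _ _) _]
  linear_combination (∏ r ∈ Finset.range (m + 1), ((∏ s ∈ Finset.Ioo (r + 1) (m + 2),
        (1 - q ^ (shiftedPart m lam (r + 1) + 2) * q ^ (shiftedPart m lam s + 2))) *
        (∏ c ∈ Finset.Ico (m + 2) (lam (r + 1) + (m + 2)),
          (1 - q ^ (shiftedPart m lam (r + 1) - columnGap m lam c))) *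
        endFactor q ε (q ^ (shiftedPart m lam (r + 1) + 2)))) *
    (qPoch q (k - 1) * (1 - q) ^ ε) * ((1 - q ^ planeHook (m + 2) k ε lam 1 (-1)) *
      (1 - q ^ planeHook (m + 2) k ε lam (-1) (-1)) *
      ∏ j ∈ Finset.range (lam 0 + (m + 2) - 1),
        (1 - q ^ planeHook (m + 2) k ε lam (-2 - (j : ℤ)) (-2 - (j : ℤ)))) * hrow0

theorem vdm_eq_prod_range {n : ℕ} (v : ℕ → ℝ) :
    vdm (fun i : Fin n => v i) =
      ∏ r ∈ Finset.range n, ∏ s ∈ Finset.Ioo r n, (v s - v r) / (1 - v r * v s) := by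
  rw [vdm, Finset.prod_range]
  refine Finset.prod_congr rfl fun r _ => ?_
  have h : Finset.Ioo (r : ℕ) n = (Finset.range n).filter fun s => (r : ℕ) < s := by
    ext s
    simp [and_comm]
  rw [h, Finset.prod_filter, Finset.prod_range]
  rfl

theorem prod_prod_Ioo (v : ℕ → ℝ) (n : ℕ) :
    ∏ r ∈ Finset.range n, ∏ s ∈ Finset.Ioo r n, v s = ∏ s ∈ Finset.range n, v s ^ s := by
  rw [Finset.prod_comm' (t' := Finset.range n) (s' := fun s => Finset.range s)]
  · simp
  · intro r s
    simp only [Finset.mem_range, Finset.mem_Ioo]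
    omega

/-- The denominators of `vdm` cancel the hooks pairing two rows. A numerator is `v s` times `1 - q ^
(shiftedPart r - shiftedPart s)`, and these complete the hooks of `λ` to `qPoch`. -/
theorem vdm_mul_prod (h0 : 0 < q) (h1 : q < 1) (hlam : Antitone lam) :
    vdm (fun i : Fin (m + 2) => q ^ (shiftedPart m lam i + 2)) *
      ∏ r ∈ Finset.range (m + 2), ((∏ s ∈ Finset.Ioo r (m + 2),
          (1 - q ^ (shiftedPart m lam r + 2) * q ^ (shiftedPart m lam s + 2))) *
        ∏ c ∈ Finset.Ico (m + 2) (lam r + (m + 2)),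
          (1 - q ^ (shiftedPart m lam r - columnGap m lam c))) =
    q ^ (∑ s ∈ Finset.range (m + 2), (shiftedPart m lam s + 2) * s) *
      ∏ r ∈ Finset.range (m + 2), qPoch q (shiftedPart m lam r) := by
  have hW : q ^ (∑ s ∈ Finset.range (m + 2), (shiftedPart m lam s + 2) * s) =
      ∏ r ∈ Finset.range (m + 2), ∏ s ∈ Finset.Ioo r (m + 2), q ^ (shiftedPart m lam s + 2) := by
    rw [prod_prod_Ioo fun s => q ^ (shiftedPart m lam s + 2), ← Finset.prod_pow_eq_pow_sum]
    exact Finset.prod_congr rfl fun s _ => pow_mul _ _ _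
  rw [vdm_eq_prod_range fun s => q ^ (shiftedPart m lam s + 2), ← Finset.prod_mul_distrib, hW,
    ← Finset.prod_mul_distrib]
  refine Finset.prod_congr rfl fun r hr => ?_
  have hr := Finset.mem_range.1 hr
  rw [← prod_sub_mul_prod_columnGap hlam hr, ← mul_assoc, ← mul_assoc, ← Finset.prod_mul_distrib,
    ← Finset.prod_mul_distrib]
  refine congrArg (· * _) (Finset.prod_congr rfl fun s hs => ?_)
  have hs := Finset.mem_Ioo.1 hs
  have h := shiftedPart_lt hlam hs.1 hs.2
  have hne : 1 - q ^ (shiftedPart m lam r + 2) * q ^ (shiftedPart m lam s + 2) ≠ 0 := by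
    rw [← pow_add]
    exact (sub_pos.2 (pow_lt_one₀ h0.le h1 (by omega))).ne'
  rw [div_mul_cancel₀ _ hne, mul_sub, mul_one, ← pow_add]
  congr 2
  omega

theorem swivelConst_eq (h0 : 0 < q) (hε : ε = 0 ∨ ε = 1) :
    swivelConst q m k ε lam = (q ^ ε / q) ^ (m + 2) *
      (∏ s ∈ Finset.range (m + 2), q ^ (shiftedPart m lam s + 2)) *
      q ^ (∑ s ∈ Finset.range (m + 2), (shiftedPart m lam s + 2) * s) *
      (∏ r ∈ Finset.range (m + 2), qPoch q (shiftedPart m lam r)) * qPoch q (k + 1) *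
      (1 - q) ^ (m + 2) * (1 - q) ^ ε := by
  have hq := h0.ne'
  have hε' : qPoch q ε = (1 - q) ^ ε := by
    rcases hε with rfl | rfl <;> simp [qPoch]
  have hprod : ∏ i : Fin m, (q ^ ((i : ℕ) + 2) * (1 - q)) =
      q ^ (∑ i ∈ Finset.range m, (i + 2)) * (1 - q) ^ m := by
    rw [← Finset.prod_range fun i => q ^ (i + 2) * (1 - q), Finset.prod_mul_distrib,
      Finset.prod_pow_eq_pow_sum, Finset.prod_const, Finset.card_range]
  have hsum : ∑ i ∈ Finset.range m, (i + 2) + ∑ i ∈ Finset.range (m + 3), i + 1 + (m + 2) =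
      2 * ∑ s ∈ Finset.range (m + 2), s + 2 * (m + 2) := by
    simp only [Finset.sum_range_succ, Finset.sum_add_distrib, Finset.sum_const,
      Finset.card_range, smul_eq_mul]
    omega
  have e1 : ∑ i : Fin (m + 3), (i : ℕ) = ∑ i ∈ Finset.range (m + 3), i :=
    (Finset.sum_range fun i => i).symm
  have e2 : ∑ i : Fin (m + 2), (lam i + (m + 1 - i)) =
      ∑ s ∈ Finset.range (m + 2), shiftedPart m lam s :=
    (Finset.sum_range (shiftedPart m lam)).symm
  have e3 : fillConst q (fun r => lam r + (m + 1 - r)) (m + 2) =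
      q ^ (∑ s ∈ Finset.range (m + 2), s * shiftedPart m lam s) *
        ∏ r ∈ Finset.range (m + 2), qPoch q (shiftedPart m lam r) := rfl
  have e4 : ∑ s ∈ Finset.range (m + 2), (shiftedPart m lam s + 2) * s =
      ∑ s ∈ Finset.range (m + 2), s * shiftedPart m lam s + 2 * ∑ s ∈ Finset.range (m + 2), s := by
    rw [Finset.mul_sum, ← Finset.sum_add_distrib]
    exact Finset.sum_congr rfl fun s _ => by ring
  have e5 : ∑ s ∈ Finset.range (m + 2), (shiftedPart m lam s + 2) =
      ∑ s ∈ Finset.range (m + 2), shiftedPart m lam s + 2 * (m + 2) := by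
    rw [Finset.sum_add_distrib]
    simp
    ring
  rw [swivelConst, e1, e2, e3, hprod, hε', Finset.prod_pow_eq_pow_sum, e4, e5, div_pow, ← pow_mul,
    mul_comm ε, div_mul_eq_mul_div, div_mul_eq_mul_div, div_mul_eq_mul_div, div_mul_eq_mul_div,
    div_mul_eq_mul_div, div_mul_eq_mul_div, eq_div_iff (pow_ne_zero _ hq)]
  generalize ∑ i ∈ Finset.range m, (i + 2) = A at hsum ⊢
  generalize ∑ i ∈ Finset.range (m + 3), i = B at hsum ⊢
  generalize ∑ i ∈ Finset.range (m + 2), i = C at hsum ⊢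
  have key : q ^ A * q ^ B * q * q ^ (m + 2) = q ^ (2 * C) * q ^ (2 * (m + 2)) := by
    rw [← pow_add, ← pow_succ, ← pow_add, ← pow_add, hsum]
  rw [pow_add q _ (2 * C), pow_add q _ (2 * (m + 2)), pow_add (1 - q)]
  generalize q ^ A = qA at key ⊢
  generalize q ^ B = qB at key ⊢
  generalize q ^ (2 * C) = qC at key ⊢
  generalize q ^ (2 * (m + 2)) = qM at key ⊢
  generalize q ^ (m + 2) = qM' at key ⊢
  linear_combination (q ^ (∑ s ∈ Finset.range (m + 2), shiftedPart m lam s) *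
    q ^ (∑ s ∈ Finset.range (m + 2), s * shiftedPart m lam s) *
    (∏ r ∈ Finset.range (m + 2), qPoch q (shiftedPart m lam r)) * qPoch q (k + 1) *
    q ^ ((m + 2) * ε) * (1 - q) ^ m * (1 - q) ^ 2 * (1 - q) ^ ε) * key

/-- With `Q = q ^ topExp` the additional node, the products of `v s - Q`, `1 - v s * Q` and
`endFactor` in the value of the sum match the hooks of `prod_top` and `prod_row`; the rest is the
constant of the block weights. -/
theorem hookProduct_mul_swivelValue (h0 : 0 < q) (h1 : q < 1) (hm : 1 ≤ m) (hk : 1 ≤ k)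
    (hε : ε = 0 ∨ ε = 1) (hlam : IsPar (m + 2) lam) :
    (∏ x : SwivelShifted (m + 2) k ε lam, (1 - q ^ hookLength x)) *
      swivelValue q ε k (fun i : Fin (m + 2) => q ^ (shiftedPart m lam i + 2)) =
    swivelConst q m k ε lam * ((1 - q ^ (topExp m k ε lam + 2)) *
      ∏ i ∈ Finset.range (lam 0 + (m + 2) - 1), (1 - q ^ (topExp m k ε lam + 2 + i + 1))) := by
  have hq := h0.ne'
  have hpow : ∀ e : ℕ, 1 ≤ e → 1 - q ^ e ≠ 0 := fun e he =>
    (sub_pos.2 (pow_lt_one₀ h0.le h1 (by omega))).ne'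
  set Q := q ^ topExp m k ε lam with hQ
  set v : ℕ → ℝ := fun s => q ^ (shiftedPart m lam s + 2) with hv
  have hVpos : (∏ s ∈ Finset.range (m + 2), v s) ≠ 0 :=
    Finset.prod_ne_zero_iff.2 fun s _ => pow_ne_zero _ hq
  have hVQ : q ^ ε / q * (∏ s ∈ Finset.range (m + 2), v s) * q * q ^ k = Q := by
    rw [hQ, hv, Finset.prod_pow_eq_pow_sum, Finset.sum_add_distrib, topExp]
    simp only [Finset.sum_const, Finset.card_range, smul_eq_mul]
    field_simp
    ring
  have hNne : ∏ s ∈ Finset.range (m + 2), (v s - Q) ≠ 0 := by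
    refine Finset.prod_ne_zero_iff.2 fun s hs => (sub_pos.2 ?_).ne'
    refine pow_lt_pow_right_of_lt_one₀ h0 h1 ?_
    have := Finset.single_le_sum (f := shiftedPart m lam) (fun _ _ => Nat.zero_le _) hs
    unfold topExp
    omega
  have hEne : ∏ r ∈ Finset.range (m + 2), endFactor q ε (v r) ≠ 0 :=
    Finset.prod_ne_zero_iff.2 fun s _ => (endFactor_pos h0 h1 ε (by omega)).ne'
  have hS2 : ∏ s ∈ Finset.range (m + 2), (1 - Q / v s) =
      (∏ s ∈ Finset.range (m + 2), (v s - Q)) / ∏ s ∈ Finset.range (m + 2), v s := by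
    rw [← Finset.prod_div_distrib]
    refine Finset.prod_congr rfl fun s _ => ?_
    rw [sub_div, div_self (pow_ne_zero _ hq)]
  have hS1 : (∏ s ∈ Finset.range (m + 2), (1 - v s * Q)) *
      ∏ c ∈ Finset.Ico (m + 2) (lam 0 + (m + 2)),
        (1 - q ^ (topExp m k ε lam + 2 + columnGap m lam c)) =
      (1 - q ^ (topExp m k ε lam + 2)) *
      ∏ i ∈ Finset.range (lam 0 + (m + 2) - 1), (1 - q ^ (topExp m k ε lam + 2 + i + 1)) := by
    rw [← prod_top_columnGap hlam.1]
    refine congrArg (· * _) (Finset.prod_congr rfl fun s _ => ?_)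
    rw [hv, hQ, ← pow_add]
    congr 2
    ring
  have hQ1 : 2 ≤ topExp m k ε lam := by
    unfold topExp
    omega
  have hd0 : 1 - Q ≠ 0 := hpow _ (by omega)
  have hd1 : 1 - Q * q ≠ 0 := by
    rw [hQ, ← pow_succ]
    exact hpow _ (by omega)
  have hd2 : 1 - Q / q ≠ 0 := by
    obtain ⟨d, hd⟩ := Nat.exists_eq_add_of_le' hQ1
    rw [hQ, hd, pow_succ, mul_div_cancel_right₀ _ hq]
    exact hpow _ (by omega)
  -- The factor `1 - g Q` of the node and the hooks of the diagonal cells belonging to the columns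
  -- `n - 2` and `n - 1` make up the three denominators of `swivelValue`.
  have heps : (1 - q ^ ε * (q ^ ε / q) * Q) * ((1 - Q / q ^ ε) * (1 - Q * q / q ^ ε)) =
      (1 - Q / q) * (1 - Q) * (1 - Q * q) := by
    rcases hε with rfl | rfl
    · simp only [pow_zero]
      ring
    · simp only [pow_one]
      field_simp
  have hkq : qPoch q (k - 1) * ((1 - q ^ k) * (1 - q * q ^ k)) = qPoch q (k + 1) := by
    obtain ⟨j, rfl⟩ := Nat.exists_eq_add_of_le' hk
    simp only [qPoch, Finset.prod_range_succ, Nat.add_sub_cancel]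
    ring
  have hval : swivelValue q ε k (fun i : Fin (m + 2) => v i) =
      (q ^ ε / q) ^ m * (1 - q) ^ m * (∏ r ∈ Finset.range (m + 2), endFactor q ε (v r))⁻¹ *
      vdm (fun i : Fin (m + 2) => v i) *
      ((∏ s ∈ Finset.range (m + 2), (1 - v s * Q)) * (∏ s ∈ Finset.range (m + 2), (v s - Q))⁻¹ *
        ((1 - q ^ ε * (q ^ ε / q) * Q) * ((1 - q) ^ 2 *
          ((q ^ ε / q) * ∏ s ∈ Finset.range (m + 2), v s) ^ 2 * ((1 - q ^ k) * (1 - q * q ^ k))) *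
          ((1 - Q / q) * (1 - Q) * (1 - Q * q))⁻¹)) := by
    have hb : q ^ ε / q - q ^ ε = q ^ ε / q * (1 - q) := by
      field_simp
    have r1 : q ^ ε / q * (∏ s ∈ Finset.range (m + 2), v s) * q ^ k = Q / q := by
      rw [← hVQ]
      field_simp
    have r2 : q ^ ε / q * (∏ s ∈ Finset.range (m + 2), v s) * q ^ 2 * q ^ k = Q * q := by
      rw [← hVQ]
      ring
    simp only [swivelValue]
    rw [← Finset.prod_range fun i => v i, ← Finset.prod_range fun i => endFactor q ε (v i), hVQ, r1,
      r2, ← Finset.prod_range fun i => 1 - v i * Q, ← Finset.prod_range fun i => v i - Q, hb, mul_pow]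
    ring
  have hvdm := vdm_mul_prod (m := m) h0 h1 hlam.1
  rw [prod_one_sub_pow_hookLength h0 hm hk hε hlam, hval, swivelConst_eq h0 hε, hS2, ← hS1, ← hkq]
  have heps' := mul_inv_cancel₀ (mul_ne_zero (mul_ne_zero hd2 hd0) hd1)
  nth_rewrite 1 [← heps] at heps'
  have hE' := mul_inv_cancel₀ hEne
  have hN' := mul_inv_cancel₀ hNne
  have hV' := mul_inv_cancel₀ hVpos
  rw [div_eq_mul_inv]
  generalize (∏ s ∈ Finset.range (m + 2), v s) = V at *
  generalize (∏ r ∈ Finset.range (m + 2), endFactor q ε (v r)) = E at *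
  generalize (∏ s ∈ Finset.range (m + 2), (v s - Q)) = N at *
  generalize q ^ ε / q = b at *
  rw [← hQ]
  change vdm (fun i : Fin (m + 2) => v i) * _ = _ at hvdm
  rw [mul_assoc (b ^ (m + 2) * V), ← hvdm]
  generalize vdm (fun i : Fin (m + 2) => v i) = vd at *
  generalize (∏ r ∈ Finset.range (m + 2), ((∏ s ∈ Finset.Ioo r (m + 2),
          (1 - q ^ (shiftedPart m lam r + 2) * q ^ (shiftedPart m lam s + 2))) *
        ∏ c ∈ Finset.Ico (m + 2) (lam r + (m + 2)),
          (1 - q ^ (shiftedPart m lam r - columnGap m lam c)))) = PT at *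
  generalize (∏ s ∈ Finset.range (m + 2), (1 - v s * Q)) = S at *
  generalize (∏ c ∈ Finset.Ico (m + 2) (lam 0 + (m + 2)),
        (1 - q ^ (topExp m k ε lam + 2 + columnGap m lam c))) = T at *
  generalize (1 - q ^ ε * b * Q) = g at *
  generalize (1 - Q / q ^ ε) * (1 - Q * q / q ^ ε) = et at *
  generalize ((1 - Q / q) * (1 - Q) * (1 - Q * q))⁻¹ = d at *
  generalize (1 - q ^ k) * (1 - q * q ^ k) = kk at *
  generalize qPoch q (k - 1) = kq at *
  generalize E⁻¹ = E' at *
  generalize N⁻¹ = N' at *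
  generalize V⁻¹ = V' at *
  generalize (1 - q) ^ ε = eq at *
  calc _ = (E * E') * (N * N') * (V * V') * (g * et * d) *
      (b ^ (m + 2) * V * (vd * PT) * (kq * kk) * (1 - q) ^ (m + 2) * eq * (S * T)) := by ring
    _ = _ := by
      rw [hE', hN', hV', heps']
      ring

theorem swivelConst_pos (h0 : 0 < q) (h1 : q < 1) : 0 < swivelConst q m k ε lam := by
  have h : 0 < 1 - q := sub_pos.2 h1
  have h2 := qPoch_pos h0 h1 (k + 1)
  have h3 := qPoch_pos h0 h1 ε
  have h4 := fillConst_pos h0 h1 (fun r => lam r + (m + 1 - r)) (m + 2)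
  have h5 : 0 < ∏ i : Fin m, (q ^ ((i : ℕ) + 2) * (1 - q)) :=
    Finset.prod_pos fun i _ => by positivity
  unfold swivelConst
  positivity

end HookFormulaProduct
end DComplete

theorem mainTheorem6 (n k ε : ℕ) (hn : 3 ≤ n) (hk : 1 ≤ k) (hε : ε = 0 ∨ ε = 1)
    (lam : ℕ → ℕ) (hlam : DComplete.IsPar n lam) :
    DComplete.HasHookLengthProperty (DComplete.SwivelShifted n k ε lam) := by
  open DComplete in
  obtain ⟨m, rfl⟩ := Nat.exists_eq_add_of_le' (show 2 ≤ n by omega)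
  have hm : 1 ≤ m := by omega
  have hpos : ∀ x : SwivelShifted (m + 2) k ε lam, 0 < hookLength x := fun x => by
    have := planeHook_pos hn hε hlam (shape_plane hn hk hε x)
    rw [← hookLength_eq_planeHook hn hk hε hlam] at this
    omega
  refine ⟨swivelShifted_isDComplete hn hk hε hlam, GF_eq_prod _ hpos fun q h0 h1 => ?_⟩
  have h := (hasPartitionSum_swivelPoset h0 h1 hk hε hlam).chain h0 h1 (lam 0 + (m + 2) - 1)
  have key := hookProduct_mul_swivelValue h0 h1 hm hk hε hlam
  have hH : ∏ x : SwivelShifted (m + 2) k ε lam, (1 - q ^ hookLength x) ≠ 0 :=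
    Finset.prod_ne_zero_iff.2 fun x _ =>
      (sub_pos.2 (pow_lt_one₀ h0.le h1 (hpos x).ne')).ne'
  -- The size of the main part is also the shift `D` with which `prod_top_columnGap` was used, so
  -- the geometric factor and the chain factors match.
  have hD : Fintype.card (PosetP (m + 2 + 1) (X11 (m + 2) k ε lam)) = topExp m k ε lam + 2 := by
    rw [card_swivelPoset hk, topExp, Finset.sum_range]
    simp only [shiftedPart]
    ring
  convert! h using 1
  rw [← card_swivelPoset (ε := ε) hk, hD]
  change _ = _ * (_ * (_ * swivelValue q ε k fun i : Fin (m + 2) =>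
    q ^ (shiftedPart m lam i + 2)))
  have hc : swivelConst q m k ε lam ≠ 0 := (swivelConst_pos h0 h1).ne'
  have hpow : ∀ e : ℕ, 1 - q ^ (e + 1) ≠ 0 := fun e =>
    (sub_pos.2 (pow_lt_one₀ h0.le h1 (by omega))).ne'
  have hd : 1 - q ^ (topExp m k ε lam + 2) ≠ 0 := hpow _
  have hp : ∏ i ∈ Finset.range (lam 0 + (m + 2) - 1),
      (1 - q ^ (topExp m k ε lam + 2 + i + 1)) ≠ 0 := Finset.prod_ne_zero_iff.2 fun i _ => hpow _
  refine (eq_inv_of_mul_eq_one_left ?_).symm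
  generalize (∏ x : SwivelShifted (m + 2) k ε lam, (1 - q ^ hookLength x)) = H at *
  generalize (∏ i ∈ Finset.range (lam 0 + (m + 2) - 1),
      (1 - q ^ (topExp m k ε lam + 2 + i + 1))) = p at *
  calc _ = (H * swivelValue q ε k fun i : Fin (m + 2) => q ^ (shiftedPart m lam i + 2)) *
        (p⁻¹ * (swivelConst q m k ε lam)⁻¹ * (1 - q ^ (topExp m k ε lam + 2))⁻¹) := by ring
    _ = (p * p⁻¹) * (swivelConst q m k ε lam * (swivelConst q m k ε lam)⁻¹) *
        ((1 - q ^ (topExp m k ε lam + 2)) * (1 - q ^ (topExp m k ε lam + 2))⁻¹) := by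
      rw [key]
      ring
    _ = 1 := by rw [mul_inv_cancel₀ hp, mul_inv_cancel₀ hc, mul_inv_cancel₀ hd, one_mul, one_mul]
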